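/- **Setting.** Let $0<\delta<\tfrac12$, $M>0$, $\mathbb T^2=\mathbb R^2/\mathbb Z^2$, $\Lambda=\mathbb R\times\mathbb T^2$, and $$\mathfrak h=L^2(\mathbb R)\otimes H^{-\frac{1+2\delta}2}(\mathbb T^2)\otimes\mathbb C^4,\qquad \langle f,g\rangle_{\mathfrak h}=\int_{\mathbb R}\int_{\mathbb T^2}\langle(-\Delta+M^2)^{-\frac{1+2\delta}2}f,g\rangle_{\mathbb C^4}\,dx\,dt .$$ Let $\kappa$ be complex conjugation on $\mathfrak h$, let $\slashed\nabla=\begin{pmatrix}0&-\partial_1+i\partial_2\\-\partial_1-i\partial_2&0\end{pmatrix}$, let $\overline{\slashed\nabla}$ be its complex conjugate, and with respect to $\mathbb C^4=\mathbb C^2\oplus\mathbb C^2$ let $$U=\sqrt{-\Delta+M^2}\begin{pmatrix}0&(-\slashed\nabla+M)^{-1}\\-(\overline{\slashed\nabla}+M)^{-1}&0\end{pmatrix}.$$ **Algebra.** Let $\Gamma=(\Gamma_n)_{n\in\mathbb N}$ be an increasing sequence of sets of finite-dimensional $\kappa U$-invariant subspaces of $\mathfrak h$, with $\dim b\le n$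 for $b\in\Gamma_n$ and $\bigcup_n\bigcup_{b\in\Gamma_n}b$ dense in $\mathfrak h$. Consider the free unital algebra generated by symbols $\alpha^\dagger(f)$ (linear in $f\in\mathfrak h$) and $\alpha(f)$ (antilinear in $f$). For a finite-dimensional $b$ let $\pi_b$ be its representation on the fermionic Fock space of $b$ that sends $\alpha^{\dagger}(f)$, $\alpha(f)$ to the creation and annihilation operators of $P_bf$, where $P_b$ is the orthogonal projection onto $b$. The extended CAR algebra $\mathscr A=\mathscr A(\Gamma)$ is the Hausdorff completion of the free algebra with respect to the seminorms $\|a\|_n=\sup_{b\in\Gamma_n}\|\pi_b(a)\|$, $n\in\mathbb N$. Put $\Psi(f)=\alpha^\dagger(f)+\alpha(\kappa Uf)$, and let $\psi$, $\bar\psi$ be the first and the second $\mathbb C^2$-component of $\Psi$. Let $\Psi^{\diamond2}:\mathfrak h\otimes\mathfrak h\to\mathscr A$ be the (unique) continuous linear map with $\Psi^{\diamond2}(f\otimes g)=\Psi(f)\Psi(g)-[\alpha(\kappa Uf),\alpha^\dagger(g)]_+$. **Kernels.** Let $\mathcal K(t,x)=\mathbf 1_{t>0}(4\pi t)^{-1}e^{-|x|^2/4t}$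 be the heat kernel. Let $\phi:\mathbb R^2\to[0,1]$ be smooth and compactly supported with $\sum_{k\in\mathbb Z^2}\phi(x+k)=1$ for all $x$, and let $\chi:\mathbb R\to[0,1]$ be smooth with $\chi=1$ on $(-\infty,1]$ and $\chi=0$ on $[2,\infty)$. Let $\mathcal I_F$ be convolution with $e^{-tM^2}\sum_{k\in\mathbb Z^2}\chi(t)\phi(x)\mathcal K(t,x+k)$, and let $G$ be the kernel of its transpose, so that $(\mathcal I_Fu)(z)=u(G(\cdot-z))$. Let $\rho\in C_c^\infty(\mathbb R^3;\mathbb R)$ be radially symmetric with $\int\rho=1$, let $\rho_\varepsilon(t,x)=\varepsilon^{-4}\rho(\varepsilon^{-2}t,\varepsilon^{-1}x)$ and $G_\varepsilon=G*\rho_\varepsilon$, let $\psi_\varepsilon=\psi*\rho_\varepsilon$, $\bar\psi_\varepsilon=\bar\psi*\rho_\varepsilon$, and put $$X_\varepsilon=(\slashed\nabla+M)\mathcal I_F\psi_\varepsilon,\qquad \bar X_\varepsilon=(-\overline{\slashed\nabla}+M)\mathcal I_F\bar\psi_\varepsilon .$$ Let $g_{z,j},\bar g_{z,j}$ ($j=1,2$)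 be the vectors (formally, elements of $\mathfrak h$) for which the $j$-th components of $(\slashed\nabla+M)\mathcal I_F\psi$ and $(-\overline{\slashed\nabla}+M)\mathcal I_F\bar\psi$ at $z$ are $\Psi(g_{z,j})$ and $\Psi(\bar g_{z,j})$; explicitly, $g_{z,j}$ consists of the $j$-th column of $(-\overline{\slashed\nabla}+M)\,G(\cdot-z)$ in the first $\mathbb C^2$ and $0$ in the second, and $\bar g_{z,j}$ of $0$ in the first $\mathbb C^2$ and the $j$-th column of $(\slashed\nabla+M)\,G(\cdot-z)$ in the second. Let $g_{z,j}^\varepsilon,\bar g_{z,j}^\varepsilon$ be the same with $G_\varepsilon$ in place of $G$. The *fermionic Wick square* and its mollified version are the $\mathscr A$-valued distributions $$Y(\eta)=\Psi^{\diamond2}\Big(\int\eta(z)\sum_{j=1}^2\bar g_{z,j}\otimes g_{z,j}\,dz\Big),\qquad Y_\varepsilon(\eta)=\Psi^{\diamond2}\Big(\int\eta(z)\sum_{j=1}^2\bar g^\varepsilon_{z,j}\otimes g^\varepsilon_{z,j}\,dz\Big),\qquad \eta\in C_c^\infty(\mathbb R^3).$$ **Spaces.** Let $|z|_{\mathfrak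 s}=\sqrt{|t|}+|x_1|+|x_2|$ and $(\mathcal S^\lambda_z\eta)(w)=\lambda^{-4}\eta(\lambda^{-2}(w_0-z_0),\lambda^{-1}(w_1-z_1),\lambda^{-1}(w_2-z_2))$. For $\alpha<0$, with $r=-\lfloor\alpha\rfloor$, for a seminorm $p$ and $K\subseteq\mathbb R^3$ put $$\|\xi\|_{\alpha;K,p}=\sup_{z\in K}\ \sup_{\eta}\ \sup_{0<\lambda\le1}\lambda^{-\alpha}p\big(\xi(\mathcal S^\lambda_z\eta)\big)+\sup_{z\in K}\ \sup_\eta\ p\big(\xi(\mathcal S^1_z\eta)\big),$$ $\eta$ ranging over the smooth functions supported in $\{|z|_{\mathfrak s}\le1\}$ with $\|\eta\|_{C^r}\le1$. Let $\mathcal C^\alpha_{\mathfrak s}(\Lambda;\mathscr A)$ be the space of spatially $\mathbb Z^2$-periodic continuous linear maps $\xi:C_c^\infty(\mathbb R^3)\to\mathscr A$ with $\|\xi\|_{\alpha;K,\|\cdot\|_n}<\infty$ for all compact $K$ and all $n$, with the topology of these seminorms. Write $\|\xi\|_{\alpha;n}=\|\xi\|_{\alpha;\mathbb R^3,\|\cdot\|_n}$.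 **Proposition.** 1. The objects above are well defined: $\Psi^{\diamond2}$ exists and is unique; for all $\eta$ and all $\varepsilon>0$ the smeared kernels in the definitions of $Y(\eta)$ and $Y_\varepsilon(\eta)$ lie in $\mathfrak h\otimes\mathfrak h$; and $g^\varepsilon_{z,j},\bar g^\varepsilon_{z,j}\in\mathfrak h$. Moreover $Y_\varepsilon$ is the renormalised product $$Y_\varepsilon(z)=\sum_{j=1}^2\bar X_{\varepsilon,j}(z)X_{\varepsilon,j}(z)-\sum_{j=1}^2\big[\alpha(\kappa U\bar g^\varepsilon_{z,j}),\alpha^\dagger(g^\varepsilon_{z,j})\big]_+ ,$$ that is, $L(Y_\varepsilon(\eta))=\int\eta(z)\,L(Y_\varepsilon(z))\,dz$ for every continuous linear functional $L$ on $\mathscr A$. 2. $Y\in\mathcal C^{-1+2\delta}_{\mathfrak s}(\Lambda;\mathscr A)$. 3. For every $n\in\mathbb N$ there is a constant $C>0$ (which may depend on the fixed data $\delta,M,\rho,\phi,\chi$, but not on $\Gamma,\nu,\varepsilon$) such that for all $\nu\in(0,1]$ and all $\varepsilon\in(0,1]$ $$\|Y-Y_\varepsilon\|_{-1+2\delta-\nu;n}\le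 C\,\varepsilon^{\nu/4}.$$ 4. Hence, for every $\nu\in(0,1]$, $Y$ and all $Y_\varepsilon$ lie in $\mathcal C^{-1+2\delta-\nu}_{\mathfrak s}(\Lambda;\mathscr A)$, and $Y_\varepsilon\to Y$ there as $\varepsilon\downarrow0$. -/

import Mathlib

open MeasureTheory Filter Topology
open scoped ENNReal NNReal ContDiff Distributions

noncomputable section

namespace FermionicWick

/-! ## The extended CAR algebra of a Hilbert space -/

section ExtendedCAR

variable {H : Type*} [NormedAddCommGroup H] [InnerProductSpace ℂ H]

/-- The Grassmannian of all finite-dimensional subspaces of `H`. -/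
abbrev Gr (H : Type*) [NormedAddCommGroup H] [InnerProductSpace ℂ H] : Type _ :=
  {b : Submodule ℂ H // FiniteDimensional ℂ b}

instance (b : Gr H) : FiniteDimensional ℂ b.1 := b.2

variable (H) in
/-- The free algebra generated by symbols `α†(f)`, linear in `f ∈ H`, and `α(f)`, antilinear in
`f ∈ H`: the tensor algebra of `H ⊕ H̄`, where the conjugate space `H̄` is identified with the dual
`H'` through `f ↦ ⟨f, ·⟩`. -/
abbrev FreeAlg : Type _ := TensorAlgebra ℂ (H × StrongDual ℂ H)

/-- The symbol `α†(f)`. -/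
def create (f : H) : FreeAlg H := TensorAlgebra.ι ℂ (f, 0)

/-- The symbol `α(f)`. -/
def annih (f : H) : FreeAlg H := TensorAlgebra.ι ℂ (0, innerSL ℂ f)

/-- The fermionic Fock space `ℱ_a(ℂᵈ)` has the orthonormal basis `e_S = √(m!) e_{i₁} ∧ ⋯ ∧ e_{i_m}`,
`S = {i₁ < ⋯ < i_m} ⊆ {0, …, d-1}`. This is the matrix of the creation operator
`α†(e_i) : e_T ↦ (-1)^{#{j ∈ T : j < i}} e_{T ∪ {i}}` (`0` if `i ∈ T`) in this basis. -/
def ladder {d : ℕ} (i : Fin d) : Matrix (Finset (Fin d)) (Finset (Fin d)) ℂ :=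
  Matrix.of fun S T =>
    if i ∉ T ∧ S = insert i T then (-1) ^ (T.filter (fun j => j < i)).card else 0

/-- `(f, ℓ) ↦ α†(P_b f) + α(P_b g)` on the Fock space of `b`, where `ℓ = ⟨g, ·⟩`, in terms of an
orthonormal basis `(e_i)` of `b`: `P_b f = ∑ ⟨e_i, f⟩ e_i`, and `α(P_b g) = ∑ ⟨g, e_i⟩ α(e_i)`. -/
def carGenerator (b : Gr H) :
    (H × StrongDual ℂ H) →ₗ[ℂ] Matrix (Finset (Fin (Module.finrank ℂ b.1)))
      (Finset (Fin (Module.finrank ℂ b.1))) ℂ where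
  toFun x := ∑ i, (inner ℂ ((stdOrthonormalBasis ℂ b.1 i : b.1) : H) x.1 • ladder i +
    x.2 ((stdOrthonormalBasis ℂ b.1 i : b.1) : H) • (ladder i).conjTranspose)
  map_add' x y := by
    rw [← Finset.sum_add_distrib]
    refine Finset.sum_congr rfl fun i _ => ?_
    simp only [Prod.fst_add, Prod.snd_add, inner_add_right, add_apply, add_smul]
    abel
  map_smul' c x := by
    simp only [Prod.smul_fst, Prod.smul_snd, inner_smul_right, smul_apply,
      smul_eq_mul, mul_smul, RingHom.id_apply, Finset.smul_sum, smul_add]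

/-- The representation `π_b` of the free algebra on the Fock space of `b`, i.e. the morphism into
the CAR algebra of `b` with `π_b(α†(f)) = α†(P_b f)` and `π_b(α(f)) = α(P_b f)`. -/
def carRep (b : Gr H) :
    FreeAlg H →ₐ[ℂ] Matrix (Finset (Fin (Module.finrank ℂ b.1)))
      (Finset (Fin (Module.finrank ℂ b.1))) ℂ :=
  TensorAlgebra.lift ℂ (carGenerator b)

/-- The seminorm `‖φ‖_b = ‖π_b(φ)‖`, with the operator norm on the Fock space of `b`. -/
def carSeminorm (b : Gr H) : Seminorm ℂ (FreeAlg H) :=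
  (normSeminorm ℂ
    (EuclideanSpace ℂ (Finset (Fin (Module.finrank ℂ b.1))) →L[ℂ]
      EuclideanSpace ℂ (Finset (Fin (Module.finrank ℂ b.1))))).comp
    ((Matrix.toEuclideanCLM (𝕜 := ℂ) :
        Matrix (Finset (Fin (Module.finrank ℂ b.1)))
          (Finset (Fin (Module.finrank ℂ b.1))) ℂ ≃⋆ₐ[ℂ] _).toAlgEquiv.toLinearMap ∘ₗ
      (carRep b).toLinearMap)

/-- A filtration of the set of all finite-dimensional subspaces of `H` that are invariant under
the antiunitary map `J` (in the application, `J = κU`). -/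
structure Filtration (J : H → H) where
  /-- the sets `Γ_n` -/
  pts : ℕ → Set (Gr H)
  invariant : ∀ n, ∀ b ∈ pts n, ∀ f ∈ b.1, J f ∈ b.1
  mono : ∀ m n, m ≤ n → pts m ⊆ pts n
  dim_le : ∀ n, ∀ b ∈ pts n, Module.finrank ℂ b.1 ≤ n
  dense : Dense (⋃ n, ⋃ b ∈ pts n, (b.1 : Set H))

variable {J : H → H}

/-- The seminorm `‖φ‖_n = sup_{b ∈ Γ_n} ‖φ‖_b` on the free algebra. -/
def preSeminorm (Γ : Filtration J) (n : ℕ) : Seminorm ℂ (FreeAlg H) :=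
  ⨆ b : Γ.pts n, carSeminorm b.1

/-- The free algebra, endowed with the topology generated by the seminorms `‖·‖_n`. -/
def PreAlg (_Γ : Filtration J) : Type _ := FreeAlg H

instance (Γ : Filtration J) : Ring (PreAlg Γ) := inferInstanceAs (Ring (FreeAlg H))

instance (Γ : Filtration J) : Algebra ℂ (PreAlg Γ) := inferInstanceAs (Algebra ℂ (FreeAlg H))

/-- The seminorms `‖·‖_n`, `n ∈ ℕ`, as a family. -/
def seminormFamily (Γ : Filtration J) : SeminormFamily ℂ (PreAlg Γ) ℕ := preSeminorm Γ

instance (Γ : Filtration J) : TopologicalSpace (PreAlg Γ) :=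
  (seminormFamily Γ).moduleFilterBasis.topology

theorem withSeminorms (Γ : Filtration J) : WithSeminorms (seminormFamily Γ) := ⟨rfl⟩

instance (Γ : Filtration J) : IsTopologicalAddGroup (PreAlg Γ) :=
  (withSeminorms Γ).topologicalAddGroup

instance (Γ : Filtration J) : ContinuousSMul ℂ (PreAlg Γ) :=
  (withSeminorms Γ).continuousSMul

instance (Γ : Filtration J) : UniformSpace (PreAlg Γ) :=
  IsTopologicalAddGroup.rightUniformSpace (PreAlg Γ)

instance (Γ : Filtration J) : IsUniformAddGroup (PreAlg Γ) := isUniformAddGroup_of_addCommGroup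

instance (Γ : Filtration J) : UniformContinuousConstSMul ℂ (PreAlg Γ) :=
  uniformContinuousConstSMul_of_continuousConstSMul ℂ (PreAlg Γ)

/-- The extended CAR algebra `𝒜`: the Hausdorff completion of the free algebra with respect to the
seminorms `‖·‖_n`. (Passing to the Hausdorff completion includes dividing
out the elements on which all these seminorms vanish.) -/
abbrev ExtCAR (Γ : Filtration J) : Type _ := UniformSpace.Completion (PreAlg Γ)

/-- The canonical map of the free algebra into the extended CAR algebra. -/
def toExt (Γ : Filtration J) (φ : FreeAlg H) : ExtCAR Γ :=
  UniformSpace.Completion.coe' (α := PreAlg Γ) φ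

/-- The seminorm `‖·‖_n`, extended by continuity to the extended CAR algebra. -/
def extNorm (Γ : Filtration J) (n : ℕ) : ExtCAR Γ → ℝ :=
  UniformSpace.Completion.extension (seminormFamily Γ n)

theorem extNorm_toExt (Γ : Filtration J) (n : ℕ) (φ : FreeAlg H) :
    extNorm Γ n (toExt Γ φ) = preSeminorm Γ n φ :=
  UniformSpace.Completion.extension_coe (Seminorm.uniformContinuous_of_continuousAt_zero
    ((withSeminorms Γ).continuous_seminorm n).continuousAt) (φ : PreAlg Γ)

/-- The supremum that defines `‖·‖_n` is finite. -/
theorem bddAbove_carSeminorm (Γ : Filtration J) (n : ℕ) :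
    BddAbove (Set.range fun b : Γ.pts n => carSeminorm b.1) := by
  rw [Seminorm.bddAbove_range_iff]
  intro φ
  have key : ∃ C : ℝ, ∀ b : Γ.pts n, carSeminorm b.1 φ ≤ C := by
    have hdef : ∀ (b : Gr H) (φ : FreeAlg H), carSeminorm b φ =
      ‖Matrix.toEuclideanCLM (𝕜 := ℂ) (carRep b φ)‖ := fun _ _ => rfl
    simp only [hdef]
    induction φ using TensorAlgebra.induction with
    | algebraMap r =>
      refine ⟨‖r‖ * 1, fun b => ?_⟩
      rw [AlgHom.commutes, Algebra.algebraMap_eq_smul_one, map_smul, map_one, norm_smul]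
      gcongr
      exact ContinuousLinearMap.norm_id_le
    | mul x y hx hy =>
      obtain ⟨C, hC⟩ := hx
      obtain ⟨D, hD⟩ := hy
      refine ⟨C * D, fun b => ?_⟩
      rw [map_mul, map_mul]
      exact (norm_mul_le _ _).trans (mul_le_mul (hC b) (hD b) (norm_nonneg _)
        ((norm_nonneg _).trans (hC b)))
    | add x y hx hy =>
      obtain ⟨C, hC⟩ := hx
      obtain ⟨D, hD⟩ := hy
      refine ⟨C + D, fun b => ?_⟩
      rw [map_add, map_add]
      exact (norm_add_le _ _).trans (add_le_add (hC b) (hD b))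
    | ι x =>
      let B : ℕ → ℝ := fun d => ∑ i : Fin d,
        (‖x.1‖ * ‖Matrix.toEuclideanCLM (𝕜 := ℂ) (ladder i)‖ +
          ‖x.2‖ * ‖Matrix.toEuclideanCLM (𝕜 := ℂ) (ladder i).conjTranspose‖)
      have hB : ∀ d, 0 ≤ B d := fun d => Finset.sum_nonneg fun i _ => by positivity
      refine ⟨∑ d ∈ Finset.range (n + 1), B d, fun b => ?_⟩
      have h1 : ‖Matrix.toEuclideanCLM (𝕜 := ℂ) (carRep b.1 (TensorAlgebra.ι ℂ x))‖ ≤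
          B (Module.finrank ℂ b.1.1) := by
        rw [carRep, TensorAlgebra.lift_ι_apply]
        change ‖Matrix.toEuclideanCLM (𝕜 := ℂ) (carGenerator b.1 x)‖ ≤ _
        rw [carGenerator, LinearMap.coe_mk, AddHom.coe_mk]
        rw [map_sum]
        refine (norm_sum_le _ _).trans (Finset.sum_le_sum fun i _ => ?_)
        rw [map_add, map_smul, map_smul]
        have he : ‖((stdOrthonormalBasis ℂ b.1.1 i : b.1.1) : H)‖ = 1 := by
          rw [← Submodule.coe_norm]
          exact (stdOrthonormalBasis ℂ b.1.1).orthonormal.1 i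
        refine (norm_add_le _ _).trans ?_
        rw [norm_smul, norm_smul]
        gcongr
        · exact (norm_inner_le_norm _ _).trans (by rw [he, one_mul])
        · exact (x.2.le_opNorm _).trans (by rw [he, mul_one])
      refine h1.trans (Finset.single_le_sum (f := B) (fun d _ => hB d) ?_)
      rw [Finset.mem_range]
      exact Nat.lt_succ_of_le (Γ.dim_le n b.1 b.2)
  obtain ⟨C, hC⟩ := key
  exact ⟨C, by rintro _ ⟨b, rfl⟩; exact hC b⟩

theorem preSeminorm_apply (Γ : Filtration J) (n : ℕ) (φ : FreeAlg H) :
    preSeminorm Γ n φ = ⨆ b : Γ.pts n, carSeminorm b.1 φ :=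
  Seminorm.iSup_apply (bddAbove_carSeminorm Γ n)

theorem preSeminorm_mul_le (Γ : Filtration J) (n : ℕ) (x y : FreeAlg H) :
    preSeminorm Γ n (x * y) ≤ preSeminorm Γ n x * preSeminorm Γ n y := by
  have hb : ∀ z : FreeAlg H, BddAbove (Set.range fun b : Γ.pts n => carSeminorm b.1 z) :=
    (Seminorm.bddAbove_range_iff).1 (bddAbove_carSeminorm Γ n)
  have hle : ∀ (z : FreeAlg H) (b : Γ.pts n), carSeminorm b.1 z ≤ preSeminorm Γ n z := fun z b => by
    rw [preSeminorm_apply]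
    exact le_ciSup (hb z) b
  rw [preSeminorm_apply Γ n (x * y)]
  refine Real.iSup_le (fun b => ?_) (mul_nonneg (apply_nonneg _ _) (apply_nonneg _ _))
  have h1 : carSeminorm b.1 (x * y) ≤
      carSeminorm b.1 x * carSeminorm b.1 y := by
    change ‖Matrix.toEuclideanCLM (𝕜 := ℂ) (carRep b.1 (x * y))‖ ≤
      ‖Matrix.toEuclideanCLM (𝕜 := ℂ) (carRep b.1 x)‖ *
        ‖Matrix.toEuclideanCLM (𝕜 := ℂ) (carRep b.1 y)‖
    rw [map_mul, map_mul]
    exact norm_mul_le _ _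
  exact h1.trans (mul_le_mul (hle _ b) (hle _ b) (apply_nonneg _ _) (apply_nonneg _ _))

theorem seminormFamily_mul_le (Γ : Filtration J) (n : ℕ) (x y : PreAlg Γ) :
    seminormFamily Γ n (x * y) ≤ seminormFamily Γ n x * seminormFamily Γ n y :=
  preSeminorm_mul_le Γ n x y

instance (Γ : Filtration J) : IsTopologicalRing (PreAlg Γ) where
  toContinuousMul := by
    refine ⟨continuous_iff_continuousAt.2 fun ⟨a, b⟩ => ?_⟩
    refine ((withSeminorms Γ).tendsto_nhds _ _).2 fun n ε hε => ?_
    have hc : Continuous (seminormFamily Γ n) := (withSeminorms Γ).continuous_seminorm n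
    have h1 : Tendsto (fun z : PreAlg Γ × PreAlg Γ =>
        seminormFamily Γ n (z.1 - a) * seminormFamily Γ n z.2 +
          seminormFamily Γ n a * seminormFamily Γ n (z.2 - b)) (𝓝 (a, b)) (𝓝 0) := by
      have : Continuous (fun z : PreAlg Γ × PreAlg Γ =>
        seminormFamily Γ n (z.1 - a) * seminormFamily Γ n z.2 +
          seminormFamily Γ n a * seminormFamily Γ n (z.2 - b)) := by fun_prop
      have h := this.tendsto (a, b)
      simpa using h
    filter_upwards [h1.eventually (gt_mem_nhds hε)] with z hz
    refine lt_of_le_of_lt ?_ hz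
    have : z.1 * z.2 - a * b = (z.1 - a) * z.2 + a * (z.2 - b) := by noncomm_ring
    rw [this]
    exact (map_add_le_add _ _ _).trans
      (add_le_add (seminormFamily_mul_le Γ n _ _) (seminormFamily_mul_le Γ n _ _))

/-- The fermionic field `Ψ(f) = α†(f) + α(J f)` in the extended CAR algebra; here `J = κU`. -/
def field (Γ : Filtration J) (f : H) : ExtCAR Γ := toExt Γ (create f) + toExt Γ (annih (J f))

/-- The anticommutator `[α(J f), α†(g)]₊` in the extended CAR algebra; here `J = κU`. -/
def contraction (Γ : Filtration J) (f g : H) : ExtCAR Γ :=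
  toExt Γ (annih (J f)) * toExt Γ (create g) + toExt Γ (create g) * toExt Γ (annih (J f))

end ExtendedCAR

/-! ## The one-particle space `𝔥 = L²(ℝ) ⊗ H^{-(1+2δ)/2}(𝕋²) ⊗ ℂ⁴`, `κ` and `U` -/

/-- `ℂ⁴ = ℂ² ⊕ ℂ²`: the pair `(s, a)` is the component `a` of the first (`s = 0`, for `ψ`) or of
the second (`s = 1`, for `ψ̄`) spinor. -/
abbrev Comp : Type := Fin 2 × Fin 2

/-- Arguments `(t, k, i)`: time, spatial frequency in `ℤ²` (for the torus `𝕋² = ℝ²/ℤ²`),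
component. -/
abbrev Mode : Type := ℝ × (ℤ × ℤ) × Comp

/-- The Fourier symbol `4π²|k|² + M²` of `-Δ + M²` on `𝕋²`. -/
def symbolSq (M : ℝ) (k : ℤ × ℤ) : ℝ :=
  4 * Real.pi ^ 2 * ((k.1 : ℝ) ^ 2 + (k.2 : ℝ) ^ 2) + M ^ 2

/-- Counting measure on `ℤ²`, weighted by the symbol of `(-Δ + M²)^{-(1+2δ)/2}`. -/
def momentumMeasure (δ M : ℝ) : Measure (ℤ × ℤ) :=
  Measure.count.withDensity fun k => ENNReal.ofReal (symbolSq M k ^ (-(1 + 2 * δ) / 2))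

instance (δ M : ℝ) : SigmaFinite (momentumMeasure δ M) :=
  SigmaFinite.withDensity_ofReal _

/-- The measure `dt ⊗ (weighted counting measure on ℤ²) ⊗ (counting measure)`. -/
def modeMeasure (δ M : ℝ) : Measure Mode :=
  (volume : Measure ℝ).prod ((momentumMeasure δ M).prod Measure.count)

instance (δ M : ℝ) : SigmaFinite (modeMeasure δ M) := by
  unfold modeMeasure; infer_instance

/-- The one-particle space `𝔥`, with `f ∈ 𝔥` represented by its spatial Fourier coefficients
`f̂_i(t, k)`: by Parseval's identity, `⟨f, g⟩ = ∫ ∑_k ∑_i (4π²|k|²+M²)^{-(1+2δ)/2}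
conj f̂_i(t, k) ĝ_i(t, k) dt`. -/
abbrev OneParticle (δ M : ℝ) : Type := Lp ℂ 2 (modeMeasure δ M)

/-- The Hilbert space tensor product `𝔥 ⊗ 𝔥`. -/
abbrev TwoParticle (δ M : ℝ) : Type := Lp ℂ 2 ((modeMeasure δ M).prod (modeMeasure δ M))

/-- The Fourier symbol of `∇̸ = [[0, -∂₁ + i∂₂], [-∂₁ - i∂₂, 0]]`. -/
def diracSymbol (k : ℤ × ℤ) : Matrix (Fin 2) (Fin 2) ℂ :=
  !![0, -(2 * Real.pi * Complex.I * k.1) + Complex.I * (2 * Real.pi * Complex.I * k.2);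
    -(2 * Real.pi * Complex.I * k.1) - Complex.I * (2 * Real.pi * Complex.I * k.2), 0]

/-- The Fourier symbol of the complex conjugate operator
`[[0, -∂₁ - i∂₂], [-∂₁ + i∂₂, 0]]` of `∇̸`. -/
def diracBarSymbol (k : ℤ × ℤ) : Matrix (Fin 2) (Fin 2) ℂ :=
  !![0, -(2 * Real.pi * Complex.I * k.1) - Complex.I * (2 * Real.pi * Complex.I * k.2);
    -(2 * Real.pi * Complex.I * k.1) + Complex.I * (2 * Real.pi * Complex.I * k.2), 0]

/-- The Fourier symbol of `U = √(-Δ+M²) [[0, (-∇̸+M)⁻¹], [-(∇̸‾+M)⁻¹, 0]]`. -/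
def unitarySymbol (M : ℝ) (k : ℤ × ℤ) : Matrix Comp Comp ℂ :=
  Matrix.of fun i j => (Real.sqrt (symbolSq M k) : ℂ) *
    (if i.1 = 0 ∧ j.1 = 1 then ((-diracSymbol k + (M : ℂ) • 1)⁻¹) i.2 j.2
    else if i.1 = 1 ∧ j.1 = 0 then -((diracBarSymbol k + (M : ℂ) • 1)⁻¹) i.2 j.2
    else 0)

theorem symbolSq_eq_mul (M : ℝ) (k : ℤ × ℤ) : (symbolSq M k : ℂ) = (M : ℂ) ^ 2 -
    (-(2 * Real.pi * Complex.I * k.1) + Complex.I * (2 * Real.pi * Complex.I * k.2)) *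
    (-(2 * Real.pi * Complex.I * k.1) - Complex.I * (2 * Real.pi * Complex.I * k.2)) := by
  have h : Complex.I ^ 2 = -1 := Complex.I_sq
  have h4 : Complex.I ^ 4 = 1 := Complex.I_pow_four
  simp only [symbolSq]
  push_cast
  ring_nf
  rw [h, h4]
  ring

theorem norm_sqrt_mul_inv_le {b : ℝ} (hb : 0 ≤ b) {e : ℂ} (he : ‖e‖ ≤ √b) :
    ‖(√b : ℂ) * ((b : ℂ)⁻¹ * e)‖ ≤ 1 := by
  rw [norm_mul, norm_mul, norm_inv, Complex.norm_real, Complex.norm_real, Real.norm_of_nonneg hb,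
    Real.norm_of_nonneg (Real.sqrt_nonneg b)]
  rcases hb.eq_or_lt with rfl | hb
  · simp
  · calc √b * (b⁻¹ * ‖e‖) ≤ √b * (b⁻¹ * √b) := by gcongr
      _ = b⁻¹ * (√b * √b) := by ring
      _ = 1 := by rw [Real.mul_self_sqrt hb.le]; exact inv_mul_cancel₀ hb.ne'

theorem symbolSq_nonneg (M : ℝ) (k : ℤ × ℤ) : 0 ≤ symbolSq M k := by
  unfold symbolSq; positivity

theorem norm_entry_le (M : ℝ) (k : ℤ × ℤ) :
    ‖(M : ℂ)‖ ≤ √(symbolSq M k) ∧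
    ‖-(2 * Real.pi * Complex.I * k.1) + Complex.I * (2 * Real.pi * Complex.I * k.2)‖ ≤
      √(symbolSq M k) ∧
    ‖-(2 * Real.pi * Complex.I * k.1) - Complex.I * (2 * Real.pi * Complex.I * k.2)‖ ≤
      √(symbolSq M k) := by
  have h1 : -(2 * Real.pi * Complex.I * k.1) + Complex.I * (2 * Real.pi * Complex.I * k.2) =
      ((-(2 * Real.pi * k.2) : ℝ) : ℂ) + ((-(2 * Real.pi * k.1) : ℝ) : ℂ) * Complex.I := by
    push_cast; linear_combination (2 * Real.pi * k.2) * Complex.I_sq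
  have h2 : -(2 * Real.pi * Complex.I * k.1) - Complex.I * (2 * Real.pi * Complex.I * k.2) =
      (((2 * Real.pi * k.2) : ℝ) : ℂ) + ((-(2 * Real.pi * k.1) : ℝ) : ℂ) * Complex.I := by
    push_cast; linear_combination (-(2 * Real.pi * k.2)) * Complex.I_sq
  refine ⟨?_, ?_, ?_⟩
  · rw [Complex.norm_real, Real.norm_eq_abs]
    apply Real.abs_le_sqrt
    unfold symbolSq
    have : 0 ≤ 4 * Real.pi ^ 2 * ((k.1 : ℝ) ^ 2 + (k.2 : ℝ) ^ 2) := by positivity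
    linarith
  · rw [h1, Complex.norm_add_mul_I]
    apply Real.sqrt_le_sqrt
    unfold symbolSq
    nlinarith [sq_nonneg M]
  · rw [h2, Complex.norm_add_mul_I]
    apply Real.sqrt_le_sqrt
    unfold symbolSq
    nlinarith [sq_nonneg M]

/-- The entries of the (unitary) matrix `unitarySymbol M k` are bounded. -/
theorem norm_unitarySymbol_le (M : ℝ) (k : ℤ × ℤ) (i j : Comp) : ‖unitarySymbol M k i j‖ ≤ 1 := by
  obtain ⟨hM, h1, h2⟩ := norm_entry_le M k
  have hs := symbolSq_eq_mul M k
  have hn := symbolSq_nonneg M k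
  have key : ∀ A : Matrix (Fin 2) (Fin 2) ℂ, A.det = (symbolSq M k : ℂ) →
      (∀ a b, ‖A.adjugate a b‖ ≤ √(symbolSq M k)) → ∀ a b,
      ‖(√(symbolSq M k) : ℂ) * A⁻¹ a b‖ ≤ 1 := by
    intro A hA hadj a b
    rw [Matrix.inv_def, Matrix.smul_apply, hA, Ring.inverse_eq_inv', smul_eq_mul]
    exact norm_sqrt_mul_inv_le hn (hadj a b)
  obtain ⟨i1, i2⟩ := i
  obtain ⟨j1, j2⟩ := j
  simp only [unitarySymbol, Matrix.of_apply]
  split_ifs with h h'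
  · refine key _ ?_ ?_ _ _
    · rw [hs, Matrix.det_fin_two]; simp [diracSymbol]; ring
    · have h1' := h1
      have h2' := h2
      rw [← norm_neg] at h1' h2'
      intro a b
      fin_cases a <;> fin_cases b <;>
        simp [Matrix.adjugate_fin_two, diracSymbol] at hM h1 h2 h1' h2' ⊢ <;>
        assumption
  · rw [mul_neg, norm_neg]
    refine key _ ?_ ?_ _ _
    · rw [hs, Matrix.det_fin_two]; simp [diracBarSymbol]; ring
    · have h1' := h1
      have h2' := h2
      rw [← norm_neg] at h1' h2'
      intro a b
      fin_cases a <;> fin_cases b <;>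
        simp [Matrix.adjugate_fin_two, diracBarSymbol] at hM h1 h2 h1' h2' ⊢ <;>
        assumption
  · simp

/-- `(t, k, i) ↦ (t, -k, j)`. -/
def reflect (j : Comp) (p : Mode) : Mode := (p.1, -p.2.1, j)

theorem map_reflect_le (δ M : ℝ) (j : Comp) :
    (modeMeasure δ M).map (reflect j) ≤ (4 : ℝ≥0) • modeMeasure δ M := by
  have hneg : (momentumMeasure δ M).map (fun k => -k) = momentumMeasure δ M := by
    refine Measure.ext_of_singleton fun k => ?_
    rw [Measure.map_apply (by fun_prop) (measurableSet_singleton k)]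
    have : (fun k : ℤ × ℤ => -k) ⁻¹' {k} = {-k} := by
      ext x; simp
    rw [this, momentumMeasure, withDensity_apply _ (measurableSet_singleton _),
      withDensity_apply _ (measurableSet_singleton _)]
    simp [symbolSq]
  have hconst : (Measure.count : Measure Comp).map (fun _ => j) ≤
      (4 : ℝ≥0) • (Measure.count : Measure Comp) := by
    rw [Measure.map_const]
    refine Measure.le_iff.2 fun s hs => ?_
    rw [Measure.smul_apply, Measure.smul_apply, Measure.dirac_apply' _ hs]
    by_cases hj : j ∈ s
    · have h1 : (1 : ℝ≥0∞) ≤ Measure.count s := by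
        rw [← Measure.count_singleton j]
        exact measure_mono (Set.singleton_subset_iff.2 hj)
      have h4 : (Measure.count : Measure Comp) Set.univ = 4 := by
        rw [Measure.count_univ]; simp
      rw [h4]
      simp only [hj, Set.indicator_of_mem, Pi.one_apply, smul_eq_mul, mul_one]
      calc (4 : ℝ≥0∞) = 4 * 1 := by simp
        _ ≤ 4 * Measure.count s := by gcongr
        _ = _ := by rw [ENNReal.smul_def, smul_eq_mul]; norm_num
    · simp [hj]
  have hmap : (modeMeasure δ M).map (reflect j) = (volume : Measure ℝ).prod
      ((momentumMeasure δ M).prod ((Measure.count : Measure Comp).map fun _ => j)) := by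
    have h2 : ((momentumMeasure δ M).prod (Measure.count : Measure Comp)).map
        (Prod.map (fun k => -k) (fun _ => j)) =
        (momentumMeasure δ M).prod ((Measure.count : Measure Comp).map fun _ => j) := by
      rw [← Measure.map_prod_map _ _ (by fun_prop) (by fun_prop), hneg]
    have h3 : reflect j = Prod.map id (Prod.map (fun k => -k) (fun _ => j)) := rfl
    rw [modeMeasure, h3, ← Measure.map_prod_map _ _ measurable_id
      (Measurable.prodMap (by fun_prop) (by fun_prop)), h2, Measure.map_id]
  rw [hmap]
  calc _ ≤ (volume : Measure ℝ).prod ((momentumMeasure δ M).prod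
        ((4 : ℝ≥0) • (Measure.count : Measure Comp))) :=
      Measure.prod_mono le_rfl (Measure.prod_mono le_rfl hconst)
    _ = _ := by rw [Measure.prod_smul_right, Measure.prod_smul_right, modeMeasure]

/-- The function that represents `κ U f`: complex conjugation `κ` sends a function with Fourier
coefficients `ĝ(k)` to the function with Fourier coefficients `conj ĝ(-k)`. -/
def conjUFun (M : ℝ) (f : Mode → ℂ) (p : Mode) : ℂ :=
  starRingEnd ℂ (∑ j : Comp, unitarySymbol M (-p.2.1) p.2.2 j * f (p.1, -p.2.1, j))

theorem memLp_conjUFun {δ M : ℝ} {f : Mode → ℂ} (hf : MemLp f 2 (modeMeasure δ M)) :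
    MemLp (conjUFun M f) 2 (modeMeasure δ M) := by
  have hmeas : ∀ j, Measurable (reflect j) := fun j => by
    unfold reflect
    refine measurable_fst.prodMk (Measurable.prodMk ?_ measurable_const)
    exact (measurable_of_countable (fun k : ℤ × ℤ => -k)).comp measurable_snd.fst
  have h : ∀ j : Comp, MemLp (fun p : Mode => unitarySymbol M (-p.2.1) p.2.2 j *
      f (p.1, -p.2.1, j)) 2 (modeMeasure δ M) := by
    intro j
    have h1 : MemLp (f ∘ reflect j) 2 (modeMeasure δ M) :=
      (hf.of_measure_le_smul (by simp) (map_reflect_le δ M j)).comp_of_map (hmeas j).aemeasurable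
    have h2 : AEStronglyMeasurable (fun p : Mode => unitarySymbol M (-p.2.1) p.2.2 j)
        (modeMeasure δ M) := by
      refine Measurable.aestronglyMeasurable ?_
      exact (measurable_of_countable (fun q : (ℤ × ℤ) × Comp =>
        unitarySymbol M (-q.1) q.2 j)).comp measurable_snd
    have h3 : ∀ p : Mode, ‖unitarySymbol M (-p.2.1) p.2.2 j * f (p.1, -p.2.1, j)‖ ≤
        ‖(f ∘ reflect j) p‖ := fun p => by
      rw [norm_mul]
      exact mul_le_of_le_one_left (norm_nonneg _) (norm_unitarySymbol_le _ _ _ _)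
    exact h1.mono (h2.mul h1.1) (Eventually.of_forall h3)
  exact (memLp_finsetSum Finset.univ fun j _ => h j).star

/-- The antiunitary map `κU` on the one-particle space. -/
def conjU (δ M : ℝ) (f : OneParticle δ M) : OneParticle δ M :=
  (memLp_conjUFun (Lp.memLp f)).toLp _

/-- The function `(p, q) ↦ f(p) g(q)` that represents `f ⊗ g`. -/
def tensorFun {δ M : ℝ} (f g : OneParticle δ M) (p : Mode × Mode) : ℂ := f p.1 * g p.2

theorem memLp_tensorFun {δ M : ℝ} (f g : OneParticle δ M) :
    MemLp (tensorFun f g) 2 ((modeMeasure δ M).prod (modeMeasure δ M)) := by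
  have hf := Lp.memLp f
  have hg := Lp.memLp g
  have hm : AEStronglyMeasurable (tensorFun f g)
      ((modeMeasure δ M).prod (modeMeasure δ M)) := hf.1.comp_fst.mul hg.1.comp_snd
  rw [memLp_two_iff_integrable_sq_norm hm]
  have := (hf.integrable_norm_pow two_ne_zero).mul_prod (hg.integrable_norm_pow two_ne_zero)
  simpa [tensorFun, mul_pow] using this

/-- `f ⊗ g ∈ 𝔥 ⊗ 𝔥`. -/
def tensor {δ M : ℝ} (f g : OneParticle δ M) : TwoParticle δ M := (memLp_tensorFun f g).toLp _

/-! ## The second Wick power -/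

variable {δ M : ℝ}

/-- `W : 𝔥 ⊗ 𝔥 → 𝒜` is the second Wick power `Ψ^{⋄2}` if it satisfies
`Ψ^{⋄2}(f ⊗ g) = Ψ(f)Ψ(g) - [α(κUf), α†(g)]₊`. -/
def IsWickSquare (Γ : Filtration (conjU δ M)) (W : TwoParticle δ M →L[ℂ] ExtCAR Γ) : Prop :=
  ∀ f g : OneParticle δ M, W (tensor f g) = field Γ f * field Γ g - contraction Γ f g

open Classical in
/-- The second Wick power `Ψ^{⋄2} : 𝔥 ⊗ 𝔥 → 𝒜`, a continuous linear map. -/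
def wickSquare (Γ : Filtration (conjU δ M)) : TwoParticle δ M →L[ℂ] ExtCAR Γ :=
  if h : ∃ W, IsWickSquare Γ W then h.choose else 0

/-! ## Kernels -/

/-- Points `(t, x₁, x₂)` of `ℝ³`. -/
abbrev Spacetime : Type := ℝ × ℝ × ℝ

/-- The heat kernel `𝒦(t, x) = 1_{t>0} (4πt)⁻¹ e^{-|x|²/4t}` of `ℝ²`. -/
def heatKernel (y : Spacetime) : ℝ :=
  if 0 < y.1 then (4 * Real.pi * y.1)⁻¹ * Real.exp (-(y.2.1 ^ 2 + y.2.2 ^ 2) / (4 * y.1)) else 0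

/-- Cutoff functions: `φ` is smooth with compact support, takes values in `[0,1]`, and its
`ℤ²`-translates sum to `1`; `χ` is smooth, takes values in `[0,1]`, is `1` on `(-∞,1]` and `0` on
`[2,∞)`. -/
structure IsCutoff (φ : ℝ × ℝ → ℝ) (χ : ℝ → ℝ) : Prop where
  smooth_space : ContDiff ℝ ∞ φ
  compact_space : HasCompactSupport φ
  mem_space : ∀ x, φ x ∈ Set.Icc (0 : ℝ) 1
  sum_space : ∀ x : ℝ × ℝ, ∑' k : ℤ × ℤ, φ (x.1 + k.1, x.2 + k.2) = 1
  smooth_time : ContDiff ℝ ∞ χ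
  mem_time : ∀ t, χ t ∈ Set.Icc (0 : ℝ) 1
  one_time : ∀ t ≤ 1, χ t = 1
  zero_time : ∀ t, 2 ≤ t → χ t = 0

/-- The truncated heat kernel `𝒦̃(t, x) = ∑_{k ∈ ℤ²} χ(t) φ(x) 𝒦(t, x + k)`. -/
def truncatedKernel (φ : ℝ × ℝ → ℝ) (χ : ℝ → ℝ) (y : Spacetime) : ℝ :=
  ∑' k : ℤ × ℤ, χ y.1 * φ y.2 * heatKernel (y.1, y.2.1 + k.1, y.2.2 + k.2)

/-- The kernel `e^{-tM²} 𝒦̃(t, x)` of the operator `ℐ_F`. -/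
def fermionKernel (M : ℝ) (φ : ℝ × ℝ → ℝ) (χ : ℝ → ℝ) (y : Spacetime) : ℝ :=
  Real.exp (-(y.1 * M ^ 2)) * truncatedKernel φ χ y

/-- The kernel `G` of the transpose of `ℐ_F`: `(ℐ_F u)(z) = u(G(· - z))`. -/
def transposedKernel (M : ℝ) (φ : ℝ × ℝ → ℝ) (χ : ℝ → ℝ) (y : Spacetime) : ℝ :=
  fermionKernel M φ χ (-y)

/-- `ρ` is smooth, compactly supported, radially symmetric and integrates to `1`. -/
structure IsMollifier (ρ : Spacetime → ℝ) : Prop where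
  smooth : ContDiff ℝ ∞ ρ
  compact : HasCompactSupport ρ
  radial : ∀ y z : Spacetime, y.1 ^ 2 + y.2.1 ^ 2 + y.2.2 ^ 2 = z.1 ^ 2 + z.2.1 ^ 2 + z.2.2 ^ 2 →
    ρ y = ρ z
  integral_eq_one : ∫ y, ρ y = 1

/-- `ρ_ε(t, x) = ε⁻⁴ ρ(ε⁻² t, ε⁻¹ x)`. -/
def rescale (ρ : Spacetime → ℝ) (ε : ℝ) (y : Spacetime) : ℝ :=
  (ε ^ 4)⁻¹ * ρ ((ε ^ 2)⁻¹ * y.1, ε⁻¹ * y.2.1, ε⁻¹ * y.2.2)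

/-- The mollification `G_ε = G * ρ_ε`. -/
def mollify (ρ : Spacetime → ℝ) (ε : ℝ) (G : Spacetime → ℝ) (y : Spacetime) : ℝ :=
  ∫ w : Spacetime, rescale ρ ε w * G (y - w)

/-- The `k`-th spatial Fourier coefficient, at time `t`, of the periodisation of the function
`G_z(y) = G(y - z)`. -/
def modeCoeff (G : Spacetime → ℝ) (z : Spacetime) (t : ℝ) (k : ℤ × ℤ) : ℂ :=
  ∫ x : ℝ × ℝ, (G ((t, x) - z) : ℂ) *
    Complex.exp (-(2 * Real.pi * Complex.I * (k.1 * x.1 + k.2 * x.2)))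

/-- The element of `𝔥` (in Fourier modes) at which `Ψ` has to be evaluated to give the `j`-th
component of `(∇̸ + M)ℐ_F ψ` at `z`, if `G` is the kernel of the transpose of `ℐ_F`: the transpose
of `∇̸ + M` is `-∇̸‾ + M`, and its `j`-th column is applied to `G_z`. -/
def fermionVec (M : ℝ) (G : Spacetime → ℝ) (z : Spacetime) (j : Fin 2) (p : Mode) : ℂ :=
  if p.2.2.1 = 0 then
    (-diracBarSymbol p.2.1 + (M : ℂ) • (1 : Matrix (Fin 2) (Fin 2) ℂ)) p.2.2.2 j *
      modeCoeff G z p.1 p.2.1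
  else 0

/-- The element of `𝔥` (in Fourier modes) at which `Ψ` has to be evaluated to give the `j`-th
component of `(-∇̸‾ + M)ℐ_F ψ̄` at `z`, if `G` is the kernel of the transpose of `ℐ_F`: the
transpose of `-∇̸‾ + M` is `∇̸ + M`, and its `j`-th column is applied to `G_z`. -/
def antiVec (M : ℝ) (G : Spacetime → ℝ) (z : Spacetime) (j : Fin 2) (p : Mode) : ℂ :=
  if p.2.2.1 = 1 then
    (diracSymbol p.2.1 + (M : ℂ) • (1 : Matrix (Fin 2) (Fin 2) ℂ)) p.2.2.2 j *
      modeCoeff G z p.1 p.2.1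
  else 0

/-- The element of `𝔥` that is represented by the function `f`. -/
def toOne (δ M : ℝ) (f : Mode → ℂ) : OneParticle δ M :=
  open Classical in if h : MemLp f 2 (modeMeasure δ M) then h.toLp f else 0

/-- The element of `𝔥 ⊗ 𝔥` that is represented by the function `F`. -/
def toTwo (δ M : ℝ) (F : Mode × Mode → ℂ) : TwoParticle δ M :=
  open Classical in
  if h : MemLp F 2 ((modeMeasure δ M).prod (modeMeasure δ M)) then h.toLp F else 0

/-! ## The Wick square -/

/-- The `j`-th component of `(∇̸ + M)ℐ_F ψ` at `z`. -/
def fermion (Γ : Filtration (conjU δ M)) (G : Spacetime → ℝ) (z : Spacetime) (j : Fin 2) :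
    ExtCAR Γ :=
  field Γ (toOne δ M (fermionVec M G z j))

/-- The `j`-th component of `(-∇̸‾ + M)ℐ_F ψ̄` at `z`. -/
def antifermion (Γ : Filtration (conjU δ M)) (G : Spacetime → ℝ) (z : Spacetime) (j : Fin 2) :
    ExtCAR Γ :=
  field Γ (toOne δ M (antiVec M G z j))

/-- The renormalisation counterterm. -/
def counterterm (Γ : Filtration (conjU δ M)) (G : Spacetime → ℝ) (z : Spacetime) : ExtCAR Γ :=
  ∑ j : Fin 2, contraction Γ (toOne δ M (antiVec M G z j)) (toOne δ M (fermionVec M G z j))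

/-- The renormalised product of the integrated noises at the point `z`. -/
def renormalisedProduct (Γ : Filtration (conjU δ M)) (G : Spacetime → ℝ) (z : Spacetime) :
    ExtCAR Γ :=
  ∑ j : Fin 2, antifermion Γ G z j * fermion Γ G z j - counterterm Γ G z

/-- The function that represents the second chaos kernel `∑_j (antiVec_j) ⊗ (fermionVec_j)` at the
point `z`. -/
def chaosKernel (M : ℝ) (G : Spacetime → ℝ) (z : Spacetime) (p : Mode × Mode) : ℂ :=
  ∑ j : Fin 2, antiVec M G z j p.1 * fermionVec M G z j p.2

/-- Smooth compactly supported test functions on `ℝ³`. -/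
abbrev TestFun : Type := 𝓓((⊤ : TopologicalSpace.Opens Spacetime), ℂ)

/-- The function that represents the second chaos kernel, tested against `η`. -/
def smearedKernel (M : ℝ) (G : Spacetime → ℝ) (η : TestFun) (p : Mode × Mode) : ℂ :=
  ∫ z : Spacetime, η z * chaosKernel M G z p

/-- The fermionic Wick square `⟨ψ̄, ψ⟩^⋄` of the integrated noises, as an `𝒜`-valued distribution:
`Ψ^{⋄2}` applied to the second chaos kernel. -/
def wickProduct (Γ : Filtration (conjU δ M)) (G : Spacetime → ℝ) (η : TestFun) : ExtCAR Γ :=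
  wickSquare Γ (toTwo δ M (smearedKernel M G η))

/-! ## Hölder–Besov spaces of negative exponent -/

/-- The parabolic norm `√|t| + |x₁| + |x₂|`. -/
def parabolicNorm (y : Spacetime) : ℝ := √|y.1| + |y.2.1| + |y.2.2|

/-- The rescaled test function `(S^λ_z η)(w) = λ⁻⁴ η(λ⁻²(w₀ - z₀), λ⁻¹(w₁ - z₁), λ⁻¹(w₂ - z₂))`. For
`λ = 1` this is the translate `η(· - z)`. -/
def scaleTest (lam : ℝ) (z : Spacetime) (η : TestFun) : TestFun where
  toFun w := ((lam ^ 4)⁻¹ : ℝ) *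
    η ((lam ^ 2)⁻¹ * (w.1 - z.1), lam⁻¹ * (w.2.1 - z.2.1), lam⁻¹ * (w.2.2 - z.2.2))
  contDiff' := by
    have h := η.contDiff
    exact contDiff_const.mul (h.comp (by fun_prop))
  hasCompactSupport' := by
    rcases eq_or_ne lam 0 with rfl | hl
    · refine HasCompactSupport.intro isCompact_empty fun w _ => ?_
      simp
    · have hc : Continuous fun y : Spacetime =>
          ((lam ^ 2 * y.1 + z.1, lam * y.2.1 + z.2.1, lam * y.2.2 + z.2.2) : Spacetime) := by
        fun_prop
      refine HasCompactSupport.intro (η.hasCompactSupport.isCompact.image hc) fun w hw => ?_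
      by_contra hne
      refine hw ⟨_, subset_tsupport _ (right_ne_zero_of_mul hne), ?_⟩
      ext <;> simp [hl]
  tsupport_subset' := fun _ _ => trivial

/-- The test functions `η` with support in the closed parabolic unit ball around the origin and
`‖η‖_{𝒞ʳ} ≤ 1`. -/
def testBall (r : ℕ) : Set TestFun :=
  {η | (∀ w, η w ≠ 0 → parabolicNorm w ≤ 1) ∧
    ∀ i ≤ r, ∀ w, ‖iteratedFDeriv ℝ i (η : Spacetime → ℂ) w‖ ≤ 1}

/-- The Hölder–Besov norm of exponent `α < 0` for the seminorm `p`, with base points in `K`, of the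
`E`-valued distribution `ξ`; here `r = -⌊α⌋`. -/
def holderNorm {E : Type*} (p : E → ℝ) (α : ℝ) (K : Set Spacetime) (ξ : TestFun → E) : ℝ≥0∞ :=
  (⨆ z ∈ K, ⨆ η ∈ testBall (-⌊α⌋).toNat, ⨆ lam ∈ Set.Ioc (0 : ℝ) 1,
    ENNReal.ofReal (lam ^ (-α) * p (ξ (scaleTest lam z η)))) +
  ⨆ z ∈ K, ⨆ η ∈ testBall (-⌊α⌋).toNat, ENNReal.ofReal (p (ξ (scaleTest 1 z η)))

/-- `ξ` is an element of `𝒞_𝔰^α(Λ; 𝒜)`, `α < 0`: a continuous linear map from the test functions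
on `ℝ³` to `𝒜` which is spatially periodic and has finite local Hölder–Besov norms. -/
structure MemHolder (Γ : Filtration (conjU δ M)) (α : ℝ) (ξ : TestFun → ExtCAR Γ) : Prop where
  isDistribution : ∃ T : TestFun →L[ℂ] ExtCAR Γ, ∀ η, T η = ξ η
  periodic : ∀ (k : ℤ × ℤ) (η : TestFun), ξ (scaleTest 1 (0, k.1, k.2) η) = ξ η
  norm_lt_top : ∀ (n : ℕ) (K : Set Spacetime), IsCompact K →
    holderNorm (extNorm Γ n) α K ξ < ⊤

end FermionicWick

end

/-!
# The fermionic Wick square of the integrated noises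

Write `ω_k² = 4π²|k|² + M²` for the symbol of `-Δ + M²`.

**Reduction to the two-particle space.** In the representation on the Fock space of `b`, the
normally ordered product `Ψ(f)Ψ(g) - [α(κUf), α†(g)]_+` is a finite sum of products of two ladder
matrices; the coefficients are products of two bounded functionals applied to `f ⊗ g`
(`carRep_wickPre`). Each of these is bounded by the Hilbert space norm on `𝔥 ⊗ 𝔥`, and there are
at most `4n²` of them if `dim b ≤ n`. So `‖Ψ^{⋄2}(F)‖_n ≤ c_n ‖F‖` with a constant that does not
depend on `Γ`, and `Ψ^{⋄2}` extends from the algebraic tensor product, which is dense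
(`exists_wickSquare`, `denseRange_tensorₗ`). All that is left is to estimate the chaos kernels in
`𝔥 ⊗ 𝔥`, and the filtration plays no role any more.

**Fourier representation.** The periodisation in the definition of the truncated heat kernel is
undone by the partition of unity, so that its spatial Fourier coefficients are `1_{τ>0} χ(τ)
e^{-τω_k²}` (`isProfile_transposedKernel`). The estimates use only that these profiles are
bounded and that their `L¹` norms in time are of order `ω_k⁻²` (`IsHeatLike`). The mollified
kernels have profiles with the same properties, uniformly in `ε`, and the two differ in `L¹` by
`O(ε² + ε ω_k⁻¹)` (`exists_lintegral_mollified_sub_le`), since the heat profile has bounded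
variation.

**Regularity.** The spatial Fourier transform at the frequency `K` of a test function at scale
`λ` decays like `min(1, (λω_K)⁻¹)`. For the modes `k` and `k'`, with `K = k + k'`, the two time
integrals give `ω_k⁻² ω_{k'}⁻²`; this cancels the symbols of the Dirac operators, which enter
squared. The norm of `𝔥` contributes the weights `ω_k^{-(1+2δ)}`. Their convolution `∑_k
ω_k^{-(1+2δ)} ω_{K-k}^{-(1+2δ)}` is `O(ω_K^{-4δ})`, and `∑_K ω_K^{-4δ} min(1, (λω_K)⁻¹)² =
O(λ^{-2+4δ})` (`exists_lintegral_modeKernel_le`), the square of `λ^{-1+2δ}`.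

**Convergence.** The difference of the chaos kernels of `G` and `G_ε` is a sum of two terms in
which one of the two profiles is replaced by the difference. With `Ω` the larger of the
frequencies, the bound on the squared norm of a mode improves by the factor `min(1, εΩ)`, as the
difference of the profiles is small, and for `Ω ≫ λ⁻¹` also by `(λΩ)⁻²`, as the test function is
spread over a time of order `λ²`, which is much longer than the decay time `Ω⁻²` of the profile.
Interpolation gives `min(1, εΩ, (λΩ)⁻²) ≤ ε^{ν/2} λ^{-2ν}` (`min_le_rpow_mul_rpow`,
`lintegral_pairing_scaleTest_le`), the square of `ε^{ν/4} λ^{-ν}`.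

**The renormalised product.** For fixed `ε`, smoothness of the mollifier puts the vectors
`g^ε_{z,j}` and `ḡ^ε_{z,j}` in `𝔥`, with norms bounded uniformly in `z`
(`exists_lintegral_mollified_sq_le`). If `L` is a continuous linear functional on `𝒜`, then `L ∘
Ψ^{⋄2}` is the inner product with a vector of `𝔥 ⊗ 𝔥`, and Fubini's theorem exchanges it with the
integral against the test function (`inner_smearedKernel`).
-/

noncomputable section

namespace FermionicWick

/-! ### The second Wick power on an abstract one-particle space -/

section AbstractWick

open scoped TensorProduct

variable {H : Type*} [NormedAddCommGroup H] [InnerProductSpace ℂ H]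

/-- The symbol `α†(f)`, as a linear map. -/
def createₗ : H →ₗ[ℂ] FreeAlg H := TensorAlgebra.ι ℂ ∘ₗ LinearMap.inl ℂ H (StrongDual ℂ H)

/-- The symbol `α(J f)`, as a linear map in `f`; `J` is antilinear. -/
def annihₗ (J : H →ₗ⋆[ℂ] H) : H →ₗ[ℂ] FreeAlg H where
  toFun f := annih (J f)
  map_add' f g := by
    simp only [annih, map_add, ← map_add (TensorAlgebra.ι ℂ), Prod.mk_add_mk, add_zero]
  map_smul' c f := by
    simp only [annih, LinearMap.map_smulₛₗ, ContinuousLinearMap.map_smulₛₗ, RingHom.id_apply,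
      ← map_smul (TensorAlgebra.ι ℂ), Prod.smul_mk, smul_zero, starRingEnd_self_apply]

/-- The normally ordered product `:(α†(f) + α(J f)) (α†(g) + α(J g)):` in the free algebra. -/
def wickPre (J : H →ₗ⋆[ℂ] H) : H ⊗[ℂ] H →ₗ[ℂ] FreeAlg H :=
  TensorProduct.lift
    ((LinearMap.mul ℂ (FreeAlg H)).compl₁₂ (createₗ + annihₗ J) (createₗ + annihₗ J) -
      ((LinearMap.mul ℂ (FreeAlg H)).compl₁₂ (annihₗ J) createₗ +
        ((LinearMap.mul ℂ (FreeAlg H)).compl₁₂ createₗ (annihₗ J)).flip))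

theorem wickPre_tmul (J : H →ₗ⋆[ℂ] H) (f g : H) :
    wickPre J (f ⊗ₜ g) = (create f + annih (J f)) * (create g + annih (J g)) -
      (annih (J f) * create g + create g * annih (J f)) := rfl

/-- The bilinear functional `f ⊗ g ↦ u(f) v(g)` on the algebraic tensor product. -/
def dualTensor (u v : StrongDual ℂ H) : H ⊗[ℂ] H →ₗ[ℂ] ℂ :=
  TensorProduct.lift ((LinearMap.mul ℂ ℂ).compl₁₂ u.toLinearMap v.toLinearMap)

theorem dualTensor_tmul (u v : StrongDual ℂ H) (f g : H) :
    dualTensor u v (f ⊗ₜ g) = u f * v g := rfl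

/-- The bounded functional `f ↦ ⟨J f, e⟩`. -/
def conjDual (J : H →ₗ⋆[ℂ] H) (c : ℝ) (hJ : ∀ f, ‖J f‖ ≤ c * ‖f‖) (e : H) : StrongDual ℂ H :=
  LinearMap.mkContinuous
    { toFun := fun f => inner ℂ (J f) e
      map_add' := fun f g => by rw [map_add, inner_add_left]
      map_smul' := fun r f => by
        rw [LinearMap.map_smulₛₗ, inner_smul_left, starRingEnd_self_apply]; rfl }
    (c * ‖e‖) fun f => by
      refine (norm_inner_le_norm _ _).trans ?_
      calc ‖J f‖ * ‖e‖ ≤ (c * ‖f‖) * ‖e‖ := by gcongr; exact hJ f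
        _ = c * ‖e‖ * ‖f‖ := by ring

theorem norm_conjDual_le (J : H →ₗ⋆[ℂ] H) (c : ℝ) (hc : 0 ≤ c) (hJ : ∀ f, ‖J f‖ ≤ c * ‖f‖) (e : H) :
    ‖conjDual J c hJ e‖ ≤ c * ‖e‖ :=
  LinearMap.mkContinuous_norm_le _ (by positivity) _

theorem carRep_create (b : Gr H) (f : H) : carRep b (create f) =
    ∑ i, inner ℂ ((stdOrthonormalBasis ℂ b.1 i : b.1) : H) f • ladder i := by
  simp [carRep, create, carGenerator]

theorem carRep_annih (b : Gr H) (f : H) : carRep b (annih f) =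
    ∑ i, inner ℂ f ((stdOrthonormalBasis ℂ b.1 i : b.1) : H) • (ladder i).conjTranspose := by
  simp [carRep, annih, carGenerator]

/-- The normally ordered product, in the representation on the Fock space of `b`. -/
theorem carRep_wickPre (J : H →ₗ⋆[ℂ] H) (c : ℝ) (hJ : ∀ f, ‖J f‖ ≤ c * ‖f‖) (b : Gr H)
    (x : H ⊗[ℂ] H) :
    let e := fun i => ((stdOrthonormalBasis ℂ b.1 i : b.1) : H)
    let u := fun i => innerSL ℂ (e i)
    let v := fun i => conjDual J c hJ (e i)
    carRep b (wickPre J x) = ∑ i, ∑ j,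
      (dualTensor (u i) (u j) x • (ladder i * ladder j) +
        dualTensor (u i) (v j) x • (ladder i * (ladder j).conjTranspose) +
        dualTensor (v i) (v j) x • ((ladder i).conjTranspose * (ladder j).conjTranspose) -
        dualTensor (v i) (u j) x • (ladder j * (ladder i).conjTranspose)) := by
  intro e u v
  induction x using TensorProduct.induction_on with
  | zero => simp
  | tmul f g =>
    have hx : wickPre J (f ⊗ₜ g) = create f * create g + create f * annih (J g) +
        annih (J f) * annih (J g) - create g * annih (J f) := by
      rw [wickPre_tmul]; noncomm_ring
    rw [hx, map_sub, map_add, map_add, map_mul, map_mul, map_mul, map_mul, carRep_create,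
      carRep_create, carRep_annih, carRep_annih]
    simp only [Finset.sum_sub_distrib, Finset.sum_add_distrib, dualTensor_tmul]
    simp only [Finset.sum_mul_sum, smul_mul_smul_comm]
    congr 1
    rw [Finset.sum_comm]
    refine Finset.sum_congr rfl fun i _ => Finset.sum_congr rfl fun j _ => ?_
    rw [mul_comm]; rfl
  | add x y hx hy =>
    simp only [map_add, hx, hy, ← Finset.sum_add_distrib, add_smul]
    refine Finset.sum_congr rfl fun i _ => Finset.sum_congr rfl fun j _ => ?_
    abel

/-- A bound for the norm of the second Wick power on Fock spaces over a space of dimension `d`. -/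
def wickBound (c : ℝ) (d : ℕ) : ℝ :=
  ∑ i : Fin d, ∑ j : Fin d,
    (‖Matrix.toEuclideanCLM (𝕜 := ℂ) (ladder i * ladder j)‖ +
      c * ‖Matrix.toEuclideanCLM (𝕜 := ℂ) (ladder i * (ladder j).conjTranspose)‖ +
      c * c * ‖Matrix.toEuclideanCLM (𝕜 := ℂ)
        ((ladder i).conjTranspose * (ladder j).conjTranspose)‖ +
      c * ‖Matrix.toEuclideanCLM (𝕜 := ℂ) (ladder j * (ladder i).conjTranspose)‖)

theorem wickBound_nonneg {c : ℝ} (hc : 0 ≤ c) (d : ℕ) : 0 ≤ wickBound c d :=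
  Finset.sum_nonneg fun i _ => Finset.sum_nonneg fun j _ => by positivity

variable {E : Type*} [NormedAddCommGroup E] [NormedSpace ℂ E]

/-- The key to the continuity of the second Wick power. In the representation on the Fock space of
`b`, the normally ordered product is a finite sum of products of two ladder matrices, whose
coefficients are products of two bounded functionals applied to `x`. As the dimension of `b` is
finite, neither the CAR relations nor the sharp norm of the ladder matrices are needed. -/
theorem carSeminorm_wickPre_le (J : H →ₗ⋆[ℂ] H) (c : ℝ) (hc : 0 ≤ c) (hJ : ∀ f, ‖J f‖ ≤ c * ‖f‖)
    (T : H ⊗[ℂ] H →ₗ[ℂ] E)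
    (hT : ∀ (u v : StrongDual ℂ H) x, ‖dualTensor u v x‖ ≤ ‖u‖ * ‖v‖ * ‖T x‖)
    (b : Gr H) (x : H ⊗[ℂ] H) :
    carSeminorm b (wickPre J x) ≤ wickBound c (Module.finrank ℂ b.1) * ‖T x‖ := by
  change ‖Matrix.toEuclideanCLM (𝕜 := ℂ) (carRep b (wickPre J x))‖ ≤ _
  rw [carRep_wickPre J c hJ, map_sum, wickBound, Finset.sum_mul]
  refine (norm_sum_le _ _).trans (Finset.sum_le_sum fun i _ => ?_)
  rw [map_sum, Finset.sum_mul]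
  refine (norm_sum_le _ _).trans (Finset.sum_le_sum fun j _ => ?_)
  have he : ∀ i, ‖((stdOrthonormalBasis ℂ b.1 i : b.1) : H)‖ = 1 := fun i => by
    rw [← Submodule.coe_norm]
    exact (stdOrthonormalBasis ℂ b.1).orthonormal.1 i
  have hu : ∀ i, ‖innerSL ℂ ((stdOrthonormalBasis ℂ b.1 i : b.1) : H)‖ ≤ 1 := fun i => by
    rw [innerSL_apply_norm, he]
  have hv : ∀ i, ‖conjDual J c hJ ((stdOrthonormalBasis ℂ b.1 i : b.1) : H)‖ ≤ c := fun i => by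
    simpa [he] using norm_conjDual_le J c hc hJ ((stdOrthonormalBasis ℂ b.1 i : b.1) : H)
  have key : ∀ (u v : StrongDual ℂ H) (r s : ℝ), ‖u‖ ≤ r → ‖v‖ ≤ s → 0 ≤ r →
      ∀ A : Matrix (Finset (Fin (Module.finrank ℂ b.1))) (Finset (Fin (Module.finrank ℂ b.1))) ℂ,
      ‖Matrix.toEuclideanCLM (𝕜 := ℂ) (dualTensor u v x • A)‖ ≤
        r * s * ‖Matrix.toEuclideanCLM (𝕜 := ℂ) A‖ * ‖T x‖ := by
    intro u v r s hr hs h0 A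
    rw [map_smul, norm_smul]
    calc _ ≤ (‖u‖ * ‖v‖ * ‖T x‖) * ‖Matrix.toEuclideanCLM (𝕜 := ℂ) A‖ := by
          gcongr; exact hT u v x
      _ ≤ (r * s * ‖T x‖) * ‖Matrix.toEuclideanCLM (𝕜 := ℂ) A‖ := by gcongr
      _ = _ := by ring
  rw [map_sub, map_add, map_add]
  refine (norm_sub_le _ _).trans ?_
  rw [add_mul, add_mul, add_mul]
  refine add_le_add ((norm_add_le _ _).trans (add_le_add ((norm_add_le _ _).trans
    (add_le_add ?_ ?_)) ?_)) ?_
  · exact (key _ _ 1 1 (hu i) (hu j) zero_le_one _).trans_eq (by rw [one_mul, one_mul])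
  · exact (key _ _ 1 c (hu i) (hv j) zero_le_one _).trans_eq (by rw [one_mul])
  · exact key _ _ c c (hv i) (hv j) hc _
  · exact (key _ _ c 1 (hv i) (hu j) hc _).trans_eq (by rw [mul_one])

/-- A bound for the norm of the second Wick power with respect to `‖·‖_n`. -/
def wickConst (c : ℝ) (n : ℕ) : ℝ := ∑ d ∈ Finset.range (n + 1), wickBound c d

theorem wickConst_nonneg {c : ℝ} (hc : 0 ≤ c) (n : ℕ) : 0 ≤ wickConst c n :=
  Finset.sum_nonneg fun d _ => wickBound_nonneg hc d

theorem preSeminorm_wickPre_le (J : H →ₗ⋆[ℂ] H) (c : ℝ) (hc : 0 ≤ c) (hJ : ∀ f, ‖J f‖ ≤ c * ‖f‖)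
    (T : H ⊗[ℂ] H →ₗ[ℂ] E)
    (hT : ∀ (u v : StrongDual ℂ H) x, ‖dualTensor u v x‖ ≤ ‖u‖ * ‖v‖ * ‖T x‖)
    (Γ : Filtration J) (n : ℕ) (x : H ⊗[ℂ] H) :
    preSeminorm Γ n (wickPre J x) ≤ wickConst c n * ‖T x‖ := by
  rw [preSeminorm_apply]
  refine Real.iSup_le (fun b => ?_) (mul_nonneg (wickConst_nonneg hc n) (norm_nonneg _))
  refine (carSeminorm_wickPre_le J c hc hJ T hT b.1 x).trans ?_
  gcongr
  refine Finset.single_le_sum (f := wickBound c) (fun d _ => wickBound_nonneg hc d) ?_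
  rw [Finset.mem_range]
  exact Nat.lt_succ_of_le (Γ.dim_le n b.1 b.2)

variable {J : H → H}

theorem toExt_add (Γ : Filtration J) (x y : FreeAlg H) : toExt Γ (x + y) = toExt Γ x + toExt Γ y :=
  UniformSpace.Completion.coe_add (α := PreAlg Γ) x y

theorem toExt_sub (Γ : Filtration J) (x y : FreeAlg H) : toExt Γ (x - y) = toExt Γ x - toExt Γ y :=
  UniformSpace.Completion.coe_sub (α := PreAlg Γ) x y

theorem toExt_mul (Γ : Filtration J) (x y : FreeAlg H) : toExt Γ (x * y) = toExt Γ x * toExt Γ y :=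
  UniformSpace.Completion.coe_mul (α := PreAlg Γ) x y

theorem continuous_extNorm (Γ : Filtration J) (n : ℕ) : Continuous (extNorm Γ n) :=
  UniformSpace.Completion.continuous_extension

/-- Elements of the free algebra at distance `0` for all the seminorms agree in the completion. -/
theorem toExt_eq_of_preSeminorm_sub_eq_zero (Γ : Filtration J) {x y : FreeAlg H}
    (h : ∀ n, preSeminorm Γ n (x - y) = 0) : toExt Γ x = toExt Γ y := by
  have key : ∀ a b : PreAlg Γ, (∀ n, seminormFamily Γ n (a - b) = 0) →
      (a : UniformSpace.Completion (PreAlg Γ)) = b := by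
    intro a b hab
    have h1 : Tendsto (fun _ : ℕ => a) atTop (𝓝 b) := by
      refine ((withSeminorms Γ).tendsto_nhds _ _).2 fun n ε hε => Eventually.of_forall fun _ => ?_
      rw [hab n]; exact hε
    have h2 := ((UniformSpace.Completion.continuous_coe (PreAlg Γ)).tendsto b).comp h1
    exact tendsto_nhds_unique tendsto_const_nhds h2
  exact key x y h

/-- The canonical map of the free algebra to its completion, as a continuous linear map. -/
def toExtL (Γ : Filtration J) : PreAlg Γ →L[ℂ] ExtCAR Γ where
  toFun := UniformSpace.Completion.coe'
  map_add' := UniformSpace.Completion.coe_add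
  map_smul' c x := UniformSpace.Completion.coe_smul c x
  cont := UniformSpace.Completion.continuous_coe _

/-- Extension by continuity: the second Wick power exists on every completion `E` of the algebraic
tensor product whose norm dominates the products of bounded functionals. -/
theorem exists_wickSquare (J : H →ₗ⋆[ℂ] H) (c : ℝ) (hc : 0 ≤ c) (hJ : ∀ f, ‖J f‖ ≤ c * ‖f‖)
    (T : H ⊗[ℂ] H →ₗ[ℂ] E) (hd : DenseRange T)
    (hT : ∀ (u v : StrongDual ℂ H) x, ‖dualTensor u v x‖ ≤ ‖u‖ * ‖v‖ * ‖T x‖)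
    (Γ : Filtration J) :
    ∃ W : E →L[ℂ] ExtCAR Γ,
      (∀ f g, W (T (f ⊗ₜ g)) = field Γ f * field Γ g - contraction Γ f g) ∧
      ∀ n F, extNorm Γ n (W F) ≤ wickConst c n * ‖F‖ := by
  -- The choice of preimages under `T` is immaterial: by `hT`, all the seminorms vanish at
  -- the image of the difference of two preimages of the same vector.
  obtain ⟨s, hs⟩ := T.rangeRestrict.exists_rightInverse_of_surjective
    (LinearMap.range_rangeRestrict T)
  have hs' : ∀ y : LinearMap.range T, T (s y) = y := fun y =>
    congrArg Subtype.val (LinearMap.congr_fun hs y)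
  have hb := preSeminorm_wickPre_le J c hc hJ T hT Γ
  let W₀ : LinearMap.range T →ₗ[ℂ] PreAlg Γ := wickPre J ∘ₗ s
  have hW₀ : Continuous W₀ := by
    refine (withSeminorms Γ).continuous_normedSpace_dom (LinearMap.range T) W₀
      fun n => ⟨⟨wickConst c n, wickConst_nonneg hc n⟩, fun y => ?_⟩
    have := hb n (s y)
    rw [hs'] at this
    exact this
  let W₁ : LinearMap.range T →L[ℂ] ExtCAR Γ := toExtL Γ ∘L ⟨W₀, hW₀⟩
  have hd' : DenseRange (LinearMap.range T).subtypeL := by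
    have : Set.range (LinearMap.range T).subtypeL = Set.range T := by ext; simp
    rw [DenseRange, this]
    exact hd
  have hi : IsUniformInducing (LinearMap.range T).subtypeL :=
    isUniformEmbedding_subtype_val.isUniformInducing
  have hW : ∀ x, W₁.extend (LinearMap.range T).subtypeL (T x) = toExt Γ (wickPre J x) := by
    intro x
    have h1 := W₁.extend_eq hd' hi ⟨T x, LinearMap.mem_range_self T x⟩
    refine h1.trans (toExt_eq_of_preSeminorm_sub_eq_zero Γ fun n => ?_)
    change preSeminorm Γ n (wickPre J (s ⟨T x, _⟩) - wickPre J x) = 0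
    rw [← map_sub]
    refine le_antisymm ((hb n _).trans ?_) (apply_nonneg _ _)
    rw [map_sub, hs', sub_self, norm_zero, mul_zero]
  refine ⟨W₁.extend (LinearMap.range T).subtypeL, fun f g => ?_, fun n F => ?_⟩
  · rw [hW, wickPre_tmul]
    simp only [toExt_add, toExt_sub, toExt_mul, field, contraction]
  · refine hd.induction_on (p := fun F =>
      extNorm Γ n (W₁.extend (LinearMap.range T).subtypeL F) ≤ wickConst c n * ‖F‖) F ?_ fun x => ?_
    · exact isClosed_le ((continuous_extNorm Γ n).comp (ContinuousLinearMap.continuous _))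
        (by fun_prop)
    · rw [hW, extNorm_toExt]
      exact hb n x

end AbstractWick

/-! ### The second Wick power on `𝔥 ⊗ 𝔥` -/

section ConcreteWick

open scoped TensorProduct

variable {δ M : ℝ}

theorem measurable_reflect (j : Comp) : Measurable (reflect j) := by
  unfold reflect
  refine measurable_fst.prodMk (Measurable.prodMk ?_ measurable_const)
  exact (measurable_of_countable (fun k : ℤ × ℤ => -k)).comp measurable_snd.fst

theorem quasiMeasurePreserving_reflect (j : Comp) :
    Measure.QuasiMeasurePreserving (reflect j) (modeMeasure δ M) (modeMeasure δ M) := by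
  refine ⟨measurable_reflect j, ?_⟩
  exact (Measure.absolutelyContinuous_of_le (map_reflect_le δ M j)).trans
    (Measure.AbsolutelyContinuous.rfl.smul_left _)

/-- `κU` respects equality almost everywhere. -/
theorem conjUFun_congr {f g : Mode → ℂ} (h : f =ᵐ[modeMeasure δ M] g) :
    conjUFun M f =ᵐ[modeMeasure δ M] conjUFun M g := by
  have : ∀ j, ∀ᵐ p ∂modeMeasure δ M, f (reflect j p) = g (reflect j p) := fun j =>
    (quasiMeasurePreserving_reflect j).ae h
  filter_upwards [ae_all_iff.2 this] with p hp
  unfold conjUFun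
  congr 1
  exact Finset.sum_congr rfl fun j _ => by rw [show f (p.1, -p.2.1, j) = _ from hp j]; rfl

theorem coeFn_conjU (f : OneParticle δ M) : conjU δ M f =ᵐ[modeMeasure δ M] conjUFun M f :=
  MemLp.coeFn_toLp _

theorem eLpNorm_conjUFun_le {f : Mode → ℂ} (hf : AEStronglyMeasurable f (modeMeasure δ M)) :
    eLpNorm (conjUFun M f) 2 (modeMeasure δ M) ≤ 8 * eLpNorm f 2 (modeMeasure δ M) := by
  have hcomp : ∀ j, eLpNorm (f ∘ reflect j) 2 (modeMeasure δ M) ≤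
      2 * eLpNorm f 2 (modeMeasure δ M) := by
    intro j
    have hsmul : AEStronglyMeasurable f ((modeMeasure δ M).map (reflect j)) :=
      hf.mono_ac (quasiMeasurePreserving_reflect j).absolutelyContinuous
    rw [← eLpNorm_map_measure hsmul (measurable_reflect j).aemeasurable]
    refine (eLpNorm_mono_measure f (map_reflect_le δ M j)).trans ?_
    rw [eLpNorm_smul_measure_of_ne_zero' (by norm_num)]
    refine le_of_eq ?_
    rw [ENNReal.smul_def, smul_eq_mul]
    congr 1
    have : ((4 : ℝ≥0) ^ ((2 : ℝ≥0∞).toReal⁻¹) : ℝ≥0) = 2 := by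
      rw [show (4 : ℝ≥0) = 2 ^ (2 : ℝ) by norm_num, ← NNReal.rpow_mul]
      norm_num
    simpa using congrArg ((↑) : ℝ≥0 → ℝ≥0∞) this
  have hm : ∀ j, AEStronglyMeasurable (f ∘ reflect j) (modeMeasure δ M) := fun j =>
    hf.comp_quasiMeasurePreserving (quasiMeasurePreserving_reflect j)
  calc eLpNorm (conjUFun M f) 2 (modeMeasure δ M)
      ≤ eLpNorm (∑ j : Comp, fun p => ‖(f ∘ reflect j) p‖) 2 (modeMeasure δ M) := by
        refine eLpNorm_mono fun p => ?_
        rw [Finset.sum_apply, Real.norm_of_nonneg (Finset.sum_nonneg fun _ _ => norm_nonneg _),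
          conjUFun, RCLike.norm_conj]
        refine (norm_sum_le _ _).trans (Finset.sum_le_sum fun j _ => ?_)
        rw [norm_mul]
        exact mul_le_of_le_one_left (norm_nonneg _) (norm_unitarySymbol_le _ _ _ _)
    _ ≤ ∑ j : Comp, eLpNorm (fun p => ‖(f ∘ reflect j) p‖) 2 (modeMeasure δ M) :=
        eLpNorm_sum_le (fun j _ => (hm j).norm) (by norm_num)
    _ ≤ ∑ _j : Comp, 2 * eLpNorm f 2 (modeMeasure δ M) :=
        Finset.sum_le_sum fun j _ => by rw [eLpNorm_norm]; exact hcomp j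
    _ = 8 * eLpNorm f 2 (modeMeasure δ M) := by
        rw [Finset.sum_const, Finset.card_univ, nsmul_eq_mul, ← mul_assoc]
        congr 1
        simp; norm_num

variable (δ M) in
/-- The antiunitary map `κU`, as an antilinear map. -/
def conjUₗ : OneParticle δ M →ₗ⋆[ℂ] OneParticle δ M where
  toFun := conjU δ M
  map_add' f g := by
    refine Lp.ext ?_
    filter_upwards [coeFn_conjU (f + g), Lp.coeFn_add (conjU δ M f) (conjU δ M g), coeFn_conjU f,
      coeFn_conjU g, conjUFun_congr (Lp.coeFn_add f g)] with p h1 h2 h3 h4 h5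
    rw [h1, h5, h2, Pi.add_apply, h3, h4]
    simp only [conjUFun, Pi.add_apply, mul_add, Finset.sum_add_distrib, map_add]
  map_smul' c f := by
    refine Lp.ext ?_
    filter_upwards [coeFn_conjU (c • f), Lp.coeFn_smul (starRingEnd ℂ c) (conjU δ M f),
      coeFn_conjU f, conjUFun_congr (Lp.coeFn_smul c f)] with p h1 h2 h3 h4
    rw [h1, h4, h2, Pi.smul_apply, h3]
    simp only [conjUFun, Pi.smul_apply, smul_eq_mul, map_sum, map_mul, Finset.mul_sum]
    exact Finset.sum_congr rfl fun j _ => by ring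

/-- The constant is not optimal: a bound that does not depend on the vector suffices. -/
theorem norm_conjUₗ_le (f : OneParticle δ M) : ‖conjUₗ δ M f‖ ≤ 8 * ‖f‖ := by
  have h1 : ‖conjUₗ δ M f‖ = (eLpNorm (conjUFun M f) 2 (modeMeasure δ M)).toReal :=
    Lp.norm_toLp _ (memLp_conjUFun (Lp.memLp f))
  rw [h1, Lp.norm_def]
  have := ENNReal.toReal_mono (ENNReal.mul_ne_top (by simp) (Lp.eLpNorm_ne_top f))
    (eLpNorm_conjUFun_le (Lp.aestronglyMeasurable f))
  simpa using this

theorem coeFn_tensor (f g : OneParticle δ M) :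
    tensor f g =ᵐ[(modeMeasure δ M).prod (modeMeasure δ M)] tensorFun f g :=
  MemLp.coeFn_toLp _

theorem tensorFun_congr_right {f g : OneParticle δ M} {g' : Mode → ℂ}
    (h : g =ᵐ[modeMeasure δ M] g') :
    tensorFun f g =ᵐ[(modeMeasure δ M).prod (modeMeasure δ M)] fun p => f p.1 * g' p.2 := by
  filter_upwards [Measure.quasiMeasurePreserving_snd.ae (p := fun q => g q = g' q) h] with p hp
  rw [tensorFun, hp]

theorem tensorFun_congr_left {f g : OneParticle δ M} {f' : Mode → ℂ}
    (h : f =ᵐ[modeMeasure δ M] f') :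
    tensorFun f g =ᵐ[(modeMeasure δ M).prod (modeMeasure δ M)] fun p => f' p.1 * g p.2 := by
  filter_upwards [Measure.quasiMeasurePreserving_fst.ae (p := fun q => f q = f' q) h] with p hp
  rw [tensorFun, hp]

variable (δ M) in
/-- The map `f ⊗ g ↦ f ⊗ g` of the algebraic into the Hilbert space tensor product. -/
def tensorₗ : OneParticle δ M ⊗[ℂ] OneParticle δ M →ₗ[ℂ] TwoParticle δ M :=
  TensorProduct.lift (LinearMap.mk₂ ℂ tensor
    (fun f f' g => by
      refine Lp.ext ?_
      filter_upwards [coeFn_tensor (f + f') g, Lp.coeFn_add (tensor f g) (tensor f' g),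
        coeFn_tensor f g, coeFn_tensor f' g, tensorFun_congr_left (g := g) (Lp.coeFn_add f f')]
        with p h1 h2 h3 h4 h5
      rw [h1, h2, h5, Pi.add_apply, Pi.add_apply, h3, h4, add_mul]; rfl)
    (fun c f g => by
      refine Lp.ext ?_
      filter_upwards [coeFn_tensor (c • f) g, Lp.coeFn_smul c (tensor f g),
        coeFn_tensor f g, tensorFun_congr_left (g := g) (Lp.coeFn_smul c f)]
        with p h1 h2 h3 h5
      rw [h1, h2, h5, Pi.smul_apply, Pi.smul_apply, h3, smul_eq_mul, smul_eq_mul, mul_assoc]; rfl)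
    (fun f g g' => by
      refine Lp.ext ?_
      filter_upwards [coeFn_tensor f (g + g'), Lp.coeFn_add (tensor f g) (tensor f g'),
        coeFn_tensor f g, coeFn_tensor f g', tensorFun_congr_right (f := f) (Lp.coeFn_add g g')]
        with p h1 h2 h3 h4 h5
      rw [h1, h2, h5, Pi.add_apply, Pi.add_apply, h3, h4, mul_add]; rfl)
    (fun c f g => by
      refine Lp.ext ?_
      filter_upwards [coeFn_tensor f (c • g), Lp.coeFn_smul c (tensor f g),
        coeFn_tensor f g, tensorFun_congr_right (f := f) (Lp.coeFn_smul c g)]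
        with p h1 h2 h3 h5
      rw [h1, h2, h5, Pi.smul_apply, Pi.smul_apply, h3, smul_eq_mul, smul_eq_mul, mul_left_comm]
      rfl))

theorem tensorₗ_tmul (f g : OneParticle δ M) : tensorₗ δ M (f ⊗ₜ g) = tensor f g := rfl

theorem inner_tensor (u v f g : OneParticle δ M) :
    inner ℂ (tensor u v) (tensor f g) = inner ℂ u f * inner ℂ v g := by
  rw [L2.inner_def, L2.inner_def, L2.inner_def, ← integral_prod_mul]
  refine integral_congr_ae ?_
  filter_upwards [coeFn_tensor u v, coeFn_tensor f g] with p h1 h2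
  rw [h1, h2]
  simp only [tensorFun, RCLike.inner_apply, map_mul]
  ring

theorem norm_tensor (u v : OneParticle δ M) : ‖tensor u v‖ = ‖u‖ * ‖v‖ := by
  have h := inner_tensor u v u v
  rw [inner_self_eq_norm_sq_to_K, inner_self_eq_norm_sq_to_K, inner_self_eq_norm_sq_to_K,
    ← mul_pow] at h
  have h' : ‖tensor u v‖ ^ 2 = (‖u‖ * ‖v‖) ^ 2 := by exact_mod_cast h
  exact (pow_left_inj₀ (norm_nonneg _) (by positivity) two_ne_zero).1 h'

/-- By the Riesz representation, `u ⊗ v` is the inner product with an elementary tensor of norm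
`‖u‖ ‖v‖`. -/
theorem norm_dualTensor_le (u v : StrongDual ℂ (OneParticle δ M))
    (x : OneParticle δ M ⊗[ℂ] OneParticle δ M) :
    ‖dualTensor u v x‖ ≤ ‖u‖ * ‖v‖ * ‖tensorₗ δ M x‖ := by
  set a := (InnerProductSpace.toDual ℂ (OneParticle δ M)).symm u
  set b := (InnerProductSpace.toDual ℂ (OneParticle δ M)).symm v
  have h : dualTensor u v x = inner ℂ (tensor a b) (tensorₗ δ M x) := by
    induction x using TensorProduct.induction_on with
    | zero => simp
    | tmul f g =>
      rw [dualTensor_tmul, tensorₗ_tmul, inner_tensor, InnerProductSpace.toDual_symm_apply,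
        InnerProductSpace.toDual_symm_apply]
    | add x y hx hy => rw [map_add, map_add, hx, hy, inner_add_right]
  rw [h]
  refine (norm_inner_le_norm _ _).trans ?_
  rw [norm_tensor, LinearIsometryEquiv.norm_map, LinearIsometryEquiv.norm_map]

end ConcreteWick

/-- A square integrable function on a product whose integrals over all rectangles of finite measure
vanish is zero. -/
theorem ae_eq_zero_of_forall_setIntegral_prod_eq_zero {α β : Type*} [MeasurableSpace α]
    [MeasurableSpace β] {μ : Measure α} {ν : Measure β} [SigmaFinite μ] [SigmaFinite ν]
    {F : α × β → ℂ} (hF : MemLp F 2 (μ.prod ν))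
    (h : ∀ A B, MeasurableSet A → MeasurableSet B → μ A < ⊤ → ν B < ⊤ →
      ∫ p in A ×ˢ B, F p ∂μ.prod ν = 0) : F =ᵐ[μ.prod ν] 0 := by
  let S : ℕ → Set (α × β) := fun n => spanningSets μ n ×ˢ spanningSets ν n
  have hSm : ∀ n, MeasurableSet (S n) := fun n =>
    (measurableSet_spanningSets μ n).prod (measurableSet_spanningSets ν n)
  have hSfin : ∀ n, μ.prod ν (S n) < ⊤ := fun n => by
    rw [Measure.prod_prod]
    exact ENNReal.mul_lt_top (measure_spanningSets_lt_top μ n) (measure_spanningSets_lt_top ν n)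
  have hU : ⋃ n, S n = Set.univ := by
    refine Set.eq_univ_of_forall fun p => Set.mem_iUnion.2 ?_
    refine ⟨max (spanningSetsIndex μ p.1) (spanningSetsIndex ν p.2), ?_, ?_⟩
    · exact monotone_spanningSets μ (le_max_left _ _) (mem_spanningSetsIndex μ p.1)
    · exact monotone_spanningSets ν (le_max_right _ _) (mem_spanningSetsIndex ν p.2)
  have key : ∀ n, F =ᵐ[(μ.prod ν).restrict (S n)] 0 := by
    intro n
    have : IsFiniteMeasure ((μ.prod ν).restrict (S n)) := ⟨by simpa using hSfin n⟩
    have hint : Integrable F ((μ.prod ν).restrict (S n)) :=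
      (hF.restrict (S n)).integrable (by norm_num)
    refine hint.ae_eq_zero_of_forall_setIntegral_eq_zero fun t ht _ => ?_
    induction t, ht using MeasurableSpace.induction_on_inter generateFrom_prod.symm
      isPiSystem_prod with
    | empty => simp
    | basic t ht =>
      obtain ⟨A, hA, B, hB, rfl⟩ := ht
      rw [Measure.restrict_restrict (hA.prod hB), Set.prod_inter_prod]
      refine h _ _ (hA.inter (measurableSet_spanningSets μ n))
        (hB.inter (measurableSet_spanningSets ν n)) ?_ ?_
      · exact (measure_mono Set.inter_subset_right).trans_lt (measure_spanningSets_lt_top μ n)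
      · exact (measure_mono Set.inter_subset_right).trans_lt (measure_spanningSets_lt_top ν n)
    | compl t ht hi =>
      have h0 : ∫ p in S n, F p ∂μ.prod ν = 0 := h _ _ (measurableSet_spanningSets μ n)
        (measurableSet_spanningSets ν n) (measure_spanningSets_lt_top μ n)
        (measure_spanningSets_lt_top ν n)
      have := integral_add_compl ht hint
      rw [hi (measure_lt_top _ _), zero_add, h0] at this
      exact this
    | iUnion f hd hm hi =>
      have := hasSum_integral_iUnion hm hd hint.integrableOn
      rw [← this.tsum_eq]
      simp [hi _ (measure_lt_top _ _)]
  have := ae_restrict_iUnion_eq S (μ := μ.prod ν)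
  rw [hU, Measure.restrict_univ] at this
  rw [Filter.EventuallyEq, this, Filter.eventually_iSup]
  exact key

section ConcreteWick

open scoped TensorProduct

variable {δ M : ℝ}

/-- A vector orthogonal to the tensor products of indicator functions vanishes. -/
theorem denseRange_tensorₗ : DenseRange (tensorₗ δ M) := by
  have : (LinearMap.range (tensorₗ δ M)).topologicalClosure = ⊤ := by
    rw [Submodule.topologicalClosure_eq_top_iff, Submodule.eq_bot_iff]
    intro F hF
    have hF' : ∀ f g, inner ℂ (tensor f g) F = 0 := fun f g =>
      (Submodule.mem_orthogonal _ F).1 hF _ ⟨f ⊗ₜ g, rfl⟩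
    refine (Lp.eq_zero_iff_ae_eq_zero).2
      (ae_eq_zero_of_forall_setIntegral_prod_eq_zero (Lp.memLp F) fun A B hA hB hA' hB' => ?_)
    rw [← hF' (indicatorConstLp 2 hA hA'.ne 1) (indicatorConstLp 2 hB hB'.ne 1), L2.inner_def,
      ← integral_indicator (hA.prod hB)]
    refine integral_congr_ae ?_
    filter_upwards [coeFn_tensor (indicatorConstLp 2 hA hA'.ne 1) (indicatorConstLp 2 hB hB'.ne 1),
      Measure.quasiMeasurePreserving_fst.ae (indicatorConstLp_coeFn (p := 2) (hs := hA)
        (hμs := hA'.ne) (c := (1 : ℂ))),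
      Measure.quasiMeasurePreserving_snd.ae (indicatorConstLp_coeFn (p := 2) (hs := hB)
        (hμs := hB'.ne) (c := (1 : ℂ)))] with p h1 h2 h3
    rw [h1, tensorFun, h2, h3]
    by_cases hpA : p.1 ∈ A <;> by_cases hpB : p.2 ∈ B <;> simp [hpA, hpB]
  have h := Submodule.dense_iff_topologicalClosure_eq_top.2 this
  rwa [LinearMap.coe_range] at h

theorem exists_isWickSquare (Γ : Filtration (conjU δ M)) :
    ∃ W, IsWickSquare Γ W ∧ ∀ n F, extNorm Γ n (W F) ≤ wickConst 8 n * ‖F‖ :=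
  exists_wickSquare (conjUₗ δ M) 8 (by norm_num) norm_conjUₗ_le (tensorₗ δ M) denseRange_tensorₗ
    norm_dualTensor_le Γ

theorem IsWickSquare.unique {Γ : Filtration (conjU δ M)} {W W' : TwoParticle δ M →L[ℂ] ExtCAR Γ}
    (h : IsWickSquare Γ W) (h' : IsWickSquare Γ W') : W = W' := by
  have h1 : W.toLinearMap ∘ₗ tensorₗ δ M = W'.toLinearMap ∘ₗ tensorₗ δ M :=
    TensorProduct.ext' fun f g => (h f g).trans (h' f g).symm
  have h2 : (W : TwoParticle δ M → ExtCAR Γ) = W' :=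
    denseRange_tensorₗ.equalizer W.continuous W'.continuous
      (funext fun x => LinearMap.congr_fun h1 x)
  exact DFunLike.coe_injective h2

theorem isWickSquare_wickSquare (Γ : Filtration (conjU δ M)) : IsWickSquare Γ (wickSquare Γ) := by
  have h : ∃ W, IsWickSquare Γ W := (exists_isWickSquare Γ).imp fun _ h => h.1
  rw [wickSquare, dif_pos h]
  exact h.choose_spec

theorem extNorm_wickSquare_le (Γ : Filtration (conjU δ M)) (n : ℕ) (F : TwoParticle δ M) :
    extNorm Γ n (wickSquare Γ F) ≤ wickConst 8 n * ‖F‖ := by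
  obtain ⟨W, hW, hb⟩ := exists_isWickSquare Γ
  rw [(isWickSquare_wickSquare Γ).unique hW]
  exact hb n F

end ConcreteWick

/-! ### Sums over the frequency lattice -/

section Lattice

variable {M : ℝ}

/-- The symbol `ω_k = √(4π²|k|² + M²)` of `√(-Δ + M²)`. -/
def freq (M : ℝ) (k : ℤ × ℤ) : ℝ := √(symbolSq M k)

theorem freq_sq (M : ℝ) (k : ℤ × ℤ) : freq M k ^ 2 = symbolSq M k :=
  Real.sq_sqrt (symbolSq_nonneg M k)

theorem le_freq (M : ℝ) (k : ℤ × ℤ) : M ≤ freq M k := by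
  refine Real.le_sqrt_of_sq_le ?_
  unfold symbolSq
  have : 0 ≤ 4 * Real.pi ^ 2 * ((k.1 : ℝ) ^ 2 + (k.2 : ℝ) ^ 2) := by positivity
  linarith

theorem freq_pos (hM : 0 < M) (k : ℤ × ℤ) : 0 < freq M k := hM.trans_le (le_freq M k)

theorem abs_fst_le_freq (M : ℝ) (k : ℤ × ℤ) : 2 * Real.pi * |(k.1 : ℝ)| ≤ freq M k := by
  refine Real.le_sqrt_of_sq_le ?_
  unfold symbolSq
  rw [mul_pow, sq_abs]
  nlinarith [sq_nonneg M, sq_nonneg (Real.pi * k.2)]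

theorem abs_snd_le_freq (M : ℝ) (k : ℤ × ℤ) : 2 * Real.pi * |(k.2 : ℝ)| ≤ freq M k := by
  refine Real.le_sqrt_of_sq_le ?_
  unfold symbolSq
  rw [mul_pow, sq_abs]
  nlinarith [sq_nonneg M, sq_nonneg (Real.pi * k.1)]

theorem freq_le (hM : 0 < M) (k : ℤ × ℤ) :
    freq M k ≤ 2 * Real.pi * |(k.1 : ℝ)| + 2 * Real.pi * |(k.2 : ℝ)| + M := by
  refine Real.sqrt_le_iff.2 ⟨by positivity, ?_⟩
  unfold symbolSq
  have h1 := sq_abs (k.1 : ℝ)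
  have h2 := sq_abs (k.2 : ℝ)
  have hp := Real.pi_pos
  have h3 : 0 ≤ Real.pi * |(k.1 : ℝ)| := by positivity
  have h4 : 0 ≤ Real.pi * |(k.2 : ℝ)| := by positivity
  rw [← h1, ← h2]
  nlinarith [mul_nonneg h3 h4, mul_nonneg h3 hM.le, mul_nonneg h4 hM.le]

/-- `ω_k` is the Euclidean norm of the vector `(2πk₁, 2πk₂, M)`, whence the triangle inequality. -/
theorem freq_add_le (hM : 0 < M) (k l : ℤ × ℤ) : freq M (k + l) ≤ freq M k + freq M l := by
  have hk := (freq_pos hM k).le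
  have hl := (freq_pos hM l).le
  refine Real.sqrt_le_iff.2 ⟨by positivity, ?_⟩
  have h : 4 * Real.pi ^ 2 * ((k.1 : ℝ) * l.1 + (k.2 : ℝ) * l.2) ≤ freq M k * freq M l := by
    refine le_of_sq_le_sq ?_ (by positivity)
    rw [mul_pow (freq M k), freq_sq, freq_sq]
    unfold symbolSq
    have h1 : 0 ≤ 16 * Real.pi ^ 4 * ((k.1 : ℝ) * l.2 - (k.2 : ℝ) * l.1) ^ 2 := by positivity
    have h2 : 0 ≤ 4 * Real.pi ^ 2 * ((k.1 : ℝ) ^ 2 + (k.2 : ℝ) ^ 2) * M ^ 2 := by positivity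
    have h3 : 0 ≤ 4 * Real.pi ^ 2 * ((l.1 : ℝ) ^ 2 + (l.2 : ℝ) ^ 2) * M ^ 2 := by positivity
    have h4 : 0 ≤ M ^ 4 := by positivity
    nlinarith
  rw [add_sq, freq_sq, freq_sq]
  unfold symbolSq
  simp only [Prod.fst_add, Prod.snd_add, Int.cast_add]
  nlinarith [sq_nonneg M]

/-- The number of frequencies with `ω_k ≤ R` is at most of order `R²`. -/
theorem exists_card_freq_le (hM : 0 < M) : ∃ C : ℝ, 0 < C ∧ ∀ R : ℝ, 0 < R →
    ∑' k : ℤ × ℤ, (if freq M k ≤ R then 1 else 0 : ℝ≥0∞) ≤ ENNReal.ofReal (C * R ^ 2) := by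
  refine ⟨(2 + 3 / M) ^ 2, by positivity, fun R hR => ?_⟩
  rcases lt_or_ge R M with hRM | hRM
  · have : ∀ k : ℤ × ℤ, (if freq M k ≤ R then 1 else 0 : ℝ≥0∞) = 0 := fun k =>
      if_neg (not_le.2 (hRM.trans_le (le_freq M k)))
    simp [this]
  set N : ℤ := ⌊R⌋ with hN
  have hN0 : 0 ≤ N := Int.floor_nonneg.2 hR.le
  let s : Finset (ℤ × ℤ) := Finset.Icc (-N) N ×ˢ Finset.Icc (-N) N
  have hs : ∀ k, freq M k ≤ R → k ∈ s := by
    intro k hk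
    have hp : (1 : ℝ) ≤ 2 * Real.pi := by linarith [Real.pi_gt_three]
    have h1 : |(k.1 : ℝ)| ≤ R := by
      have := abs_fst_le_freq M k
      nlinarith [abs_nonneg (k.1 : ℝ)]
    have h2 : |(k.2 : ℝ)| ≤ R := by
      have := abs_snd_le_freq M k
      nlinarith [abs_nonneg (k.2 : ℝ)]
    have h1' : |k.1| ≤ N := Int.le_floor.2 (by push_cast; exact h1)
    have h2' : |k.2| ≤ N := Int.le_floor.2 (by push_cast; exact h2)
    simp only [s, Finset.mem_product, Finset.mem_Icc]
    exact ⟨abs_le.1 h1', abs_le.1 h2'⟩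
  calc ∑' k : ℤ × ℤ, (if freq M k ≤ R then 1 else 0 : ℝ≥0∞)
      = ∑ k ∈ s, (if freq M k ≤ R then 1 else 0 : ℝ≥0∞) :=
        tsum_eq_sum fun k hk => if_neg fun h => hk (hs k h)
    _ ≤ ∑ _k ∈ s, 1 := Finset.sum_le_sum fun k _ => by split_ifs <;> simp
    _ = ENNReal.ofReal ((2 * N + 1) ^ 2 : ℝ) := by
        have hc : (s.card : ℤ) = (2 * N + 1) ^ 2 := by
          simp only [s, Finset.card_product, Int.card_Icc]
          push_cast
          rw [Int.toNat_of_nonneg (by omega)]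
          ring
        have hc' : (s.card : ℝ) = (2 * N + 1) ^ 2 := by exact_mod_cast hc
        rw [Finset.sum_const, nsmul_eq_mul, mul_one, ← hc', ENNReal.ofReal_natCast]
    _ ≤ ENNReal.ofReal ((2 + 3 / M) ^ 2 * R ^ 2) := by
        refine ENNReal.ofReal_le_ofReal ?_
        rw [← mul_pow]
        have h1 : (N : ℝ) ≤ R := Int.floor_le R
        have h2 : (0 : ℝ) ≤ N := by exact_mod_cast hN0
        have h3 : 1 ≤ 3 / M * R := by
          rw [div_mul_eq_mul_div, le_div_iff₀ hM]; linarith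
        gcongr
        linarith

/-- Powers of `ω_k` below the critical exponent, summed over low frequencies; the sum is decomposed
into dyadic shells. -/
theorem exists_sum_low_le (hM : 0 < M) {β : ℝ} (hβ : 0 ≤ β) (hβ' : β < 2) :
    ∃ C : ℝ, 0 < C ∧ ∀ R : ℝ, 0 < R →
    ∑' k : ℤ × ℤ, (if freq M k ≤ R then ENNReal.ofReal (freq M k ^ (-β)) else 0) ≤
      ENNReal.ofReal (C * R ^ (2 - β)) := by
  obtain ⟨C, hC, hcard⟩ := exists_card_freq_le hM
  set q : ℝ := (2 : ℝ) ^ (β - 2) with hq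
  have hq0 : 0 < q := by positivity
  have hq1 : q < 1 := Real.rpow_lt_one_of_one_lt_of_neg (by norm_num) (by linarith)
  refine ⟨C * 2 ^ β * (1 - q)⁻¹, by have := sub_pos.2 hq1; positivity, fun R hR => ?_⟩
  have hpt : ∀ k, (if freq M k ≤ R then ENNReal.ofReal (freq M k ^ (-β)) else 0) ≤
      ∑' j : ℕ, ENNReal.ofReal ((R * 2⁻¹ ^ (j + 1)) ^ (-β)) *
        (if freq M k ≤ R * 2⁻¹ ^ j then 1 else 0 : ℝ≥0∞) := by
    intro k
    split_ifs with hk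
    · have hf := freq_pos hM k
      obtain ⟨j, hj1, hj2⟩ := exists_nat_pow_near_of_lt_one (x := freq M k / R) (y := (2⁻¹ : ℝ))
        (by positivity) (by rwa [div_le_one hR]) (by norm_num) (by norm_num)
      rw [div_le_iff₀ hR, mul_comm] at hj2
      rw [lt_div_iff₀ hR, mul_comm] at hj1
      refine le_trans ?_ (ENNReal.le_tsum j)
      rw [if_pos hj2, mul_one]
      exact ENNReal.ofReal_le_ofReal
        (Real.rpow_le_rpow_of_nonpos (by positivity) hj1.le (by linarith))
    · exact zero_le
  have hterm : ∀ j : ℕ, (R * 2⁻¹ ^ (j + 1)) ^ (-β) * (C * (R * 2⁻¹ ^ j) ^ 2) =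
      C * 2 ^ β * R ^ (2 - β) * q ^ j := by
    intro j
    have e1 : ((2⁻¹ : ℝ)) ^ (j + 1) = 2 ^ (-(j + 1 : ℝ)) := by
      rw [inv_pow, Real.rpow_neg (by norm_num)]; norm_cast
    have e2 : ((2⁻¹ : ℝ)) ^ j = 2 ^ (-(j : ℝ)) := by
      rw [inv_pow, Real.rpow_neg (by norm_num)]; norm_cast
    have e3 : q ^ j = 2 ^ ((β - 2) * j) := by
      rw [hq, Real.rpow_mul (by norm_num), Real.rpow_natCast]
    rw [e1, e2, e3, Real.mul_rpow hR.le (by positivity), ← Real.rpow_mul (by norm_num), mul_pow,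
      ← Real.rpow_natCast (2 ^ (-(j : ℝ))), ← Real.rpow_mul (by norm_num),
      sub_eq_add_neg (2 : ℝ) β, Real.rpow_add hR, Real.rpow_two,
      show (β - 2) * (j : ℝ) = -β + (-(j + 1 : ℝ) * -β + -(j : ℝ) * ((2 : ℕ) : ℝ)) by
        push_cast; ring,
      Real.rpow_add (by norm_num) (-β), Real.rpow_add (by norm_num),
      Real.rpow_neg (by norm_num : (0 : ℝ) ≤ 2) β]
    field_simp
  calc _ ≤ ∑' k : ℤ × ℤ, ∑' j : ℕ, ENNReal.ofReal ((R * 2⁻¹ ^ (j + 1)) ^ (-β)) *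
        (if freq M k ≤ R * 2⁻¹ ^ j then 1 else 0 : ℝ≥0∞) := ENNReal.tsum_le_tsum hpt
    _ = ∑' j : ℕ, ENNReal.ofReal ((R * 2⁻¹ ^ (j + 1)) ^ (-β)) *
        ∑' k : ℤ × ℤ, (if freq M k ≤ R * 2⁻¹ ^ j then 1 else 0 : ℝ≥0∞) := by
        rw [ENNReal.tsum_comm]; simp_rw [ENNReal.tsum_mul_left]
    _ ≤ ∑' j : ℕ, ENNReal.ofReal (C * 2 ^ β * R ^ (2 - β) * q ^ j) := by
        refine ENNReal.tsum_le_tsum fun j => ?_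
        rw [← hterm, ENNReal.ofReal_mul (by positivity)]
        gcongr
        exact hcard _ (by positivity)
    _ = ENNReal.ofReal (C * 2 ^ β * (1 - q)⁻¹ * R ^ (2 - β)) := by
        rw [← ENNReal.ofReal_tsum_of_nonneg (fun j => by positivity)
          ((summable_geometric_of_lt_one hq0.le hq1).mul_left _), tsum_mul_left,
          tsum_geometric_of_lt_one hq0.le hq1]
        congr 1; ring

/-- Powers of `ω_k` above the critical exponent, summed over high frequencies. -/
theorem exists_sum_high_le (hM : 0 < M) {γ : ℝ} (hγ : 2 < γ) :
    ∃ C : ℝ, 0 < C ∧ ∀ R : ℝ, 0 < R →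
    ∑' k : ℤ × ℤ, (if R < freq M k then ENNReal.ofReal (freq M k ^ (-γ)) else 0) ≤
      ENNReal.ofReal (C * R ^ (2 - γ)) := by
  obtain ⟨C, hC, hcard⟩ := exists_card_freq_le hM
  set q : ℝ := (2 : ℝ) ^ (2 - γ) with hq
  have hq0 : 0 < q := by positivity
  have hq1 : q < 1 := Real.rpow_lt_one_of_one_lt_of_neg (by norm_num) (by linarith)
  refine ⟨C * 4 * (1 - q)⁻¹, by have := sub_pos.2 hq1; positivity, fun R hR => ?_⟩
  have hpt : ∀ k, (if R < freq M k then ENNReal.ofReal (freq M k ^ (-γ)) else 0) ≤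
      ∑' j : ℕ, ENNReal.ofReal ((R * 2 ^ j) ^ (-γ)) *
        (if freq M k ≤ R * 2 ^ (j + 1) then 1 else 0 : ℝ≥0∞) := by
    intro k
    split_ifs with hk
    · have hf := freq_pos hM k
      obtain ⟨j, hj1, hj2⟩ := exists_nat_pow_near (x := freq M k / R) (y := (2 : ℝ))
        (by rw [le_div_iff₀ hR]; linarith) (by norm_num)
      rw [le_div_iff₀ hR, mul_comm] at hj1
      rw [div_lt_iff₀ hR, mul_comm] at hj2
      refine le_trans ?_ (ENNReal.le_tsum j)
      rw [if_pos hj2.le, mul_one]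
      exact ENNReal.ofReal_le_ofReal
        (Real.rpow_le_rpow_of_nonpos (by positivity) hj1 (by linarith))
    · exact zero_le
  have hterm : ∀ j : ℕ, (R * 2 ^ j) ^ (-γ) * (C * (R * 2 ^ (j + 1)) ^ 2) =
      C * 4 * R ^ (2 - γ) * q ^ j := by
    intro j
    have e3 : q ^ j = 2 ^ ((2 - γ) * j) := by
      rw [hq, Real.rpow_mul (by norm_num), Real.rpow_natCast]
    rw [e3, Real.mul_rpow hR.le (by positivity), ← Real.rpow_natCast 2 j,
      ← Real.rpow_mul (by norm_num), sub_eq_add_neg (2 : ℝ) γ, Real.rpow_add hR, Real.rpow_two,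
      show (2 + -γ) * (j : ℝ) = j * -γ + (j + j) by ring, Real.rpow_add (by norm_num),
      Real.rpow_add (by norm_num) (j : ℝ) j, Real.rpow_natCast]
    ring
  calc _ ≤ ∑' k : ℤ × ℤ, ∑' j : ℕ, ENNReal.ofReal ((R * 2 ^ j) ^ (-γ)) *
        (if freq M k ≤ R * 2 ^ (j + 1) then 1 else 0 : ℝ≥0∞) := ENNReal.tsum_le_tsum hpt
    _ = ∑' j : ℕ, ENNReal.ofReal ((R * 2 ^ j) ^ (-γ)) *
        ∑' k : ℤ × ℤ, (if freq M k ≤ R * 2 ^ (j + 1) then 1 else 0 : ℝ≥0∞) := by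
        rw [ENNReal.tsum_comm]; simp_rw [ENNReal.tsum_mul_left]
    _ ≤ ∑' j : ℕ, ENNReal.ofReal (C * 4 * R ^ (2 - γ) * q ^ j) := by
        refine ENNReal.tsum_le_tsum fun j => ?_
        rw [← hterm, ENNReal.ofReal_mul (by positivity)]
        gcongr
        exact hcard _ (by positivity)
    _ = ENNReal.ofReal (C * 4 * (1 - q)⁻¹ * R ^ (2 - γ)) := by
        rw [← ENNReal.ofReal_tsum_of_nonneg (fun j => by positivity)
          ((summable_geometric_of_lt_one hq0.le hq1).mul_left _), tsum_mul_left,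
          tsum_geometric_of_lt_one hq0.le hq1]
        congr 1; ring

/-- The discrete convolution of `ω^{-a}` with itself, `1 < a < 2`, decays like `ω^{2-2a}`. -/
theorem exists_sum_conv_le (hM : 0 < M) {a : ℝ} (ha : 1 < a) (ha' : a < 2) :
    ∃ C : ℝ, 0 < C ∧ ∀ K : ℤ × ℤ,
    ∑' k : ℤ × ℤ, ENNReal.ofReal (freq M k ^ (-a) * freq M (K - k) ^ (-a)) ≤
      ENNReal.ofReal (C * freq M K ^ (2 - 2 * a)) := by
  obtain ⟨C₁, hC₁, h₁⟩ := exists_sum_low_le hM (by linarith : 0 ≤ a) ha'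
  obtain ⟨C₂, hC₂, h₂⟩ := exists_sum_high_le hM (by linarith : 2 < 2 * a)
  refine ⟨2 * (2 ^ a * C₁ + C₂), by positivity, fun K => ?_⟩
  have hK := freq_pos hM K
  let f : ℤ × ℤ → ℝ≥0∞ := fun k =>
    ENNReal.ofReal ((freq M K / 2) ^ (-a)) *
      (if freq M k ≤ freq M K then ENNReal.ofReal (freq M k ^ (-a)) else 0) +
    (if freq M K < freq M k then ENNReal.ofReal (freq M k ^ (-(2 * a))) else 0)
  -- if `k` is the smaller one of the two frequencies, then the larger one is at least `ω_K / 2`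
  have hf : ∀ k l, freq M K ≤ freq M k + freq M l → freq M k ≤ freq M l →
      ENNReal.ofReal (freq M k ^ (-a) * freq M l ^ (-a)) ≤ f k := by
    intro k l hadd hkl
    have hk := freq_pos hM k
    have hl := freq_pos hM l
    rcases le_or_gt (freq M k) (freq M K) with h | h
    · simp only [f, if_pos h, if_neg (not_lt.2 h), add_zero]
      rw [← ENNReal.ofReal_mul (by positivity), mul_comm]
      refine ENNReal.ofReal_le_ofReal (mul_le_mul_of_nonneg_right ?_ (by positivity))
      exact Real.rpow_le_rpow_of_nonpos (by positivity) (by linarith) (by linarith)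
    · simp only [f, if_pos h, if_neg (not_le.2 h), mul_zero, zero_add]
      refine ENNReal.ofReal_le_ofReal ?_
      rw [show -(2 * a) = -a + -a by ring, Real.rpow_add hk]
      refine mul_le_mul_of_nonneg_left ?_ (by positivity)
      exact Real.rpow_le_rpow_of_nonpos hk hkl (by linarith)
  have hfs : ∑' k, f k ≤ ENNReal.ofReal ((2 ^ a * C₁ + C₂) * freq M K ^ (2 - 2 * a)) := by
    simp only [f]
    rw [ENNReal.tsum_add, ENNReal.tsum_mul_left]
    calc _ ≤ ENNReal.ofReal ((freq M K / 2) ^ (-a)) * ENNReal.ofReal (C₁ * freq M K ^ (2 - a)) +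
          ENNReal.ofReal (C₂ * freq M K ^ (2 - 2 * a)) := by
          gcongr
          · exact h₁ _ hK
          · exact h₂ _ hK
      _ = _ := by
          rw [← ENNReal.ofReal_mul (by positivity), ← ENNReal.ofReal_add (by positivity)
            (by positivity)]
          congr 1
          rw [Real.div_rpow hK.le (by norm_num), show (2 - 2 * a) = -a + (2 - a) by ring,
            Real.rpow_add hK, Real.rpow_neg (by norm_num : (0 : ℝ) ≤ 2) a]
          field_simp
  have hpt : ∀ k, ENNReal.ofReal (freq M k ^ (-a) * freq M (K - k) ^ (-a)) ≤ f k + f (K - k) := by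
    intro k
    have hadd : freq M K ≤ freq M k + freq M (K - k) := by
      simpa using freq_add_le hM k (K - k)
    rcases le_total (freq M k) (freq M (K - k)) with h | h
    · exact (hf k (K - k) hadd h).trans le_self_add
    · rw [mul_comm]
      exact (hf (K - k) k (by linarith) h).trans le_add_self
  calc _ ≤ ∑' k, (f k + f (K - k)) := ENNReal.tsum_le_tsum hpt
    _ = ∑' k, f k + ∑' k, f k := by
        rw [ENNReal.tsum_add, show ∑' k, f (K - k) = ∑' k, f k from (Equiv.subLeft K).tsum_eq f]
    _ ≤ ENNReal.ofReal ((2 ^ a * C₁ + C₂) * freq M K ^ (2 - 2 * a)) +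
        ENNReal.ofReal ((2 ^ a * C₁ + C₂) * freq M K ^ (2 - 2 * a)) := add_le_add hfs hfs
    _ = _ := by
        rw [← ENNReal.ofReal_add (by positivity) (by positivity)]
        congr 1; ring

/-- The decay `min(1, (λ ω_k)⁻¹)` of the Fourier transform of a test function at scale `λ`. -/
def decay (M lam : ℝ) (k : ℤ × ℤ) : ℝ := min 1 (lam * freq M k)⁻¹

theorem decay_nonneg (hM : 0 < M) {lam : ℝ} (hl : 0 < lam) (k : ℤ × ℤ) : 0 ≤ decay M lam k :=
  le_min zero_le_one (inv_nonneg.2 (mul_nonneg hl.le (freq_pos hM k).le))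

/-- The sum that determines the regularity of the Wick square. -/
theorem exists_sum_decay_le (hM : 0 < M) {β : ℝ} (hβ : 0 < β) (hβ' : β < 2) :
    ∃ C : ℝ, 0 < C ∧ ∀ lam : ℝ, 0 < lam →
    ∑' k : ℤ × ℤ, ENNReal.ofReal (freq M k ^ (-β) * decay M lam k ^ 2) ≤
      ENNReal.ofReal (C * lam ^ (β - 2)) := by
  obtain ⟨C₁, hC₁, h₁⟩ := exists_sum_low_le hM hβ.le hβ'
  obtain ⟨C₂, hC₂, h₂⟩ := exists_sum_high_le hM (by linarith : 2 < β + 2)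
  refine ⟨C₁ + C₂, by positivity, fun lam hl => ?_⟩
  have hpt : ∀ k, ENNReal.ofReal (freq M k ^ (-β) * decay M lam k ^ 2) ≤
      (if freq M k ≤ lam⁻¹ then ENNReal.ofReal (freq M k ^ (-β)) else 0) +
      ENNReal.ofReal (lam ^ (-2 : ℝ)) *
        (if lam⁻¹ < freq M k then ENNReal.ofReal (freq M k ^ (-(β + 2))) else 0) := by
    intro k
    have hk := freq_pos hM k
    have hd := decay_nonneg hM hl k
    rcases le_or_gt (freq M k) lam⁻¹ with h | h
    · rw [if_pos h, if_neg (not_lt.2 h), mul_zero, add_zero]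
      refine ENNReal.ofReal_le_ofReal (mul_le_of_le_one_right (by positivity) ?_)
      exact pow_le_one₀ hd (min_le_left _ _)
    · rw [if_neg (not_le.2 h), if_pos h, zero_add, ← ENNReal.ofReal_mul (by positivity)]
      refine ENNReal.ofReal_le_ofReal ?_
      calc freq M k ^ (-β) * decay M lam k ^ 2
          ≤ freq M k ^ (-β) * ((lam * freq M k)⁻¹) ^ 2 := by
            gcongr; exact min_le_right _ _
        _ = lam ^ (-2 : ℝ) * freq M k ^ (-(β + 2)) := by
            rw [neg_add, Real.rpow_add hk, Real.rpow_neg hl.le, Real.rpow_neg hk.le 2,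
              Real.rpow_two, Real.rpow_two]
            field_simp
  calc _ ≤ _ := ENNReal.tsum_le_tsum hpt
    _ ≤ ENNReal.ofReal (C₁ * lam⁻¹ ^ (2 - β)) +
        ENNReal.ofReal (lam ^ (-2 : ℝ)) * ENNReal.ofReal (C₂ * lam⁻¹ ^ (2 - (β + 2))) := by
        rw [ENNReal.tsum_add, ENNReal.tsum_mul_left]
        gcongr
        · exact h₁ _ (inv_pos.2 hl)
        · exact h₂ _ (inv_pos.2 hl)
    _ = ENNReal.ofReal ((C₁ + C₂) * lam ^ (β - 2)) := by
        rw [← ENNReal.ofReal_mul (by positivity), ← ENNReal.ofReal_add (by positivity)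
          (by positivity), Real.inv_rpow hl.le, Real.inv_rpow hl.le, ← Real.rpow_neg hl.le,
          ← Real.rpow_neg hl.le, mul_left_comm, ← Real.rpow_add hl, add_mul]
        ring_nf

end Lattice

/-! ### Spatial Fourier coefficients of the kernels -/

section Phase

/-- The character `e^{-2πi k·x}`. -/
def phase (k : ℤ × ℤ) (x : ℝ × ℝ) : ℂ :=
  Complex.exp (-(2 * Real.pi * Complex.I * (k.1 * x.1 + k.2 * x.2)))

theorem phase_eq (k : ℤ × ℤ) (x : ℝ × ℝ) :
    phase k x = Complex.exp (((-(2 * Real.pi * (k.1 * x.1 + k.2 * x.2)) : ℝ) : ℂ) * Complex.I) := by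
  rw [phase]; congr 1; push_cast; ring

theorem norm_phase (k : ℤ × ℤ) (x : ℝ × ℝ) : ‖phase k x‖ = 1 := by
  rw [phase_eq, Complex.norm_exp_ofReal_mul_I]

theorem continuous_phase (k : ℤ × ℤ) : Continuous (phase k) := by
  unfold phase; fun_prop

theorem phase_add (k : ℤ × ℤ) (x y : ℝ × ℝ) : phase k (x + y) = phase k x * phase k y := by
  rw [phase, phase, phase, ← Complex.exp_add]
  congr 1; simp only [Prod.fst_add, Prod.snd_add, Complex.ofReal_add]; ring

theorem phase_add_left (k l : ℤ × ℤ) (x : ℝ × ℝ) : phase (k + l) x = phase k x * phase l x := by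
  rw [phase, phase, phase, ← Complex.exp_add]
  congr 1; simp only [Prod.fst_add, Prod.snd_add, Int.cast_add]; ring

theorem phase_int (k l : ℤ × ℤ) : phase k (l.1, l.2) = 1 := by
  rw [phase, Complex.exp_eq_one_iff]
  exact ⟨-(k.1 * l.1 + k.2 * l.2), by push_cast; ring⟩

theorem norm_phase_sub_one_le (M : ℝ) (k : ℤ × ℤ) (x : ℝ × ℝ) :
    ‖phase k x - 1‖ ≤ freq M k * (|x.1| + |x.2|) := by
  rw [phase_eq]
  have h0 := Real.norm_exp_I_mul_ofReal_sub_one_le (x := -(2 * Real.pi * (k.1 * x.1 + k.2 * x.2)))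
  rw [mul_comm Complex.I] at h0
  refine h0.trans ?_
  rw [norm_neg, Real.norm_eq_abs, abs_mul, abs_of_pos (by positivity : 0 < 2 * Real.pi)]
  have h1 := abs_fst_le_freq M k
  have h2 := abs_snd_le_freq M k
  calc 2 * Real.pi * |(k.1 : ℝ) * x.1 + k.2 * x.2|
      ≤ 2 * Real.pi * (|(k.1 : ℝ) * x.1| + |(k.2 : ℝ) * x.2|) := by
        gcongr; exact abs_add_le _ _
    _ = 2 * Real.pi * |(k.1 : ℝ)| * |x.1| + 2 * Real.pi * |(k.2 : ℝ)| * |x.2| := by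
        rw [abs_mul, abs_mul]; ring
    _ ≤ freq M k * |x.1| + freq M k * |x.2| := by gcongr
    _ = _ := by ring

end Phase

/-- The representation of a kernel `G` by its spatial Fourier coefficients `H`: translation acts by
phases in space, and by translation in time. -/
def IsProfile (G : Spacetime → ℝ) (H : ℤ × ℤ → ℝ → ℂ) : Prop :=
  ∀ z t k, modeCoeff G z t k = phase k z.2 * H k (z.1 - t)

/-- Unfolding: the integral over `ℝ²` of the periodisation of `g`, cut off by a partition of unity,
is the integral of `g`, also when tested against a character. -/
theorem integral_periodisation {φ : ℝ × ℝ → ℝ} (hφ : Continuous φ)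
    (hφ' : ∀ x, φ x ∈ Set.Icc (0 : ℝ) 1)
    (hsum : ∀ x : ℝ × ℝ, ∑' k : ℤ × ℤ, φ (x.1 + k.1, x.2 + k.2) = 1)
    {g : ℝ × ℝ → ℝ} (hg : Integrable g) (k : ℤ × ℤ) :
    ∫ y, ((∑' l : ℤ × ℤ, φ y * g (y.1 + l.1, y.2 + l.2) : ℝ) : ℂ) * phase k (-y) =
      ∫ y, (g y : ℂ) * phase k (-y) := by
  let c : ℤ × ℤ → ℝ × ℝ := fun l => (l.1, l.2)
  have hsumm : ∀ x : ℝ × ℝ, Summable fun l => φ (x - c l) := by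
    intro x
    have h1 : Summable fun l : ℤ × ℤ => φ (x.1 + l.1, x.2 + l.2) := by
      by_contra h
      have := hsum x
      rw [tsum_eq_zero_of_not_summable h] at this
      exact zero_ne_one this
    have := (Equiv.neg (ℤ × ℤ)).summable_iff.2 h1
    refine this.congr fun l => ?_
    simp [c, sub_eq_add_neg]
    congr 1
  have htsum : ∀ x : ℝ × ℝ, ∑' l, φ (x - c l) = 1 := by
    intro x
    rw [← hsum x, ← (Equiv.neg (ℤ × ℤ)).tsum_eq fun l : ℤ × ℤ => φ (x.1 + l.1, x.2 + l.2)]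
    refine tsum_congr fun l => ?_
    congr 1
    simp [c, sub_eq_add_neg, Prod.ext_iff]
  let F : ℤ × ℤ → ℝ × ℝ → ℂ := fun l y => ((φ (y - c l) * g y : ℝ) : ℂ) * phase k (-y)
  have hFnorm : ∀ l y, ‖F l y‖ = φ (y - c l) * |g y| := by
    intro l y
    rw [norm_mul, norm_phase, mul_one, Complex.norm_real, Real.norm_eq_abs, abs_mul,
      abs_of_nonneg (hφ' _).1]
  have hFint : ∀ l, Integrable (F l) := by
    intro l
    refine Integrable.mono (g := g) hg ?_ (Eventually.of_forall fun y => ?_)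
    · refine AEStronglyMeasurable.mul ?_
        ((continuous_phase k).comp continuous_neg).aestronglyMeasurable
      refine Complex.continuous_ofReal.comp_aestronglyMeasurable ?_
      exact (hφ.comp (continuous_id.sub continuous_const)).aestronglyMeasurable.mul hg.1
    · rw [hFnorm, Real.norm_eq_abs]
      exact mul_le_of_le_one_left (abs_nonneg _) (hφ' _).2
  have hFsum : Summable fun l => ∫ y, ‖F l y‖ := by
    refine summable_of_sum_le (c := ∫ y, |g y|) (fun l => integral_nonneg fun y => norm_nonneg _)
      fun s => ?_
    rw [← integral_finsetSum s fun l _ => (hFint l).norm]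
    refine integral_mono (integrable_finsetSum s fun l _ => (hFint l).norm) hg.norm fun y => ?_
    simp only [hFnorm, ← Finset.sum_mul]
    refine mul_le_of_le_one_left (abs_nonneg _) ?_
    rw [← htsum y]
    exact (hsumm y).sum_le_tsum s fun l _ => (hφ' _).1
  have hshift : ∀ l y, ((φ y * g (y.1 + l.1, y.2 + l.2) : ℝ) : ℂ) * phase k (-y) =
      F l (y + c l) := by
    intro l y
    simp only [F, add_sub_cancel_right, neg_add]
    rw [phase_add, show -c l = ((((-l).1 : ℤ) : ℝ), (((-l).2 : ℤ) : ℝ)) by simp [c],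
      phase_int, mul_one]
    rfl
  have hs1 := hasSum_integral_of_summable_integral_norm hFint hFsum
  have hs2 := hasSum_integral_of_summable_integral_norm (F := fun l y => F l (y + c l))
    (fun l => (hFint l).comp_add_right (c l)) (by
      refine hFsum.congr fun l => ?_
      rw [integral_add_right_eq_self (fun y => ‖F l y‖) (c l)])
  have heq : ∀ l, ∫ y, F l (y + c l) = ∫ y, F l y := fun l =>
    integral_add_right_eq_self (F l) (c l)
  simp only [heq] at hs2
  have := hs2.unique hs1
  calc _ = ∫ y, ∑' l, F l (y + c l) := by
        refine integral_congr_ae (Eventually.of_forall fun y => ?_)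
        simp only [← hshift]
        rw [tsum_mul_right, Complex.ofReal_tsum]
    _ = ∫ y, ∑' l, F l y := this
    _ = _ := by
        refine integral_congr_ae (Eventually.of_forall fun y => ?_)
        simp only [F]
        rw [tsum_mul_right, ← Complex.ofReal_tsum, tsum_mul_right, htsum, one_mul]

/-! ### The heat kernel -/

theorem heatKernel_nonneg (y : Spacetime) : 0 ≤ heatKernel y := by
  unfold heatKernel
  split_ifs with h
  · positivity
  · exact le_rfl

theorem integral_heatKernel_mul_phase {τ : ℝ} (hτ : 0 < τ) (k : ℤ × ℤ) :
    ∫ y : ℝ × ℝ, (heatKernel (τ, y) : ℂ) * phase k (-y) =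
      Real.exp (-(τ * (4 * Real.pi ^ 2 * ((k.1 : ℝ) ^ 2 + (k.2 : ℝ) ^ 2)))) := by
  have hτ' : (τ : ℂ) ≠ 0 := by exact_mod_cast hτ.ne'
  have hπ : (Real.pi : ℂ) ≠ 0 := by exact_mod_cast Real.pi_ne_zero
  have hb : 0 < ((((4 * τ)⁻¹ : ℝ)) : ℂ).re := by rw [Complex.ofReal_re]; positivity
  let f : ℝ → ℝ → ℂ := fun a y => Complex.exp (Complex.I * ((2 * Real.pi * a : ℝ) : ℂ) * y) *
    Complex.exp (-(((4 * τ)⁻¹ : ℝ) : ℂ) * y ^ 2)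
  have hf : ∀ a : ℝ, ∫ y, f a y = (Real.pi / (((4 * τ)⁻¹ : ℝ) : ℂ)) ^ (1 / 2 : ℂ) *
      Complex.exp (-(((2 * Real.pi * a : ℝ) : ℂ)) ^ 2 / (4 * (((4 * τ)⁻¹ : ℝ) : ℂ))) := fun a =>
    fourierIntegral_gaussian hb _
  have hpt : ∀ y : ℝ × ℝ, (heatKernel (τ, y) : ℂ) * phase k (-y) =
      (((4 * Real.pi * τ)⁻¹ : ℝ) : ℂ) * (f k.1 y.1 * f k.2 y.2) := by
    intro y
    simp only [heatKernel, if_pos hτ, f, phase]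
    rw [Complex.ofReal_mul, mul_assoc, Complex.ofReal_exp, ← Complex.exp_add, ← Complex.exp_add,
      ← Complex.exp_add, ← Complex.exp_add]
    congr 2
    simp only [Prod.fst_neg, Prod.snd_neg]
    push_cast
    field_simp
    ring
  simp only [hpt]
  rw [integral_const_mul, Measure.volume_eq_prod, integral_prod_mul (f k.1) (f k.2), hf, hf]
  have hz : (Real.pi / (((4 * τ)⁻¹ : ℝ) : ℂ)) ≠ 0 := by
    push_cast
    exact div_ne_zero hπ (inv_ne_zero (mul_ne_zero (by norm_num) hτ'))
  have hsq : (Real.pi / (((4 * τ)⁻¹ : ℝ) : ℂ)) ^ (1 / 2 : ℂ) *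
      (Real.pi / (((4 * τ)⁻¹ : ℝ) : ℂ)) ^ (1 / 2 : ℂ) = 4 * Real.pi * τ := by
    rw [← Complex.cpow_add _ _ hz, show (1 / 2 + 1 / 2 : ℂ) = 1 by norm_num, Complex.cpow_one]
    push_cast
    field_simp
  calc _ = (((4 * Real.pi * τ)⁻¹ : ℝ) : ℂ) * ((Real.pi / (((4 * τ)⁻¹ : ℝ) : ℂ)) ^ (1 / 2 : ℂ) *
      (Real.pi / (((4 * τ)⁻¹ : ℝ) : ℂ)) ^ (1 / 2 : ℂ)) *
      (Complex.exp (-(((2 * Real.pi * k.1 : ℝ) : ℂ)) ^ 2 / (4 * (((4 * τ)⁻¹ : ℝ) : ℂ))) *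
      Complex.exp (-(((2 * Real.pi * k.2 : ℝ) : ℂ)) ^ 2 / (4 * (((4 * τ)⁻¹ : ℝ) : ℂ)))) := by ring
    _ = _ := by
      rw [hsq, ← Complex.exp_add, Complex.ofReal_exp]
      have : (((4 * Real.pi * τ)⁻¹ : ℝ) : ℂ) * (4 * Real.pi * τ) = 1 := by
        push_cast
        field_simp
      rw [this, one_mul]
      congr 1
      push_cast
      field_simp
      ring

theorem integrable_heatKernel {τ : ℝ} (hτ : 0 < τ) :
    Integrable fun y : ℝ × ℝ => heatKernel (τ, y) := by
  have h := integral_heatKernel_mul_phase hτ 0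
  have h' : Integrable fun y : ℝ × ℝ => (heatKernel (τ, y) : ℂ) * phase 0 (-y) := by
    refine Integrable.of_integral_ne_zero ?_
    rw [h]
    exact_mod_cast (Real.exp_pos _).ne'
  refine h'.norm.congr (Eventually.of_forall fun y => ?_)
  simp only
  rw [norm_mul, norm_phase, mul_one, Complex.norm_real, Real.norm_of_nonneg (heatKernel_nonneg _)]

section Kernel

variable {M : ℝ} {φ : ℝ × ℝ → ℝ} {χ : ℝ → ℝ}

/-- The Fourier coefficients `1_{τ>0} χ(τ) e^{-τ ω_k²}` of the truncated kernel. -/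
def heatProfile (M : ℝ) (χ : ℝ → ℝ) (k : ℤ × ℤ) (τ : ℝ) : ℂ :=
  if 0 < τ then ((χ τ * Real.exp (-(τ * freq M k ^ 2)) : ℝ) : ℂ) else 0

/-- The periodised heat kernel, cut off by a partition of unity. -/
def periodicHeat (φ : ℝ × ℝ → ℝ) (τ : ℝ) (y : ℝ × ℝ) : ℝ :=
  ∑' l : ℤ × ℤ, φ y * heatKernel (τ, y.1 + l.1, y.2 + l.2)

theorem fermionKernel_eq (τ : ℝ) (y : ℝ × ℝ) :
    fermionKernel M φ χ (τ, y) = Real.exp (-(τ * M ^ 2)) * χ τ * periodicHeat φ τ y := by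
  rw [fermionKernel, truncatedKernel, periodicHeat, mul_assoc, ← tsum_mul_left (a := χ τ)]
  simp only [mul_assoc]

theorem periodicHeat_of_nonpos {τ : ℝ} (hτ : ¬0 < τ) (y : ℝ × ℝ) : periodicHeat φ τ y = 0 := by
  simp [periodicHeat, heatKernel, hτ]

theorem periodicHeat_nonneg (hcut : IsCutoff φ χ) (τ : ℝ) (y : ℝ × ℝ) : 0 ≤ periodicHeat φ τ y :=
  tsum_nonneg fun _ => mul_nonneg (hcut.mem_space _).1 (heatKernel_nonneg _)

theorem integral_periodicHeat (hcut : IsCutoff φ χ) {τ : ℝ} (hτ : 0 < τ) (k : ℤ × ℤ) :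
    ∫ y, (periodicHeat φ τ y : ℂ) * phase k (-y) =
      Real.exp (-(τ * (4 * Real.pi ^ 2 * ((k.1 : ℝ) ^ 2 + (k.2 : ℝ) ^ 2)))) := by
  rw [← integral_heatKernel_mul_phase hτ]
  exact integral_periodisation hcut.smooth_space.continuous hcut.mem_space hcut.sum_space
    (integrable_heatKernel hτ) k

theorem integrable_periodicHeat (hcut : IsCutoff φ χ) {τ : ℝ} (hτ : 0 < τ) :
    Integrable (periodicHeat φ τ) := by
  have h := integral_periodicHeat hcut hτ 0
  have h' : Integrable fun y : ℝ × ℝ => (periodicHeat φ τ y : ℂ) * phase 0 (-y) := by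
    refine Integrable.of_integral_ne_zero ?_
    rw [h]
    exact_mod_cast (Real.exp_pos _).ne'
  refine h'.norm.congr (Eventually.of_forall fun y => ?_)
  simp only
  rw [norm_mul, norm_phase, mul_one, Complex.norm_real,
    Real.norm_of_nonneg (periodicHeat_nonneg hcut _ _)]

theorem integral_periodicHeat_eq_one (hcut : IsCutoff φ χ) {τ : ℝ} (hτ : 0 < τ) :
    ∫ y, periodicHeat φ τ y = 1 := by
  have h := integral_periodicHeat hcut hτ 0
  have h0 : ∀ x, phase 0 x = 1 := fun x => by simp [phase]
  simp only [h0, mul_one] at h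
  rw [integral_complex_ofReal] at h
  simpa using h

theorem integral_fermionKernel_mul_phase (hcut : IsCutoff φ χ) (τ : ℝ) (k : ℤ × ℤ) :
    ∫ y, (fermionKernel M φ χ (τ, y) : ℂ) * phase k (-y) = heatProfile M χ k τ := by
  by_cases hτ : 0 < τ
  · simp only [fermionKernel_eq, Complex.ofReal_mul, mul_assoc]
    rw [integral_const_mul, integral_const_mul, integral_periodicHeat hcut hτ, heatProfile,
      if_pos hτ, freq_sq, symbolSq, ← mul_assoc, mul_comm (Complex.ofReal _) (χ τ : ℂ), mul_assoc,
      ← Complex.ofReal_mul, ← Real.exp_add, ← Complex.ofReal_mul]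
    congr 3
    ring
  · simp [fermionKernel_eq, periodicHeat_of_nonpos hτ, heatProfile, hτ]

theorem integrable_fermionKernel (hcut : IsCutoff φ χ) (τ : ℝ) :
    Integrable fun y => fermionKernel M φ χ (τ, y) := by
  simp only [fermionKernel_eq]
  by_cases hτ : 0 < τ
  · exact (integrable_periodicHeat hcut hτ).const_mul _
  · simp [periodicHeat_of_nonpos hτ]

theorem integral_norm_fermionKernel_le (hcut : IsCutoff φ χ) (τ : ℝ) :
    ∫ y, ‖fermionKernel M φ χ (τ, y)‖ ≤ 1 := by
  simp only [fermionKernel_eq, norm_mul]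
  rw [integral_const_mul]
  by_cases hτ : 0 < τ
  · have h1 : ∫ y, ‖periodicHeat φ τ y‖ = 1 := by
      rw [← integral_periodicHeat_eq_one hcut hτ]
      simp only [Real.norm_of_nonneg (periodicHeat_nonneg hcut _ _)]
    rw [h1, mul_one, Real.norm_of_nonneg (Real.exp_pos _).le,
      Real.norm_of_nonneg (hcut.mem_time _).1]
    exact mul_le_one₀
      (Real.exp_le_one_iff.2 (by nlinarith [sq_nonneg M, mul_nonneg hτ.le (sq_nonneg M)]))
      (hcut.mem_time _).1 (hcut.mem_time _).2
  · simp [periodicHeat_of_nonpos hτ]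

theorem isProfile_transposedKernel (hcut : IsCutoff φ χ) :
    IsProfile (transposedKernel M φ χ) (heatProfile M χ) := by
  intro z t k
  have h1 : ∀ x : ℝ × ℝ, (transposedKernel M φ χ ((t, x) - z) : ℂ) * phase k x =
      (fun y : ℝ × ℝ => phase k z.2 * ((fermionKernel M φ χ (z.1 - t, y) : ℂ) * phase k (-y)))
        (z.2 - x) := by
    intro x
    have e : -((t, x) - z) = (z.1 - t, z.2 - x) := by
      rw [neg_sub]; rfl
    have e' : phase k x = phase k z.2 * phase k (-(z.2 - x)) := by
      rw [← phase_add]; congr 1; abel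
    simp only [transposedKernel, e]
    rw [e']
    ring
  calc modeCoeff (transposedKernel M φ χ) z t k
      = ∫ x : ℝ × ℝ, (transposedKernel M φ χ ((t, x) - z) : ℂ) * phase k x := rfl
    _ = _ := by
      simp only [h1]
      rw [integral_sub_left_eq_self (fun y : ℝ × ℝ => phase k z.2 *
        ((fermionKernel M φ χ (z.1 - t, y) : ℂ) * phase k (-y))) volume z.2, integral_const_mul,
        integral_fermionKernel_mul_phase hcut]

theorem measurable_transposedKernel (hcut : IsCutoff φ χ) :
    Measurable (transposedKernel M φ χ) := by
  have hφ := hcut.smooth_space.continuous.measurable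
  have hχ := hcut.smooth_time.continuous.measurable
  have hheat : Measurable heatKernel := by
    unfold heatKernel
    refine Measurable.ite (measurableSet_lt measurable_const measurable_fst) ?_ measurable_const
    fun_prop
  have h1 : Measurable (fermionKernel M φ χ) := by
    unfold fermionKernel
    refine Measurable.mul (by fun_prop) ?_
    unfold truncatedKernel
    refine Measurable.tsum fun k => ?_
    refine Measurable.mul (by fun_prop) ?_
    exact hheat.comp (by fun_prop)
  exact h1.comp measurable_neg

end Kernel

/-! ### Bounds for the heat profile -/

section HeatProfile

variable {M : ℝ} {φ : ℝ × ℝ → ℝ} {χ : ℝ → ℝ}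

/-- Profiles that share the size of the heat profile: they are bounded, uniformly in the frequency,
and their `L¹` norms are of order `ω_k⁻²`. -/
structure IsHeatLike (M S : ℝ) (a : ℤ × ℤ → ℝ → ℂ) : Prop where
  meas : ∀ k, Measurable (a k)
  norm_le : ∀ k τ, ‖a k τ‖ ≤ S
  lintegral_le : ∀ k, ∫⁻ τ, ‖a k τ‖ₑ ≤ ENNReal.ofReal (S * (freq M k ^ 2)⁻¹)

theorem lintegral_exp_neg_mul {c : ℝ} (hc : 0 < c) :
    ∫⁻ τ in Set.Ioi (0 : ℝ), ENNReal.ofReal (Real.exp (-(τ * c))) = ENNReal.ofReal c⁻¹ := by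
  have h : ∀ τ : ℝ, -(τ * c) = -c * τ := fun τ => by ring
  simp only [h]
  rw [← ofReal_integral_eq_lintegral_ofReal (integrableOn_exp_mul_Ioi (by linarith) 0)
    (Eventually.of_forall fun _ => (Real.exp_pos _).le), integral_exp_mul_Ioi (by linarith)]
  congr 1
  simp [neg_div_neg_eq]

theorem norm_heatProfile_le_one (hcut : IsCutoff φ χ) (k : ℤ × ℤ) (τ : ℝ) :
    ‖heatProfile M χ k τ‖ ≤ 1 := by
  unfold heatProfile
  split_ifs with h
  · rw [Complex.norm_real, norm_mul, Real.norm_of_nonneg (hcut.mem_time _).1,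
      Real.norm_of_nonneg (Real.exp_pos _).le]
    exact mul_le_one₀ (hcut.mem_time _).2 (Real.exp_pos _).le
      (Real.exp_le_one_iff.2 (by have := mul_nonneg h.le (sq_nonneg (freq M k)); linarith))
  · simp

theorem isHeatLike_heatProfile (hM : 0 < M) (hcut : IsCutoff φ χ) :
    IsHeatLike M 1 (heatProfile M χ) where
  meas k := by
    have hχ := hcut.smooth_time.continuous.measurable
    unfold heatProfile
    refine Measurable.ite measurableSet_Ioi ?_ measurable_const
    exact Complex.measurable_ofReal.comp (by fun_prop)
  norm_le := norm_heatProfile_le_one hcut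
  lintegral_le k := by
    have hk := freq_pos hM k
    rw [one_mul, ← lintegral_exp_neg_mul (by positivity), ← lintegral_indicator measurableSet_Ioi]
    refine lintegral_mono fun τ => ?_
    unfold heatProfile
    by_cases h : 0 < τ
    · rw [if_pos h, Set.indicator_of_mem (by exact h), ← ofReal_norm]
      refine ENNReal.ofReal_le_ofReal ?_
      rw [Complex.norm_real, norm_mul, Real.norm_of_nonneg (hcut.mem_time _).1,
        Real.norm_of_nonneg (Real.exp_pos _).le]
      exact mul_le_of_le_one_left (Real.exp_pos _).le (hcut.mem_time _).2
    · simp [h]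

/-- The derivative of the temporal cutoff vanishes outside `[1, 2]`. -/
theorem exists_norm_deriv_cutoff_le (hcut : IsCutoff φ χ) :
    ∃ L : ℝ, 0 ≤ L ∧ ∀ t, ‖deriv χ t‖ ≤ L := by
  have hc : Continuous (deriv χ) := hcut.smooth_time.continuous_deriv (by simp)
  obtain ⟨L, hL⟩ := (isCompact_Icc (a := (1 : ℝ)) (b := 2)).exists_bound_of_continuousOn
    hc.continuousOn
  refine ⟨max L 0, le_max_right _ _, fun t => ?_⟩
  by_cases h1 : t < 1
  · have : χ =ᶠ[𝓝 t] fun _ => 1 := by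
      filter_upwards [gt_mem_nhds h1] with s hs using hcut.one_time s hs.le
    rw [this.deriv_eq]; simp
  by_cases h2 : 2 < t
  · have : χ =ᶠ[𝓝 t] fun _ => 0 := by
      filter_upwards [lt_mem_nhds h2] with s hs using hcut.zero_time s hs.le
    rw [this.deriv_eq]; simp
  · exact (hL t ⟨not_lt.1 h1, not_lt.1 h2⟩).trans (le_max_left _ _)

/-- A translate of the heat profile differs from it in `L¹` by at most a multiple of the shift: the
heat profile has bounded variation, uniformly in the frequency. -/
theorem exists_lintegral_heatProfile_shift_le (hM : 0 < M) (hcut : IsCutoff φ χ) :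
    ∃ C : ℝ, 0 < C ∧ ∀ k s,
      ∫⁻ τ, ‖heatProfile M χ k (τ + s) - heatProfile M χ k τ‖ₑ ≤ ENNReal.ofReal (C * |s|) := by
  obtain ⟨L, hL0, hL⟩ := exists_norm_deriv_cutoff_le hcut
  have hmeas := (isHeatLike_heatProfile hM hcut).meas
  have key : ∀ k s, 0 ≤ s → ∫⁻ τ, ‖heatProfile M χ k (τ + s) - heatProfile M χ k τ‖ₑ ≤
      ENNReal.ofReal ((2 + L / M ^ 2) * s) := by
    intro k s hs
    set c : ℝ := freq M k ^ 2 with hc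
    have hc0 : 0 < c := by have := freq_pos hM k; positivity
    have hMc : M ^ 2 ≤ c := by have := le_freq M k; rw [hc]; gcongr
    let g : ℝ → ℝ := fun τ => χ τ * Real.exp (-(τ * c))
    have hg : ∀ τ, 0 < τ → heatProfile M χ k τ = (g τ : ℂ) := fun τ hτ => by
      rw [heatProfile, if_pos hτ]
    have hderiv : ∀ u, HasDerivAt g (deriv χ u * Real.exp (-(u * c)) +
        χ u * (Real.exp (-(u * c)) * -(1 * c))) u := fun u =>
      ((hcut.smooth_time.differentiable (by simp)) u).hasDerivAt.mul
        (((hasDerivAt_id u).mul_const c).neg.exp)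
    have hdiff : ∀ τ, 0 < τ → |g (τ + s) - g τ| ≤ (L + c) * Real.exp (-(τ * c)) * s := by
      intro τ hτ
      have := (convex_Ici τ).norm_image_sub_le_of_norm_hasDerivWithin_le (f := g)
        (C := (L + c) * Real.exp (-(τ * c))) (fun u _ => (hderiv u).hasDerivWithinAt)
        (fun u hu => by
          have he : Real.exp (-(u * c)) ≤ Real.exp (-(τ * c)) := by
            refine Real.exp_le_exp.2 (neg_le_neg ?_)
            exact mul_le_mul_of_nonneg_right hu hc0.le
          refine (norm_add_le _ _).trans ?_
          rw [add_mul, norm_mul, norm_mul, norm_mul, Real.norm_of_nonneg (Real.exp_pos _).le,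
            Real.norm_of_nonneg (hcut.mem_time u).1, one_mul, norm_neg, Real.norm_of_nonneg hc0.le]
          have h1 := hL u
          have h2 := (hcut.mem_time u).2
          have h3 := (hcut.mem_time u).1
          refine add_le_add (mul_le_mul h1 he (Real.exp_pos _).le hL0) ?_
          calc χ u * (Real.exp (-(u * c)) * c) ≤ 1 * (Real.exp (-(τ * c)) * c) := by gcongr
            _ = c * Real.exp (-(τ * c)) := by ring)
        (Set.self_mem_Ici) (show τ + s ∈ Set.Ici τ from by simpa using hs)
      simpa [Real.norm_eq_abs, abs_of_nonneg hs] using this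
    -- for `τ > 0` the mean value theorem applies; for `-s < τ ≤ 0` the jump at `0` is crossed
    have hpt : ∀ τ, ‖heatProfile M χ k (τ + s) - heatProfile M χ k τ‖ₑ ≤
        (Set.Ioc (-s) 0).indicator (fun _ => 1) τ +
        ENNReal.ofReal ((L + c) * s) *
          (Set.Ioi 0).indicator (fun τ => ENNReal.ofReal (Real.exp (-(τ * c)))) τ := by
      intro τ
      rcases lt_or_ge 0 τ with h | h
      · rw [Set.indicator_of_notMem (by simp [h]), zero_add, Set.indicator_of_mem (by exact h),
          hg τ h, hg (τ + s) (by linarith), ← Complex.ofReal_sub, ← ofReal_norm,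
          Complex.norm_real, Real.norm_eq_abs, ← ENNReal.ofReal_mul (by positivity)]
        refine ENNReal.ofReal_le_ofReal ((hdiff τ h).trans_eq (by ring))
      · have h0 : heatProfile M χ k τ = 0 := by rw [heatProfile, if_neg (not_lt.2 h)]
        rw [h0, sub_zero]
        rcases lt_or_ge (-s) τ with h' | h'
        · rw [Set.indicator_of_mem (by exact ⟨h', h⟩)]
          refine le_trans ?_ le_self_add
          rw [← ofReal_norm, ← ENNReal.ofReal_one]
          exact ENNReal.ofReal_le_ofReal (norm_heatProfile_le_one hcut _ _)
        · rw [heatProfile, if_neg (by linarith)]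
          simp
    calc _ ≤ _ := lintegral_mono hpt
      _ = ENNReal.ofReal s + ENNReal.ofReal ((L + c) * s) * ENNReal.ofReal c⁻¹ := by
        rw [lintegral_add_left (measurable_const.indicator measurableSet_Ioc),
          lintegral_const_mul _ (Measurable.indicator (by fun_prop) measurableSet_Ioi),
          lintegral_indicator measurableSet_Ioi, lintegral_exp_neg_mul hc0,
          lintegral_indicator measurableSet_Ioc]
        simp
      _ ≤ _ := by
        rw [← ENNReal.ofReal_mul (by positivity), ← ENNReal.ofReal_add hs (by positivity)]
        refine ENNReal.ofReal_le_ofReal ?_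
        have : L / c ≤ L / M ^ 2 := by gcongr
        calc s + (L + c) * s * c⁻¹ = (2 + L / c) * s := by field_simp; ring
          _ ≤ _ := by gcongr
  refine ⟨2 + L / M ^ 2, by positivity, fun k s => ?_⟩
  rcases le_total 0 s with hs | hs
  · rw [abs_of_nonneg hs]; exact key k s hs
  · rw [abs_of_nonpos hs]
    refine le_trans (le_of_eq ?_) (key k (-s) (by linarith))
    rw [← lintegral_add_right_eq_self _ (-s)]
    refine lintegral_congr fun τ => ?_
    rw [neg_add_cancel_right, enorm_sub_rev]

end HeatProfile

/-! ### Mollification -/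

section Rescale

variable {ρ : Spacetime → ℝ}

theorem continuous_rescale (hρ : IsMollifier ρ) (ε : ℝ) : Continuous (rescale ρ ε) :=
  continuous_const.mul (hρ.smooth.continuous.comp (by fun_prop))

theorem contDiff_rescale (hρ : IsMollifier ρ) (ε : ℝ) : ContDiff ℝ ∞ (rescale ρ ε) :=
  contDiff_const.mul (hρ.smooth.comp (by fun_prop))

/-- The support of `ρ_ε` has size `ε²` in time and `ε` in space. -/
theorem exists_rescale_support (hρ : IsMollifier ρ) : ∃ R : ℝ, 0 < R ∧ ∀ ε, 0 < ε → ∀ w,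
    rescale ρ ε w ≠ 0 → |w.1| ≤ R * ε ^ 2 ∧ |w.2.1| ≤ R * ε ∧ |w.2.2| ≤ R * ε := by
  obtain ⟨R, hR⟩ := hρ.compact.isCompact.isBounded.exists_norm_le
  refine ⟨max R 1, by positivity, fun ε hε w hw => ?_⟩
  have hmem := hR _ (subset_tsupport _ (right_ne_zero_of_mul hw))
  have hmem' := hmem.trans (le_max_left R 1)
  rw [Prod.norm_def, Prod.norm_def, max_le_iff, max_le_iff] at hmem'
  obtain ⟨h1, h2, h3⟩ := hmem'
  simp only [Real.norm_eq_abs, abs_mul, abs_inv, abs_of_pos hε,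
    abs_of_pos (pow_pos hε 2)] at h1 h2 h3
  rw [inv_mul_le_iff₀ (by positivity), mul_comm] at h1 h2 h3
  exact ⟨h1, h2, h3⟩

theorem hasCompactSupport_rescale (hρ : IsMollifier ρ) {ε : ℝ} (hε : 0 < ε) :
    HasCompactSupport (rescale ρ ε) := by
  obtain ⟨R, hR0, hR⟩ := exists_rescale_support hρ
  refine HasCompactSupport.intro (K := Metric.closedBall 0 (max (R * ε ^ 2) (R * ε)))
    (isCompact_closedBall _ _) fun w hw => ?_
  by_contra h
  obtain ⟨h1, h2, h3⟩ := hR ε hε w h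
  refine hw ?_
  rw [mem_closedBall_zero_iff, Prod.norm_def, Prod.norm_def]
  exact max_le (h1.trans (le_max_left _ _)) (max_le (h2.trans (le_max_right _ _))
    (h3.trans (le_max_right _ _)))

theorem integrable_rescale (hρ : IsMollifier ρ) {ε : ℝ} (hε : 0 < ε) :
    Integrable (rescale ρ ε) :=
  (continuous_rescale hρ ε).integrable_of_hasCompactSupport (hasCompactSupport_rescale hρ hε)

theorem map_parabolic_scale {a b : ℝ} (ha : 0 < a) (hb : 0 < b) :
    (volume : Measure Spacetime).map (fun w => (a * w.1, b * w.2.1, b * w.2.2)) =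
      ENNReal.ofReal (a * b ^ 2)⁻¹ • (volume : Measure Spacetime) := by
  have h1 : ∀ c : ℝ, 0 < c → (volume : Measure ℝ).map (fun x => c * x) =
      ENNReal.ofReal c⁻¹ • (volume : Measure ℝ) := fun c hc => by
    have := Real.map_volume_mul_left hc.ne'
    rwa [abs_of_pos (inv_pos.2 hc)] at this
  have e : (fun w : Spacetime => (a * w.1, b * w.2.1, b * w.2.2)) =
      Prod.map (fun x => a * x) (Prod.map (fun x => b * x) (fun x => b * x)) := rfl
  rw [e, Measure.volume_eq_prod, Measure.volume_eq_prod,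
    ← Measure.map_prod_map _ _ (by fun_prop) (by fun_prop),
    ← Measure.map_prod_map _ _ (by fun_prop) (by fun_prop), h1 a ha, h1 b hb]
  simp only [Measure.prod_smul_left, Measure.prod_smul_right, smul_smul]
  rw [← ENNReal.ofReal_mul (by positivity), ← ENNReal.ofReal_mul (by positivity)]
  congr 2
  field_simp

theorem integral_comp_parabolic_scale {f : Spacetime → ℝ} (hf : Continuous f) {ε : ℝ} (hε : 0 < ε) :
    ∫ w : Spacetime, (ε ^ 4)⁻¹ * f ((ε ^ 2)⁻¹ * w.1, ε⁻¹ * w.2.1, ε⁻¹ * w.2.2) = ∫ w, f w := by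
  have h : ∫ w, f w ∂((volume : Measure Spacetime).map
      (fun w => ((ε ^ 2)⁻¹ * w.1, ε⁻¹ * w.2.1, ε⁻¹ * w.2.2))) =
      ∫ w : Spacetime, f ((ε ^ 2)⁻¹ * w.1, ε⁻¹ * w.2.1, ε⁻¹ * w.2.2) :=
    integral_map (by fun_prop) hf.aestronglyMeasurable
  rw [integral_const_mul, ← h, map_parabolic_scale (by positivity) (by positivity),
    integral_smul_measure, ENNReal.toReal_ofReal (by positivity), smul_eq_mul]
  field_simp

theorem integral_rescale (hρ : IsMollifier ρ) {ε : ℝ} (hε : 0 < ε) : ∫ w, rescale ρ ε w = 1 := by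
  rw [← hρ.integral_eq_one]
  exact integral_comp_parabolic_scale hρ.smooth.continuous hε

/-- The `L¹` norm of a mollifier, which its rescalings share. -/
def mollifierMass (ρ : Spacetime → ℝ) : ℝ := ∫ w, |ρ w|

theorem lintegral_enorm_rescale (hρ : IsMollifier ρ) {ε : ℝ} (hε : 0 < ε) :
    ∫⁻ w, ‖rescale ρ ε w‖ₑ = ENNReal.ofReal (mollifierMass ρ) := by
  rw [← ofReal_integral_norm_eq_lintegral_enorm (integrable_rescale hρ hε), mollifierMass,
    ← integral_comp_parabolic_scale (f := fun w => |ρ w|) hρ.smooth.continuous.abs hε]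
  congr 1
  refine integral_congr_ae (Eventually.of_forall fun w => ?_)
  simp only [rescale, Real.norm_eq_abs, abs_mul, abs_inv]
  rw [abs_of_pos (pow_pos hε 4)]

theorem one_le_mollifierMass (hρ : IsMollifier ρ) : 1 ≤ mollifierMass ρ := by
  rw [← hρ.integral_eq_one]
  refine integral_mono ?_ ?_ fun w => le_abs_self _
  · exact hρ.smooth.continuous.integrable_of_hasCompactSupport hρ.compact
  · exact (hρ.smooth.continuous.integrable_of_hasCompactSupport hρ.compact).abs

end Rescale

section MollifiedProfile

variable {M : ℝ} {φ : ℝ × ℝ → ℝ} {χ : ℝ → ℝ} {ρ : Spacetime → ℝ}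

/-- The Fourier coefficients of the mollification of a kernel with Fourier coefficients `H`. -/
def mollifiedProfile (r : Spacetime → ℝ) (H : ℤ × ℤ → ℝ → ℂ) (k : ℤ × ℤ) (τ : ℝ) : ℂ :=
  ∫ w : Spacetime, (r w : ℂ) * (phase k w.2 * H k (τ + w.1))

theorem measurable_mollifiedProfile {r : Spacetime → ℝ} (hr : Measurable r) {H : ℤ × ℤ → ℝ → ℂ}
    (hH : ∀ k, Measurable (H k)) (k : ℤ × ℤ) : Measurable (mollifiedProfile r H k) := by
  have : StronglyMeasurable fun p : ℝ × Spacetime =>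
      (r p.2 : ℂ) * (phase k p.2.2 * H k (p.1 + p.2.1)) := by
    refine Measurable.stronglyMeasurable ?_
    have h1 := (continuous_phase k).measurable
    have h2 := hH k
    fun_prop
  exact (this.integral_prod_right' (ν := (volume : Measure Spacetime))).measurable

theorem integrable_transposedKernel (hcut : IsCutoff φ χ) (s : ℝ) :
    Integrable fun x : ℝ × ℝ => transposedKernel M φ χ (s, x) :=
  (integrable_fermionKernel (M := M) hcut (-s)).comp_neg

theorem integral_norm_transposedKernel_le (hcut : IsCutoff φ χ) (s : ℝ) :
    ∫ x : ℝ × ℝ, ‖transposedKernel M φ χ (s, x)‖ ≤ 1 := by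
  refine le_trans (le_of_eq ?_) (integral_norm_fermionKernel_le (M := M) hcut (-s))
  exact integral_neg_eq_self (fun x => ‖fermionKernel M φ χ (-s, x)‖) volume

theorem isProfile_mollify (hcut : IsCutoff φ χ) (hρ : IsMollifier ρ) {ε : ℝ} (hε : 0 < ε) :
    IsProfile (mollify ρ ε (transposedKernel M φ χ))
      (mollifiedProfile (rescale ρ ε) (heatProfile M χ)) := by
  intro z t k
  set G := transposedKernel M φ χ with hG
  set r := rescale ρ ε with hr
  have hGm : Measurable G := measurable_transposedKernel hcut
  have hrm : Measurable r := (continuous_rescale hρ ε).measurable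
  let f : (ℝ × ℝ) → Spacetime → ℂ := fun x w => (r w : ℂ) * ((G ((t, x) - (z + w)) : ℂ) * phase k x)
  have hnorm : ∀ x w, ‖f x w‖ = ‖r w‖ * ‖G (t - (z + w).1, x - (z + w).2)‖ := by
    intro x w
    simp only [f]
    rw [norm_mul, norm_mul, norm_phase, mul_one, Complex.norm_real, Complex.norm_real]
    rfl
  have hfm : AEStronglyMeasurable (Function.uncurry f)
      ((volume : Measure (ℝ × ℝ)).prod (volume : Measure Spacetime)) := by
    refine Measurable.aestronglyMeasurable ?_
    have h1 := (continuous_phase k).measurable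
    have h2 : Measurable fun p : (ℝ × ℝ) × Spacetime => G ((t, p.1) - (z + p.2)) :=
      hGm.comp (by fun_prop)
    have h3 : Measurable fun p : (ℝ × ℝ) × Spacetime => phase k p.1 := h1.comp measurable_fst
    have h4 : Measurable fun p : (ℝ × ℝ) × Spacetime => r p.2 := hrm.comp measurable_snd
    exact (Complex.measurable_ofReal.comp h4).mul ((Complex.measurable_ofReal.comp h2).mul h3)
  have hslice : ∀ w, ∫ x, ‖f x w‖ ≤ ‖r w‖ := by
    intro w
    simp only [hnorm]
    rw [integral_const_mul,
      integral_sub_right_eq_self (fun x : ℝ × ℝ => ‖G (t - (z + w).1, x)‖) (z + w).2]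
    exact mul_le_of_le_one_right (norm_nonneg _) (integral_norm_transposedKernel_le hcut _)
  have hfi : Integrable (Function.uncurry f)
      ((volume : Measure (ℝ × ℝ)).prod (volume : Measure Spacetime)) := by
    rw [integrable_prod_iff' hfm]
    refine ⟨Eventually.of_forall fun w => ?_, ?_⟩
    · have h1 : Integrable fun x : ℝ × ℝ => G ((t, x) - (z + w)) :=
        (integrable_transposedKernel hcut (t - (z + w).1)).comp_sub_right (z + w).2
      have h2 : Integrable fun x : ℝ × ℝ => (G ((t, x) - (z + w)) : ℂ) * phase k x := by
        refine h1.mono ((h1.ofReal (𝕜 := ℂ)).1.mul (continuous_phase k).aestronglyMeasurable)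
          (Eventually.of_forall fun x => ?_)
        rw [norm_mul, norm_phase, mul_one, Complex.norm_real]
      exact h2.const_mul (r w : ℂ)
    · refine (integrable_rescale hρ hε).norm.mono' hfm.norm.prod_swap.integral_prod_right' ?_
      refine Eventually.of_forall fun w => ?_
      rw [Real.norm_of_nonneg (integral_nonneg fun _ => norm_nonneg _)]
      exact hslice w
  calc modeCoeff (mollify ρ ε G) z t k = ∫ x, ∫ w, f x w := by
        refine integral_congr_ae (Eventually.of_forall fun x => ?_)
        simp only [f, mollify]
        rw [← integral_complex_ofReal, ← integral_mul_const]
        refine integral_congr_ae (Eventually.of_forall fun w => ?_)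
        simp only [Complex.ofReal_mul, phase, sub_sub, mul_assoc, hr]
    _ = ∫ w, ∫ x, f x w := integral_integral_swap hfi
    _ = ∫ w : Spacetime, phase k z.2 *
          ((r w : ℂ) * (phase k w.2 * heatProfile M χ k (z.1 - t + w.1))) := by
        refine integral_congr_ae (Eventually.of_forall fun w => ?_)
        simp only [f]
        rw [integral_const_mul]
        have := isProfile_transposedKernel (M := M) hcut (z + w) t k
        rw [← hG] at this
        rw [show ∫ x : ℝ × ℝ, (G ((t, x) - (z + w)) : ℂ) * phase k x = _ from this, Prod.snd_add,
          phase_add, Prod.fst_add, show z.1 + w.1 - t = z.1 - t + w.1 by ring]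
        ring
    _ = _ := by rw [integral_const_mul]; rfl

/-- Minkowski's inequality for the mollification of profiles. -/
theorem lintegral_mollified_le {r : Spacetime → ℝ} (hr : Measurable r)
    {D : Spacetime → ℝ → ℂ} (hD : Measurable (Function.uncurry D)) {B : ℝ≥0∞}
    (hB : ∀ w, r w ≠ 0 → ∫⁻ τ, ‖D w τ‖ₑ ≤ B) :
    ∫⁻ τ, ‖∫ w, (r w : ℂ) * D w τ‖ₑ ≤ (∫⁻ w, ‖r w‖ₑ) * B := by
  have hm : Measurable fun p : ℝ × Spacetime => ‖r p.2‖ₑ * ‖D p.2 p.1‖ₑ := by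
    have h1 : Measurable fun p : ℝ × Spacetime => D p.2 p.1 := hD.comp measurable_swap
    exact (hr.comp measurable_snd).enorm.mul h1.enorm
  have he : ∀ w τ, ‖(r w : ℂ) * D w τ‖ₑ = ‖r w‖ₑ * ‖D w τ‖ₑ := fun w τ => by
    rw [enorm_mul, ← ofReal_norm (r w : ℂ), Complex.norm_real, ofReal_norm]
  calc ∫⁻ τ, ‖∫ w, (r w : ℂ) * D w τ‖ₑ ≤ ∫⁻ τ, ∫⁻ w, ‖r w‖ₑ * ‖D w τ‖ₑ := by
        refine lintegral_mono fun τ => (enorm_integral_le_lintegral_enorm _).trans_eq ?_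
        simp only [he]
    _ = ∫⁻ w, ∫⁻ τ, ‖r w‖ₑ * ‖D w τ‖ₑ := lintegral_lintegral_swap hm.aemeasurable
    _ ≤ ∫⁻ w, ‖r w‖ₑ * B := by
        refine lintegral_mono fun w => ?_
        have h2 : Measurable (D w) := hD.comp measurable_prodMk_left
        simp only
        rw [lintegral_const_mul _ h2.enorm]
        by_cases h : r w = 0
        · simp [h]
        · gcongr
          exact hB w h
    _ = _ := lintegral_mul_const _ hr.enorm

theorem measurable_phase_mul_shift {H : ℤ × ℤ → ℝ → ℂ} (hH : ∀ k, Measurable (H k)) (k : ℤ × ℤ) :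
    Measurable (Function.uncurry fun (w : Spacetime) (τ : ℝ) => phase k w.2 * H k (τ + w.1)) := by
  have h1 := (continuous_phase k).measurable
  have h2 := hH k
  simp only [Function.uncurry_def]
  fun_prop

theorem IsHeatLike.mollified {S : ℝ} {H : ℤ × ℤ → ℝ → ℂ} (hH : IsHeatLike M S H)
    (hρ : IsMollifier ρ) {ε : ℝ} (hε : 0 < ε) :
    IsHeatLike M (mollifierMass ρ * S) (mollifiedProfile (rescale ρ ε) H) where
  meas := measurable_mollifiedProfile (continuous_rescale hρ ε).measurable hH.meas
  norm_le k τ := by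
    refine (norm_integral_le_integral_norm _).trans ?_
    have hm : ∫ w, ‖rescale ρ ε w‖ = mollifierMass ρ := by
      rw [integral_norm_eq_lintegral_enorm (integrable_rescale hρ hε).1,
        lintegral_enorm_rescale hρ hε, ENNReal.toReal_ofReal]
      exact zero_le_one.trans (one_le_mollifierMass hρ)
    rw [← hm, ← integral_mul_const]
    refine integral_mono_of_nonneg (Eventually.of_forall fun _ => norm_nonneg _)
      ((integrable_rescale hρ hε).norm.mul_const S) (Eventually.of_forall fun w => ?_)
    simp only
    rw [norm_mul, norm_mul, norm_phase, one_mul, Complex.norm_real]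
    gcongr
    exact hH.norm_le _ _
  lintegral_le k := by
    refine (lintegral_mollified_le (continuous_rescale hρ ε).measurable
      (measurable_phase_mul_shift hH.meas k)
      (B := ENNReal.ofReal (S * (freq M k ^ 2)⁻¹)) fun w _ => ?_).trans_eq ?_
    · simp only [enorm_mul]
      have : ‖phase k w.2‖ₑ = 1 := by
        rw [← ofReal_norm, norm_phase, ENNReal.ofReal_one]
      simp only [this, one_mul]
      rw [lintegral_add_right_eq_self (fun τ => ‖H k τ‖ₑ)]
      exact hH.lintegral_le k
    · rw [lintegral_enorm_rescale hρ hε, ← ENNReal.ofReal_mul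
        (zero_le_one.trans (one_le_mollifierMass hρ)), mul_assoc]

/-- The mollification changes the heat profile in `L¹` by an amount of order `ε² + ε ω_k⁻¹`. -/
theorem exists_lintegral_mollified_sub_le (hM : 0 < M) (hcut : IsCutoff φ χ) (hρ : IsMollifier ρ) :
    ∃ C : ℝ, 0 < C ∧ ∀ ε, 0 < ε → ∀ k,
      ∫⁻ τ, ‖heatProfile M χ k τ - mollifiedProfile (rescale ρ ε) (heatProfile M χ) k τ‖ₑ ≤
        ENNReal.ofReal (C * (ε ^ 2 + ε * (freq M k)⁻¹)) := by
  obtain ⟨C, hC, hshift⟩ := exists_lintegral_heatProfile_shift_le hM hcut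
  obtain ⟨R, hR, hsupp⟩ := exists_rescale_support hρ
  have hh := isHeatLike_heatProfile hM hcut
  have hmass := zero_lt_one.trans_le (one_le_mollifierMass hρ)
  refine ⟨mollifierMass ρ * (C * R + 2 * R), by positivity, fun ε hε k => ?_⟩
  have hk := freq_pos hM k
  set h := heatProfile M χ k with hh'
  set r := rescale ρ ε with hr
  have hrm : Measurable r := (continuous_rescale hρ ε).measurable
  let D : Spacetime → ℝ → ℂ := fun w τ => phase k w.2 * h (τ + w.1) - h τ
  have hD : Measurable (Function.uncurry D) :=
    (measurable_phase_mul_shift hh.meas k).sub ((hh.meas k).comp measurable_snd)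
  have heq : ∀ τ, h τ - mollifiedProfile r (heatProfile M χ) k τ = -∫ w, (r w : ℂ) * D w τ := by
    intro τ
    have h1 : Integrable fun w => (r w : ℂ) * (phase k w.2 * h (τ + w.1)) := by
      refine (integrable_rescale hρ hε).mono ?_ (Eventually.of_forall fun w => ?_)
      · refine (Complex.measurable_ofReal.comp hrm).aestronglyMeasurable.mul ?_
        exact ((measurable_phase_mul_shift hh.meas k).comp
          (measurable_prodMk_right (y := τ))).aestronglyMeasurable
      · rw [norm_mul, norm_mul, norm_phase, one_mul, Complex.norm_real]
        exact mul_le_of_le_one_right (norm_nonneg _) (hh.norm_le _ _)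
    have h2 : Integrable fun w => (r w : ℂ) * h τ :=
      (integrable_rescale hρ hε).ofReal.mul_const _
    simp only [D, mul_sub]
    rw [integral_sub h1 h2, integral_mul_const, integral_complex_ofReal, integral_rescale hρ hε]
    simp only [mollifiedProfile, Complex.ofReal_one, one_mul, neg_sub]
    rfl
  simp only [heq, enorm_neg]
  refine (lintegral_mollified_le hrm hD
    (B := ENNReal.ofReal ((C * R + 2 * R) * (ε ^ 2 + ε * (freq M k)⁻¹))) fun w hw => ?_).trans_eq ?_
  · obtain ⟨h1, h2, h3⟩ := hsupp ε hε w hw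
    calc ∫⁻ τ, ‖D w τ‖ₑ
        ≤ ∫⁻ τ, (‖phase k w.2 - 1‖ₑ * ‖h (τ + w.1)‖ₑ + ‖h (τ + w.1) - h τ‖ₑ) := by
          refine lintegral_mono fun τ => ?_
          have : D w τ = (phase k w.2 - 1) * h (τ + w.1) + (h (τ + w.1) - h τ) := by
            simp only [D]; ring
          rw [this, ← enorm_mul]
          exact enorm_add_le _ _
      _ = ‖phase k w.2 - 1‖ₑ * (∫⁻ τ, ‖h τ‖ₑ) + ∫⁻ τ, ‖h (τ + w.1) - h τ‖ₑ := by
          have hm : Measurable fun τ => ‖h (τ + w.1)‖ₑ :=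
            ((hh.meas k).comp (measurable_add_const w.1)).enorm
          rw [lintegral_add_left (hm.const_mul _), lintegral_const_mul _ hm,
            lintegral_add_right_eq_self (fun τ => ‖h τ‖ₑ)]
      _ ≤ ENNReal.ofReal (freq M k * (|w.2.1| + |w.2.2|)) * ENNReal.ofReal (1 * (freq M k ^ 2)⁻¹) +
          ENNReal.ofReal (C * |w.1|) := by
          gcongr
          · rw [← ofReal_norm]
            exact ENNReal.ofReal_le_ofReal (norm_phase_sub_one_le M k w.2)
          · exact hh.lintegral_le k
          · exact hshift k w.1
      _ ≤ _ := by
          rw [← ENNReal.ofReal_mul (by positivity), ← ENNReal.ofReal_add (by positivity)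
            (by positivity)]
          refine ENNReal.ofReal_le_ofReal ?_
          calc freq M k * (|w.2.1| + |w.2.2|) * (1 * (freq M k ^ 2)⁻¹) + C * |w.1|
              ≤ freq M k * (R * ε + R * ε) * (1 * (freq M k ^ 2)⁻¹) + C * (R * ε ^ 2) := by gcongr
            _ = 2 * R * (ε * (freq M k)⁻¹) + C * R * ε ^ 2 := by field_simp; ring
            _ ≤ _ := by
              have h1 : 0 ≤ C * R * (ε * (freq M k)⁻¹) := by positivity
              have h2 : 0 ≤ 2 * R * ε ^ 2 := by positivity
              linarith
  · rw [lintegral_enorm_rescale hρ hε, ← ENNReal.ofReal_mul hmass.le, mul_assoc]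

end MollifiedProfile

/-! ### Spatial Fourier transforms of test functions -/

section SpatialFT

variable {M : ℝ}

/-- The spatial Fourier transform of a function on space-time. -/
def spatialFT (f : Spacetime → ℂ) (s : ℝ) (k : ℤ × ℤ) : ℂ := ∫ x : ℝ × ℝ, f (s, x) * phase k x

/-- `f` is continuously differentiable and supported in the parabolic box with centre `c` and side
lengths `2T`, `2R`, `2R`; it is bounded by `A`, and its spatial derivatives by `A / λ`. -/
structure IsBump (f : Spacetime → ℂ) (c : Spacetime) (T R A lam : ℝ) : Prop where
  smooth : ContDiff ℝ 1 f
  supp : ∀ w, f w ≠ 0 → |w.1 - c.1| ≤ T ∧ |w.2.1 - c.2.1| ≤ R ∧ |w.2.2 - c.2.2| ≤ R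
  norm_le : ∀ w, ‖f w‖ ≤ A
  fderiv_le : ∀ w (v : ℝ × ℝ), ‖v‖ ≤ 1 → lam * ‖fderiv ℝ f w (0, v)‖ ≤ A

theorem norm_integral_le_of_box {g : ℝ × ℝ → ℂ} {c : ℝ × ℝ} {R A : ℝ} (hR : 0 ≤ R)
    (hA : ∀ x, ‖g x‖ ≤ A) (hs : ∀ x, g x ≠ 0 → |x.1 - c.1| ≤ R ∧ |x.2 - c.2| ≤ R) :
    ‖∫ x, g x‖ ≤ 4 * R ^ 2 * A := by
  let S : Set (ℝ × ℝ) := Set.Icc (c.1 - R) (c.1 + R) ×ˢ Set.Icc (c.2 - R) (c.2 + R)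
  have h1 : ∫ x in S, g x = ∫ x, g x := by
    refine setIntegral_eq_integral_of_forall_compl_eq_zero fun x hx => ?_
    by_contra h
    obtain ⟨ha, hb⟩ := hs x h
    rw [abs_le] at ha hb
    exact hx ⟨⟨by linarith, by linarith⟩, ⟨by linarith, by linarith⟩⟩
  have h2 : (volume : Measure (ℝ × ℝ)) S = ENNReal.ofReal (4 * R ^ 2) := by
    rw [Measure.volume_eq_prod, Measure.prod_prod, Real.volume_Icc, Real.volume_Icc,
      ← ENNReal.ofReal_mul (by linarith)]
    congr 1; ring
  rw [← h1]
  refine (norm_setIntegral_le_of_norm_le_const (C := A)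
    (by rw [h2]; exact ENNReal.ofReal_lt_top) fun x _ => hA x).trans ?_
  rw [Measure.real, h2, ENNReal.toReal_ofReal (by positivity), mul_comm]

theorem hasFDerivAt_phase (k : ℤ × ℤ) (x v : ℝ × ℝ) :
    DifferentiableAt ℝ (phase k) x ∧
    fderiv ℝ (phase k) x v = -(2 * Real.pi * Complex.I * (k.1 * v.1 + k.2 * v.2)) * phase k x := by
  let L : ℝ × ℝ →L[ℝ] ℂ := -((2 * Real.pi * Complex.I : ℂ) •
    ((k.1 : ℂ) • (Complex.ofRealCLM ∘L ContinuousLinearMap.fst ℝ ℝ ℝ) +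
      (k.2 : ℂ) • (Complex.ofRealCLM ∘L ContinuousLinearMap.snd ℝ ℝ ℝ)))
  have hL : ∀ y, phase k y = Complex.exp (L y) := fun y => by
    rw [phase]; congr 1
  have h : HasFDerivAt (phase k) (Complex.exp (L x) • L) x := by
    have : phase k = fun y => Complex.exp (L y) := funext hL
    rw [this]
    exact L.hasFDerivAt.cexp
  refine ⟨h.differentiableAt, ?_⟩
  rw [h.fderiv, hL, mul_comm]
  rfl

variable {f : Spacetime → ℂ} {c : Spacetime} {T R A lam : ℝ}

theorem IsBump.hasCompactSupport (hf : IsBump f c T R A lam) : HasCompactSupport f := by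
  refine HasCompactSupport.intro (K := Set.Icc (c.1 - T) (c.1 + T) ×ˢ
    (Set.Icc (c.2.1 - R) (c.2.1 + R) ×ˢ Set.Icc (c.2.2 - R) (c.2.2 + R)))
    (isCompact_Icc.prod (isCompact_Icc.prod isCompact_Icc)) fun w hw => ?_
  by_contra h
  obtain ⟨h1, h2, h3⟩ := hf.supp w h
  rw [abs_le] at h1 h2 h3
  exact hw ⟨⟨by linarith, by linarith⟩, ⟨by linarith, by linarith⟩, ⟨by linarith, by linarith⟩⟩

theorem hasCompactSupport_slice {f : Spacetime → ℂ} (hf : HasCompactSupport f) (s : ℝ) :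
    HasCompactSupport fun x : ℝ × ℝ => f (s, x) :=
  hf.comp_isClosedEmbedding (Topology.IsClosedEmbedding.of_continuous_injective_isClosedMap
    (by fun_prop) (fun x y h => (Prod.ext_iff.1 h).2) (isClosedMap_prodMk_left s))

theorem IsBump.spatialFT_eq_zero (hf : IsBump f c T R A lam) {s : ℝ} (hs : T < |s - c.1|)
    (k : ℤ × ℤ) : spatialFT f s k = 0 := by
  have : ∀ x, f (s, x) = 0 := fun x => by
    by_contra h
    exact absurd (hf.supp _ h).1 (not_le.2 hs)
  simp [spatialFT, this]

theorem IsBump.norm_spatialFT_le (hf : IsBump f c T R A lam) (hR : 0 ≤ R) (s : ℝ) (k : ℤ × ℤ) :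
    ‖spatialFT f s k‖ ≤ 4 * R ^ 2 * A := by
  refine norm_integral_le_of_box (c := c.2) hR (fun x => ?_) fun x hx => ?_
  · rw [norm_mul, norm_phase, mul_one]; exact hf.norm_le _
  · exact (hf.supp _ (left_ne_zero_of_mul hx)).2

/-- Integration by parts. -/
theorem IsBump.norm_mul_spatialFT_le (hf : IsBump f c T R A lam) (hR : 0 ≤ R)
    (hl : 0 < lam) (s : ℝ) (k : ℤ × ℤ) (v : ℝ × ℝ) (hv : ‖v‖ ≤ 1) :
    2 * Real.pi * |k.1 * v.1 + k.2 * v.2| * ‖spatialFT f s k‖ ≤ 4 * R ^ 2 * (A / lam) := by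
  let g : ℝ × ℝ → ℂ := fun x => f (s, x)
  have hsl : ContDiff ℝ 1 fun x : ℝ × ℝ => ((s, x) : Spacetime) := by fun_prop
  have hg : ContDiff ℝ 1 g := hf.smooth.comp hsl
  have hgc : HasCompactSupport g := hasCompactSupport_slice hf.hasCompactSupport s
  have hgd : ∀ x, fderiv ℝ g x v = fderiv ℝ f (s, x) (0, v) := by
    intro x
    have h1 : HasFDerivAt (fun x : ℝ × ℝ => ((s, x) : Spacetime))
        (ContinuousLinearMap.inr ℝ ℝ (ℝ × ℝ)) x := hasFDerivAt_prodMk_right s x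
    have h2 : HasFDerivAt g _ x :=
      ((hf.smooth.differentiable (by simp)) (s, x)).hasFDerivAt.comp x h1
    rw [h2.fderiv]
    simp
  have hdc : Continuous fun x => fderiv ℝ g x v :=
    (hg.continuous_fderiv (by simp)).clm_apply continuous_const
  have hdcs : HasCompactSupport fun x => fderiv ℝ g x v :=
    (hgc.fderiv ℝ).comp_left (g := fun L : ℝ × ℝ →L[ℝ] ℂ => L v) (by simp)
  have hph := fun x => (hasFDerivAt_phase k x v).2
  have ibp := integral_mul_fderiv_eq_neg_fderiv_mul_of_integrable (μ := (volume : Measure (ℝ × ℝ)))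
    (f := g) (g := phase k) (v := v)
    ((hdc.mul (continuous_phase k)).integrable_of_hasCompactSupport hdcs.mul_right)
    (by
      simp only [hph]
      exact (hg.continuous.mul (continuous_const.mul
        (continuous_phase k))).integrable_of_hasCompactSupport hgc.mul_right)
    ((hg.continuous.mul (continuous_phase k)).integrable_of_hasCompactSupport hgc.mul_right)
    (fun x _ => hg.differentiable (by simp) x) (fun x _ => (hasFDerivAt_phase k x v).1)
  have e : ∫ x, g x * fderiv ℝ (phase k) x v =
      -(2 * Real.pi * Complex.I * (k.1 * v.1 + k.2 * v.2)) * spatialFT f s k := by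
    rw [spatialFT, ← integral_const_mul]
    refine integral_congr_ae (Eventually.of_forall fun x => ?_)
    simp only [hph, g]; ring
  have hn : ‖(-(2 * Real.pi * Complex.I * (k.1 * v.1 + k.2 * v.2)) : ℂ)‖ =
      2 * Real.pi * |k.1 * v.1 + k.2 * v.2| := by
    rw [norm_neg, norm_mul, norm_mul, norm_mul, Complex.norm_I, mul_one]
    have : ((k.1 : ℂ) * v.1 + k.2 * v.2) = ((k.1 * v.1 + k.2 * v.2 : ℝ) : ℂ) := by push_cast; rfl
    rw [this, Complex.norm_real, Complex.norm_real, Real.norm_eq_abs, Real.norm_eq_abs,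
      abs_of_pos Real.pi_pos]
    norm_num
  rw [← hn, ← norm_mul, ← e, ibp, norm_neg]
  refine norm_integral_le_of_box (c := c.2) hR (fun x => ?_) fun x hx => ?_
  · rw [norm_mul, norm_phase, mul_one, hgd, le_div_iff₀ hl, mul_comm]
    exact hf.fderiv_le _ v hv
  · by_contra h
    -- outside of the closed box the function vanishes near `x`
    have hz : g =ᶠ[𝓝 x] fun _ => 0 := by
      have h1 : IsClosed {x : ℝ × ℝ | |x.1 - c.2.1| ≤ R} := isClosed_le (by fun_prop) (by fun_prop)
      have h2 : IsClosed {x : ℝ × ℝ | |x.2 - c.2.2| ≤ R} := isClosed_le (by fun_prop) (by fun_prop)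
      have hcl : IsClosed {x : ℝ × ℝ | |x.1 - c.2.1| ≤ R ∧ |x.2 - c.2.2| ≤ R} := h1.inter h2
      filter_upwards [hcl.isOpen_compl.mem_nhds h] with y hy
      by_contra h'
      exact hy (hf.supp _ h').2
    refine hx ?_
    rw [hz.fderiv_eq]
    simp

/-- One derivative in space suffices: it gives the decay `(λ ω_k)⁻¹` of the Fourier transform. -/
theorem IsBump.norm_spatialFT_le_decay (hM : 0 < M) (hf : IsBump f c T R A lam) (hR : 0 ≤ R)
    (hl : 0 < lam) (s : ℝ) (k : ℤ × ℤ) :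
    ‖spatialFT f s k‖ ≤ 4 * R ^ 2 * A * (2 + lam * M) * decay M lam k := by
  have hA : 0 ≤ A := (norm_nonneg _).trans (hf.norm_le 0)
  have hk := freq_pos hM k
  have h0 := hf.norm_spatialFT_le hR s k
  have h1 := hf.norm_mul_spatialFT_le hR hl s k (1, 0) (by simp [Prod.norm_def])
  have h2 := hf.norm_mul_spatialFT_le hR hl s k (0, 1) (by simp [Prod.norm_def])
  simp only [mul_one, mul_zero, add_zero, zero_add] at h1 h2
  have hn := norm_nonneg (spatialFT f s k)
  have hfr := freq_le hM k
  have hfin : lam * freq M k * ‖spatialFT f s k‖ ≤ 4 * R ^ 2 * A * (2 + lam * M) := by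
    calc lam * freq M k * ‖spatialFT f s k‖
        ≤ lam * (2 * Real.pi * |(k.1 : ℝ)| + 2 * Real.pi * |(k.2 : ℝ)| + M) *
          ‖spatialFT f s k‖ := by gcongr
      _ = lam * (2 * Real.pi * |(k.1 : ℝ)| * ‖spatialFT f s k‖) +
          lam * (2 * Real.pi * |(k.2 : ℝ)| * ‖spatialFT f s k‖) +
          lam * M * ‖spatialFT f s k‖ := by ring
      _ ≤ lam * (4 * R ^ 2 * (A / lam)) + lam * (4 * R ^ 2 * (A / lam)) +
          lam * M * (4 * R ^ 2 * A) := by gcongr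
      _ = _ := by field_simp; ring
  rw [decay, mul_min_of_nonneg _ _ (by positivity)]
  refine le_min ?_ ?_
  · refine h0.trans ?_
    rw [mul_one]
    refine le_mul_of_one_le_right (by positivity) ?_
    nlinarith [mul_pos hl hM]
  · rw [← div_eq_mul_inv, le_div_iff₀ (by positivity), mul_comm]
    exact hfin

theorem measurable_spatialFT {f : Spacetime → ℂ} (hf : Measurable f) (k : ℤ × ℤ) :
    Measurable fun s => spatialFT f s k := by
  have : StronglyMeasurable fun p : ℝ × (ℝ × ℝ) => f p * phase k p.2 := by
    refine Measurable.stronglyMeasurable ?_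
    have h1 := (continuous_phase k).measurable
    fun_prop
  exact (this.integral_prod_right' (ν := (volume : Measure (ℝ × ℝ)))).measurable

theorem IsBump.lintegral_spatialFT_pow_le (hM : 0 < M) (hf : IsBump f c T R A lam) (hR : 0 ≤ R)
    (hl : 0 < lam) (k : ℤ × ℤ) (n : ℕ) (hn : n ≠ 0) :
    ∫⁻ s, ‖spatialFT f s k‖ₑ ^ n ≤
      ENNReal.ofReal (2 * T * (4 * R ^ 2 * A * (2 + lam * M) * decay M lam k) ^ n) := by
  set B := 4 * R ^ 2 * A * (2 + lam * M) * decay M lam k with hB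
  have hB0 : 0 ≤ B := (norm_nonneg _).trans (hf.norm_spatialFT_le_decay hM hR hl 0 k)
  calc ∫⁻ s, ‖spatialFT f s k‖ₑ ^ n
      ≤ ∫⁻ s, (Set.Icc (c.1 - T) (c.1 + T)).indicator (fun _ => ENNReal.ofReal (B ^ n)) s := by
        refine lintegral_mono fun s => ?_
        by_cases hs : s ∈ Set.Icc (c.1 - T) (c.1 + T)
        · rw [Set.indicator_of_mem hs, ← ofReal_norm, ← ENNReal.ofReal_pow (norm_nonneg _)]
          refine ENNReal.ofReal_le_ofReal ?_
          have := hf.norm_spatialFT_le_decay hM hR hl s k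
          gcongr
        · rw [hf.spatialFT_eq_zero, enorm_zero, zero_pow hn]
          · exact zero_le
          · by_contra h
            rw [not_lt, abs_le] at h
            exact hs ⟨by linarith, by linarith⟩
    _ = ENNReal.ofReal (2 * T * B ^ n) := by
        rw [lintegral_indicator measurableSet_Icc, setLIntegral_const, Real.volume_Icc,
          ← ENNReal.ofReal_mul (by positivity)]
        congr 1; ring

/-- Every continuously differentiable function of compact support is a bump. -/
theorem exists_isBump_of_hasCompactSupport {f : Spacetime → ℂ} (hf : ContDiff ℝ 1 f)
    (hc : HasCompactSupport f) : ∃ R A : ℝ, 0 < R ∧ IsBump f 0 R R A 1 := by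
  obtain ⟨R, hR⟩ := hc.isCompact.isBounded.exists_norm_le
  obtain ⟨A₁, hA₁⟩ := hc.exists_bound_of_continuous hf.continuous
  obtain ⟨A₂, hA₂⟩ := (hc.fderiv ℝ).exists_bound_of_continuous (hf.continuous_fderiv (by simp))
  refine ⟨max R 1, max A₁ A₂, by positivity, hf, fun w hw => ?_, fun w => ?_, fun w v hv => ?_⟩
  · have h := (hR w (subset_tsupport _ hw)).trans (le_max_left R 1)
    rw [Prod.norm_def, Prod.norm_def, max_le_iff, max_le_iff] at h
    simpa using h
  · exact (hA₁ w).trans (le_max_left _ _)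
  · rw [one_mul]
    refine ((fderiv ℝ f w).le_opNorm _).trans ?_
    have : ‖((0, v) : Spacetime)‖ ≤ 1 := by rw [Prod.norm_def]; simpa using hv
    exact (mul_le_of_le_one_right (norm_nonneg _) this).trans
      ((hA₂ w).trans (le_max_right _ _))

/-- A rescaled test function is a bump at the scale `λ`. -/
theorem isBump_scaleTest {η : TestFun} {r : ℕ} (hr : 1 ≤ r) (hη : η ∈ testBall r) {lam : ℝ}
    (hl : 0 < lam) (z : Spacetime) :
    IsBump (scaleTest lam z η) z (lam ^ 2) lam (lam ^ 4)⁻¹ lam := by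
  obtain ⟨hsupp, hder⟩ := hη
  let L : Spacetime →L[ℝ] Spacetime :=
    ((lam ^ 2)⁻¹ • ContinuousLinearMap.id ℝ ℝ).prodMap
      ((lam⁻¹ • ContinuousLinearMap.id ℝ ℝ).prodMap (lam⁻¹ • ContinuousLinearMap.id ℝ ℝ))
  have hval : ∀ w, scaleTest lam z η w = (((lam ^ 4)⁻¹ : ℝ) : ℂ) * η (L (w - z)) := fun w => rfl
  refine ⟨(scaleTest lam z η).contDiff.of_le (by simp), fun w hw => ?_, fun w => ?_,
    fun w v hv => ?_⟩
  · have h := hsupp _ (right_ne_zero_of_mul hw)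
    simp only [parabolicNorm, abs_mul, abs_inv, abs_of_pos hl, abs_of_pos (pow_pos hl 2)] at h
    have h1 : √((lam ^ 2)⁻¹ * |w.1 - z.1|) ≤ 1 := by
      have := abs_nonneg (w.2.1 - z.2.1)
      have := abs_nonneg (w.2.2 - z.2.2)
      have : 0 ≤ lam⁻¹ * |w.2.1 - z.2.1| := by positivity
      have : 0 ≤ lam⁻¹ * |w.2.2 - z.2.2| := by positivity
      linarith
    have h2 : lam⁻¹ * |w.2.1 - z.2.1| ≤ 1 := by
      have := Real.sqrt_nonneg ((lam ^ 2)⁻¹ * |w.1 - z.1|)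
      have : 0 ≤ lam⁻¹ * |w.2.2 - z.2.2| := by positivity
      linarith
    have h3 : lam⁻¹ * |w.2.2 - z.2.2| ≤ 1 := by
      have := Real.sqrt_nonneg ((lam ^ 2)⁻¹ * |w.1 - z.1|)
      have : 0 ≤ lam⁻¹ * |w.2.1 - z.2.1| := by positivity
      linarith
    replace h1 := (Real.sqrt_le_iff.1 h1).2
    rw [one_pow, inv_mul_le_iff₀ (by positivity), mul_one] at h1
    rw [inv_mul_le_iff₀ hl, mul_one] at h2 h3
    exact ⟨h1, h2, h3⟩
  · rw [hval, norm_mul, Complex.norm_real, Real.norm_of_nonneg (by positivity)]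
    have := hder 0 (by omega) (L (w - z))
    rw [norm_iteratedFDeriv_zero] at this
    exact mul_le_of_le_one_right (by positivity) this
  · have h1 : HasFDerivAt (fun w : Spacetime => L (w - z)) L w :=
      L.hasFDerivAt.comp w ((hasFDerivAt_id w).sub_const z)
    have h2 : HasFDerivAt (fun w => (((lam ^ 4)⁻¹ : ℝ) : ℂ) * η (L (w - z))) _ w :=
      (((η.contDiff.differentiable (by simp)) (L (w - z))).hasFDerivAt.comp w h1).const_mul _
    have h3 : (scaleTest lam z η : Spacetime → ℂ) =
      fun w => (((lam ^ 4)⁻¹ : ℝ) : ℂ) * η (L (w - z)) := funext hval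
    rw [h3, h2.fderiv]
    have hLv : L (0, v) = lam⁻¹ • ((0, v) : Spacetime) := by
      simp [L, Prod.ext_iff]
    have h0v : ‖((0, v) : Spacetime)‖ ≤ 1 := by rw [Prod.norm_def]; simpa using hv
    have hd := hder 1 hr (L (w - z))
    rw [norm_iteratedFDeriv_one] at hd
    change lam * ‖(((lam ^ 4)⁻¹ : ℝ) : ℂ) * fderiv ℝ η (L (w - z)) (L (0, v))‖ ≤ _
    rw [hLv, map_smul, norm_mul, norm_smul, Complex.norm_real, Real.norm_of_nonneg (by positivity),
      Real.norm_of_nonneg (by positivity)]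
    have h4 : ‖fderiv ℝ η (L (w - z)) (0, v)‖ ≤ 1 :=
      ((fderiv ℝ η (L (w - z))).le_opNorm _).trans (mul_le_one₀ hd (norm_nonneg _) h0v)
    calc lam * ((lam ^ 4)⁻¹ * (lam⁻¹ * ‖fderiv ℝ η (L (w - z)) (0, v)‖))
        = (lam ^ 4)⁻¹ * ‖fderiv ℝ η (L (w - z)) (0, v)‖ := by field_simp
      _ ≤ _ := mul_le_of_le_one_right (by positivity) h4

end SpatialFT

/-! ### The time integrals of the chaos kernel -/

section TimeIntegrals

variable {u α β : ℝ → ℝ≥0∞}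

theorem measurable_timeIntegrand (hu : Measurable u) (hα : Measurable α) (hβ : Measurable β) :
    Measurable fun q : (ℝ × ℝ) × ℝ => u q.2 * (α (q.2 - q.1.1) * β (q.2 - q.1.2)) := by
  fun_prop

/-- Tonelli's theorem for the two time variables. -/
theorem lintegral_lintegral_lintegral_shift (hu : Measurable u) (hα : Measurable α)
    (hβ : Measurable β) :
    ∫⁻ t, ∫⁻ t', ∫⁻ s, u s * (α (s - t) * β (s - t')) =
      (∫⁻ s, u s) * ((∫⁻ s, α s) * ∫⁻ s, β s) := by
  have h1 : ∀ t, ∫⁻ t', ∫⁻ s, u s * (α (s - t) * β (s - t')) =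
      (∫⁻ s, u s * α (s - t)) * ∫⁻ s, β s := by
    intro t
    rw [lintegral_lintegral_swap (by fun_prop), ← lintegral_mul_const _ (by fun_prop)]
    refine lintegral_congr fun s => ?_
    simp only [← mul_assoc]
    rw [lintegral_const_mul _ (by fun_prop), lintegral_sub_left_eq_self β]
  simp only [h1]
  rw [lintegral_mul_const _ (Measurable.lintegral_prod_right' (f := fun q : ℝ × ℝ =>
    u q.2 * α (q.2 - q.1)) (by fun_prop)), lintegral_lintegral_swap (by fun_prop), ← mul_assoc]
  congr 1
  rw [← lintegral_mul_const _ hu]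
  refine lintegral_congr fun s => ?_
  dsimp only
  rw [lintegral_const_mul _ (by fun_prop), lintegral_sub_left_eq_self α]

theorem lintegral_sq_le_of_bounded (hu : Measurable u) (hα : Measurable α) (hβ : Measurable β)
    {Sa Sb : ℝ≥0∞} (ha : ∀ s, α s ≤ Sa) (hb : ∀ s, β s ≤ Sb) :
    ∫⁻ t, ∫⁻ t', (∫⁻ s, u s * (α (s - t) * β (s - t'))) ^ 2 ≤
      (∫⁻ s, u s) ^ 2 * (Sa * Sb) * ((∫⁻ s, α s) * ∫⁻ s, β s) := by
  have h1 : ∀ t t', (∫⁻ s, u s * (α (s - t) * β (s - t'))) ^ 2 ≤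
      ((∫⁻ s, u s) * (Sa * Sb)) * ∫⁻ s, u s * (α (s - t) * β (s - t')) := by
    intro t t'
    rw [sq]
    gcongr
    rw [← lintegral_mul_const _ hu]
    refine lintegral_mono fun s => ?_
    gcongr
    exacts [ha _, hb _]
  have hm : Measurable fun q : ℝ × ℝ => ∫⁻ s, u s * (α (s - q.1) * β (s - q.2)) :=
    (measurable_timeIntegrand hu hα hβ).lintegral_prod_right'
  have hm' : ∀ t, Measurable fun t' => ∫⁻ s, u s * (α (s - t) * β (s - t')) := fun t =>
    hm.comp measurable_prodMk_left
  calc _ ≤ ∫⁻ t, ∫⁻ t', ((∫⁻ s, u s) * (Sa * Sb)) * ∫⁻ s, u s * (α (s - t) * β (s - t')) :=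
        lintegral_mono fun t => lintegral_mono fun t' => h1 t t'
    _ = ((∫⁻ s, u s) * (Sa * Sb)) * ∫⁻ t, ∫⁻ t', ∫⁻ s, u s * (α (s - t) * β (s - t')) := by
        rw [← lintegral_const_mul _ hm.lintegral_prod_right']
        refine lintegral_congr fun t => ?_
        rw [lintegral_const_mul _ (hm' t)]
    _ = _ := by rw [lintegral_lintegral_lintegral_shift hu hα hβ]; ring

theorem sq_lintegral_mul_le {f g : ℝ → ℝ≥0∞} (hf : Measurable f) (hg : Measurable g) :
    (∫⁻ s, f s * g s) ^ 2 ≤ (∫⁻ s, f s ^ 2 * g s) * ∫⁻ s, g s := by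
  have h := ENNReal.lintegral_mul_le_Lp_mul_Lq volume Real.HolderConjugate.two_two
    (f := fun s => f s * g s ^ (1 / 2 : ℝ)) (g := fun s => g s ^ (1 / 2 : ℝ))
    (by fun_prop) (by fun_prop)
  have e1 : ∀ x : ℝ≥0∞, x ^ (1 / 2 : ℝ) * x ^ (1 / 2 : ℝ) = x := fun x => by
    rw [← ENNReal.rpow_add_of_nonneg _ _ (by norm_num) (by norm_num)]; norm_num
  have e2 : ∀ x : ℝ≥0∞, (x ^ (1 / 2 : ℝ)) ^ (2 : ℝ) = x := fun x => by
    rw [← ENNReal.rpow_mul]; norm_num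
  simp only [Pi.mul_apply, mul_assoc, e1, e2, ENNReal.mul_rpow_of_nonneg _ _ zero_le_two] at h
  calc _ ≤ ((∫⁻ s, f s ^ (2 : ℝ) * g s) ^ (1 / 2 : ℝ) * (∫⁻ s, g s) ^ (1 / 2 : ℝ)) ^ 2 := by gcongr
    _ = _ := by
      rw [mul_pow, sq, sq, e1, e1]
      simp only [ENNReal.rpow_two]

/-- The bound by the Cauchy–Schwarz inequality; it is better than the one that uses the
boundedness of the profiles if the support of `u` is large compared with their decay times. -/
theorem lintegral_sq_le_of_lintegral_le (hu : Measurable u) (hα : Measurable α) (hβ : Measurable β)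
    {X : ℝ≥0∞} (hX : ∀ t t', ∫⁻ s, α (s - t) * β (s - t') ≤ X) :
    ∫⁻ t, ∫⁻ t', (∫⁻ s, u s * (α (s - t) * β (s - t'))) ^ 2 ≤
      (∫⁻ s, u s ^ 2) * ((∫⁻ s, α s) * ∫⁻ s, β s) * X := by
  have hm : Measurable fun q : ℝ × ℝ => ∫⁻ s, u s ^ 2 * (α (s - q.1) * β (s - q.2)) :=
    (measurable_timeIntegrand (hu.pow_const 2) hα hβ).lintegral_prod_right'
  have hm' : ∀ t, Measurable fun t' => ∫⁻ s, u s ^ 2 * (α (s - t) * β (s - t')) := fun t =>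
    hm.comp measurable_prodMk_left
  calc _ ≤ ∫⁻ t, ∫⁻ t', (∫⁻ s, u s ^ 2 * (α (s - t) * β (s - t'))) * X := by
        refine lintegral_mono fun t => lintegral_mono fun t' => ?_
        refine (sq_lintegral_mul_le hu (g := fun s => α (s - t) * β (s - t'))
          (by fun_prop)).trans ?_
        gcongr
        exact hX t t'
    _ = (∫⁻ t, ∫⁻ t', ∫⁻ s, u s ^ 2 * (α (s - t) * β (s - t'))) * X := by
        rw [← lintegral_mul_const _ hm.lintegral_prod_right']
        refine lintegral_congr fun t => ?_
        rw [lintegral_mul_const _ (hm' t)]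
    _ = _ := by rw [lintegral_lintegral_lintegral_shift (hu.pow_const 2) hα hβ]

end TimeIntegrals

section Pairing

/-- The integral over the space-time variable of a test function against the product of two
modes with profiles `a` and `b` and total frequency `K`, at the times `t`. -/
def pairing (f : Spacetime → ℂ) (a b : ℝ → ℂ) (K : ℤ × ℤ) (t : ℝ × ℝ) : ℂ :=
  ∫ s, spatialFT f s K * (a (s - t.1) * b (s - t.2))

variable {M : ℝ} {f : Spacetime → ℂ} {c : Spacetime} {T R A lam : ℝ} {a b : ℝ → ℂ}

theorem measurable_pairing (hf : Measurable f) (ha : Measurable a) (hb : Measurable b)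
    (K : ℤ × ℤ) : Measurable (pairing f a b K) := by
  have h : Measurable fun q : (ℝ × ℝ) × ℝ =>
      spatialFT f q.2 K * (a (q.2 - q.1.1) * b (q.2 - q.1.2)) := by
    have := measurable_spatialFT hf K
    fun_prop
  exact h.stronglyMeasurable.integral_prod_right'.measurable

theorem enorm_pairing_le (f : Spacetime → ℂ) (a b : ℝ → ℂ) (K : ℤ × ℤ) (t : ℝ × ℝ) :
    ‖pairing f a b K t‖ₑ ≤ ∫⁻ s, ‖spatialFT f s K‖ₑ * (‖a (s - t.1)‖ₑ * ‖b (s - t.2)‖ₑ) := by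
  refine (enorm_integral_le_lintegral_enorm _).trans_eq (lintegral_congr fun s => ?_)
  rw [enorm_mul, enorm_mul]

/-- The amplitude of the spatial Fourier transform of a bump. -/
def bumpSize (M R A lam : ℝ) (K : ℤ × ℤ) : ℝ := 4 * R ^ 2 * A * (2 + lam * M) * decay M lam K

variable {Sa Sb Ia Ib : ℝ}

theorem ofReal_norm_le {x : ℂ} {S : ℝ} (h : ‖x‖ ≤ S) : ‖x‖ₑ ≤ ENNReal.ofReal S := by
  rw [← ofReal_norm]; exact ENNReal.ofReal_le_ofReal h

theorem IsBump.lintegral_pairing_sq_le (hM : 0 < M) (hf : IsBump f c T R A lam) (hT : 0 ≤ T)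
    (hR : 0 ≤ R) (hA : 0 ≤ A) (hl : 0 < lam) (ha : Measurable a) (hb : Measurable b)
    (hSa : ∀ s, ‖a s‖ ≤ Sa) (hSb : ∀ s, ‖b s‖ ≤ Sb) (hIa : ∫⁻ s, ‖a s‖ₑ ≤ ENNReal.ofReal Ia)
    (hIb : ∫⁻ s, ‖b s‖ₑ ≤ ENNReal.ofReal Ib) (hIa0 : 0 ≤ Ia) (K : ℤ × ℤ) :
    ∫⁻ t, ∫⁻ t', ‖pairing f a b K (t, t')‖ₑ ^ 2 ≤
      ENNReal.ofReal ((2 * T * bumpSize M R A lam K) ^ 2 * (Sa * Sb) * (Ia * Ib)) := by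
  have hSa0 := (norm_nonneg _).trans (hSa 0)
  have hd := decay_nonneg hM hl K
  have hB : 0 ≤ 2 * T * bumpSize M R A lam K := by unfold bumpSize; positivity
  have hu : Measurable fun s => ‖spatialFT f s K‖ₑ :=
    (measurable_spatialFT hf.smooth.continuous.measurable K).enorm
  have hu1 := hf.lintegral_spatialFT_pow_le hM hR hl K 1 one_ne_zero
  simp only [pow_one] at hu1
  calc _ ≤ ∫⁻ t, ∫⁻ t', (∫⁻ s, ‖spatialFT f s K‖ₑ * (‖a (s - t)‖ₑ * ‖b (s - t')‖ₑ)) ^ 2 :=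
        lintegral_mono fun t => lintegral_mono fun t' => by
          gcongr; exact enorm_pairing_le f a b K (t, t')
    _ ≤ (∫⁻ s, ‖spatialFT f s K‖ₑ) ^ 2 * (ENNReal.ofReal Sa * ENNReal.ofReal Sb) *
          ((∫⁻ s, ‖a s‖ₑ) * ∫⁻ s, ‖b s‖ₑ) :=
        lintegral_sq_le_of_bounded hu ha.enorm hb.enorm (fun s => ofReal_norm_le (hSa s))
          fun s => ofReal_norm_le (hSb s)
    _ ≤ (ENNReal.ofReal (2 * T * bumpSize M R A lam K)) ^ 2 *
          (ENNReal.ofReal Sa * ENNReal.ofReal Sb) * (ENNReal.ofReal Ia * ENNReal.ofReal Ib) := by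
        gcongr
        exact hu1
    _ = _ := by
      rw [← ENNReal.ofReal_pow hB, ← ENNReal.ofReal_mul hSa0, ← ENNReal.ofReal_mul hIa0,
        ← ENNReal.ofReal_mul (by positivity), ← ENNReal.ofReal_mul
          (mul_nonneg (by positivity) (mul_nonneg hSa0 ((norm_nonneg _).trans (hSb 0))))]

theorem IsBump.lintegral_pairing_sq_le_min (hM : 0 < M) (hf : IsBump f c T R A lam) (hT : 0 ≤ T)
    (hR : 0 ≤ R) (hA : 0 ≤ A) (hl : 0 < lam) (ha : Measurable a) (hb : Measurable b)
    (hSa : ∀ s, ‖a s‖ ≤ Sa) (hSb : ∀ s, ‖b s‖ ≤ Sb) (hIa : ∫⁻ s, ‖a s‖ₑ ≤ ENNReal.ofReal Ia)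
    (hIb : ∫⁻ s, ‖b s‖ₑ ≤ ENNReal.ofReal Ib) (hIa0 : 0 ≤ Ia) (hIb0 : 0 ≤ Ib) (K : ℤ × ℤ) :
    ∫⁻ t, ∫⁻ t', ‖pairing f a b K (t, t')‖ₑ ^ 2 ≤
      ENNReal.ofReal (2 * T * bumpSize M R A lam K ^ 2 * (Ia * Ib) *
        min (Sb * Ia) (Sa * Ib)) := by
  have hSa0 := (norm_nonneg _).trans (hSa 0)
  have hSb0 := (norm_nonneg _).trans (hSb 0)
  have hd := decay_nonneg hM hl K
  have hB : 0 ≤ bumpSize M R A lam K := by unfold bumpSize; positivity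
  have hu : Measurable fun s => ‖spatialFT f s K‖ₑ :=
    (measurable_spatialFT hf.smooth.continuous.measurable K).enorm
  have hX : ∀ t t', ∫⁻ s, ‖a (s - t)‖ₑ * ‖b (s - t')‖ₑ ≤
      ENNReal.ofReal (min (Sb * Ia) (Sa * Ib)) := by
    intro t t'
    rcases min_choice (Sb * Ia) (Sa * Ib) with h | h
    · rw [h, mul_comm, ENNReal.ofReal_mul hIa0]
      calc _ ≤ ∫⁻ s, ‖a (s - t)‖ₑ * ENNReal.ofReal Sb := by
            gcongr with s; exact ofReal_norm_le (hSb _)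
        _ = (∫⁻ s, ‖a s‖ₑ) * ENNReal.ofReal Sb := by
            rw [lintegral_mul_const _ (by fun_prop),
              lintegral_sub_right_eq_self (fun s => ‖a s‖ₑ)]
        _ ≤ _ := by gcongr
    · rw [h, ENNReal.ofReal_mul hSa0]
      calc _ ≤ ∫⁻ s, ENNReal.ofReal Sa * ‖b (s - t')‖ₑ := by
            gcongr with s; exact ofReal_norm_le (hSa _)
        _ = ENNReal.ofReal Sa * (∫⁻ s, ‖b s‖ₑ) := by
            rw [lintegral_const_mul _ (by fun_prop),
              lintegral_sub_right_eq_self (fun s => ‖b s‖ₑ)]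
        _ ≤ _ := by gcongr
  calc _ ≤ ∫⁻ t, ∫⁻ t', (∫⁻ s, ‖spatialFT f s K‖ₑ * (‖a (s - t)‖ₑ * ‖b (s - t')‖ₑ)) ^ 2 :=
        lintegral_mono fun t => lintegral_mono fun t' => by
          gcongr; exact enorm_pairing_le f a b K (t, t')
    _ ≤ (∫⁻ s, ‖spatialFT f s K‖ₑ ^ 2) * ((∫⁻ s, ‖a s‖ₑ) * ∫⁻ s, ‖b s‖ₑ) *
          ENNReal.ofReal (min (Sb * Ia) (Sa * Ib)) :=
        lintegral_sq_le_of_lintegral_le hu ha.enorm hb.enorm hX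
    _ ≤ ENNReal.ofReal (2 * T * bumpSize M R A lam K ^ 2) *
          (ENNReal.ofReal Ia * ENNReal.ofReal Ib) *
          ENNReal.ofReal (min (Sb * Ia) (Sa * Ib)) := by
        gcongr
        exact hf.lintegral_spatialFT_pow_le hM hR hl K 2 two_ne_zero
    _ = _ := by
      rw [← ENNReal.ofReal_mul hIa0, ← ENNReal.ofReal_mul (by positivity), ← ENNReal.ofReal_mul
          (by positivity)]

end Pairing

/-! ### Sums over modes -/

section Modes

variable {δ M : ℝ}

theorem lintegral_momentumMeasure (δ M : ℝ) (g : ℤ × ℤ → ℝ≥0∞) :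
    ∫⁻ k, g k ∂momentumMeasure δ M =
      ∑' k, ENNReal.ofReal (freq M k ^ (-(1 + 2 * δ))) * g k := by
  have e : ∀ k, symbolSq M k ^ (-(1 + 2 * δ) / 2) = freq M k ^ (-(1 + 2 * δ)) := fun k => by
    rw [← freq_sq, ← Real.rpow_natCast (freq M k) 2,
      ← Real.rpow_mul (show 0 ≤ freq M k from Real.sqrt_nonneg _)]
    congr 1
    push_cast
    ring
  rw [momentumMeasure, lintegral_withDensity_eq_lintegral_mul _ (measurable_of_countable _)
    (measurable_of_countable _), lintegral_count]
  simp only [Pi.mul_apply, e]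

theorem lintegral_modeMeasure_le {g : ℤ × ℤ → ℝ → ℝ≥0∞} (hg : ∀ k, Measurable (g k)) :
    ∫⁻ q, g q.2.1 q.1 ∂modeMeasure δ M ≤
      4 * ∑' k, ENNReal.ofReal (freq M k ^ (-(1 + 2 * δ))) * ∫⁻ t, g k t := by
  have hc : (Measure.count : Measure Comp) Set.univ = 4 := by
    rw [Measure.count_univ]
    simp [ENat.card_eq_coe_fintype_card]
  calc _ ≤ ∫⁻ t, ∫⁻ y, g y.1 t ∂((momentumMeasure δ M).prod Measure.count) :=
        lintegral_prod_le _
    _ ≤ ∫⁻ t, ∫⁻ k, ∫⁻ _ : Comp, g k t ∂Measure.count ∂momentumMeasure δ M :=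
        lintegral_mono fun t => lintegral_prod_le _
    _ = ∫⁻ t, ∑' k, ENNReal.ofReal (freq M k ^ (-(1 + 2 * δ))) * (g k t * 4) := by
        simp only [lintegral_const, hc, lintegral_momentumMeasure]
    _ = ∑' k, ∫⁻ t, ENNReal.ofReal (freq M k ^ (-(1 + 2 * δ))) * (g k t * 4) :=
        lintegral_tsum fun k => by have := hg k; fun_prop
    _ = _ := by
        rw [← ENNReal.tsum_mul_left]
        refine tsum_congr fun k => ?_
        rw [lintegral_const_mul _ (by have := hg k; fun_prop), lintegral_mul_const _ (hg k)]
        ring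

/-- The spinor part of the chaos kernel: the product of the symbols of `∇̸ + M` and
`-∇̸‾ + M`, contracted over the spinor index. -/
def diracCoeff (M : ℝ) (p : Mode × Mode) : ℂ :=
  ∑ j : Fin 2,
    (if p.1.2.2.1 = 1 then
      (diracSymbol p.1.2.1 + (M : ℂ) • (1 : Matrix (Fin 2) (Fin 2) ℂ)) p.1.2.2.2 j else 0) *
    (if p.2.2.2.1 = 0 then
      (-diracBarSymbol p.2.2.1 + (M : ℂ) • (1 : Matrix (Fin 2) (Fin 2) ℂ)) p.2.2.2.2 j else 0)

theorem norm_diracSymbol_add_le (M : ℝ) (k : ℤ × ℤ) (a b : Fin 2) :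
    ‖(diracSymbol k + (M : ℂ) • (1 : Matrix (Fin 2) (Fin 2) ℂ)) a b‖ ≤ freq M k := by
  obtain ⟨h0, h1, h2⟩ := norm_entry_le M k
  rw [← freq] at h0 h1 h2
  have hf : 0 ≤ freq M k := Real.sqrt_nonneg _
  fin_cases a <;> fin_cases b
  · simpa [diracSymbol] using h0
  · simpa [diracSymbol] using h1
  · simpa [diracSymbol] using h2
  · simpa [diracSymbol] using h0

theorem norm_neg_diracBarSymbol_add_le (M : ℝ) (k : ℤ × ℤ) (a b : Fin 2) :
    ‖(-diracBarSymbol k + (M : ℂ) • (1 : Matrix (Fin 2) (Fin 2) ℂ)) a b‖ ≤ freq M k := by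
  obtain ⟨h0, h1, h2⟩ := norm_entry_le M k
  rw [← freq] at h0 h1 h2
  have hf : 0 ≤ freq M k := Real.sqrt_nonneg _
  fin_cases a <;> fin_cases b
  · simpa [diracBarSymbol] using h0
  · rw [← norm_neg] at h2
    simpa [diracBarSymbol] using h2
  · rw [← norm_neg] at h1
    simpa [diracBarSymbol] using h1
  · simpa [diracBarSymbol] using h0

theorem norm_diracCoeff_le (M : ℝ) (p : Mode × Mode) :
    ‖diracCoeff M p‖ ≤ 2 * (freq M p.1.2.1 * freq M p.2.2.1) := by
  have h : ∀ k, 0 ≤ freq M k := fun k => Real.sqrt_nonneg _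
  refine (norm_sum_le _ _).trans ((Finset.sum_le_sum fun j _ => ?_ :
    _ ≤ ∑ _j : Fin 2, freq M p.1.2.1 * freq M p.2.2.1).trans_eq (by simp))
  rw [norm_mul]
  refine mul_le_mul ?_ ?_ (norm_nonneg _) (h _)
  · split_ifs
    · exact norm_diracSymbol_add_le M _ _ _
    · simpa using h _
  · split_ifs
    · exact norm_neg_diracBarSymbol_add_le M _ _ _
    · simpa using h _

/-- The function on pairs of modes with spinor part `diracCoeff` and with the dependence `P k k'` on
the times, for the frequencies `k`, `k'`. -/
def modeKernel (M : ℝ) (P : ℤ × ℤ → ℤ × ℤ → ℝ × ℝ → ℂ) (p : Mode × Mode) : ℂ :=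
  diracCoeff M p * P p.1.2.1 p.2.2.1 (p.1.1, p.2.1)

theorem measurable_of_modes {E : Type*} [MeasurableSpace E]
    (F : (ℝ × ℝ) → ((ℤ × ℤ) × Comp) × ((ℤ × ℤ) × Comp) → E) (hF : ∀ c, Measurable fun t => F t c) :
    Measurable fun p : Mode × Mode => F (p.1.1, p.2.1) (p.1.2, p.2.2) := by
  have h : Measurable (Function.uncurry F) := measurable_from_prod_countable_left hF
  exact h.comp (by fun_prop :
    Measurable fun p : Mode × Mode => ((p.1.1, p.2.1), (p.1.2, p.2.2)))

theorem measurable_modeKernel {P : ℤ × ℤ → ℤ × ℤ → ℝ × ℝ → ℂ}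
    (hP : ∀ k k', Measurable (P k k')) : Measurable (modeKernel M P) :=
  measurable_of_modes (fun t c => diracCoeff M ((t.1, c.1), (t.2, c.2)) * P c.1.1 c.2.1 t)
    fun c => (hP _ _).const_mul (diracCoeff M ((0, c.1), (0, c.2)))

theorem lintegral_modeKernel_le {P : ℤ × ℤ → ℤ × ℤ → ℝ × ℝ → ℂ}
    (hP : ∀ k k', Measurable (P k k')) :
    ∫⁻ p, ‖modeKernel M P p‖ₑ ^ 2 ∂(modeMeasure δ M).prod (modeMeasure δ M) ≤
      16 * ∑' k, ∑' k', ENNReal.ofReal (freq M k ^ (-(1 + 2 * δ))) *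
        (ENNReal.ofReal (freq M k' ^ (-(1 + 2 * δ))) *
          (ENNReal.ofReal ((2 * (freq M k * freq M k')) ^ 2) *
            ∫⁻ t, ∫⁻ t', ‖P k k' (t, t')‖ₑ ^ 2)) := by
  let c : ℤ × ℤ → ℤ × ℤ → ℝ≥0∞ := fun k k' => ENNReal.ofReal ((2 * (freq M k * freq M k')) ^ 2)
  have h0 : ∀ p, ‖modeKernel M P p‖ₑ ^ 2 ≤
      c p.1.2.1 p.2.2.1 * ‖P p.1.2.1 p.2.2.1 (p.1.1, p.2.1)‖ₑ ^ 2 := by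
    intro p
    have : ‖diracCoeff M p‖ₑ ^ 2 ≤ c p.1.2.1 p.2.2.1 := by
      rw [← ofReal_norm, ← ENNReal.ofReal_pow (norm_nonneg _)]
      exact ENNReal.ofReal_le_ofReal (pow_le_pow_left₀ (norm_nonneg _) (norm_diracCoeff_le M p) 2)
    rw [modeKernel, enorm_mul, mul_pow]
    gcongr
  have hm : ∀ k k', Measurable fun t => ∫⁻ t', ‖P k k' (t, t')‖ₑ ^ 2 := fun k k' =>
    ((hP k k').enorm.pow_const 2).lintegral_prod_right'
  have hm' : ∀ k k' t, Measurable fun t' => ‖P k k' (t, t')‖ₑ ^ 2 := fun k k' t =>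
    ((hP k k').enorm.pow_const 2).comp measurable_prodMk_left
  calc _ ≤ ∫⁻ q, ∫⁻ q', c q.2.1 q'.2.1 * ‖P q.2.1 q'.2.1 (q.1, q'.1)‖ₑ ^ 2
          ∂modeMeasure δ M ∂modeMeasure δ M :=
        (lintegral_mono h0).trans (lintegral_prod_le _)
    _ ≤ ∫⁻ q, (4 * ∑' k', ENNReal.ofReal (freq M k' ^ (-(1 + 2 * δ))) *
          ∫⁻ t', c q.2.1 k' * ‖P q.2.1 k' (q.1, t')‖ₑ ^ 2) ∂modeMeasure δ M :=
        lintegral_mono fun q => lintegral_modeMeasure_le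
          (g := fun k' t' => c q.2.1 k' * ‖P q.2.1 k' (q.1, t')‖ₑ ^ 2)
          fun k' => (hm' _ _ _).const_mul _
    _ = ∫⁻ q, (4 * ∑' k', ENNReal.ofReal (freq M k' ^ (-(1 + 2 * δ))) *
          (c q.2.1 k' * ∫⁻ t', ‖P q.2.1 k' (q.1, t')‖ₑ ^ 2)) ∂modeMeasure δ M := by
        refine lintegral_congr fun q => ?_
        congr 1
        refine tsum_congr fun k' => ?_
        rw [lintegral_const_mul _ (hm' _ _ _)]
    _ ≤ 4 * ∑' k, ENNReal.ofReal (freq M k ^ (-(1 + 2 * δ))) * ∫⁻ t, 4 * ∑' k',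
          ENNReal.ofReal (freq M k' ^ (-(1 + 2 * δ))) *
          (c k k' * ∫⁻ t', ‖P k k' (t, t')‖ₑ ^ 2) :=
        lintegral_modeMeasure_le (g := fun k t => 4 * ∑' k',
          ENNReal.ofReal (freq M k' ^ (-(1 + 2 * δ))) *
          (c k k' * ∫⁻ t', ‖P k k' (t, t')‖ₑ ^ 2)) fun k =>
            (Measurable.tsum fun k' => ((hm k k').const_mul _).const_mul _).const_mul _
    _ = 4 * ∑' k, ENNReal.ofReal (freq M k ^ (-(1 + 2 * δ))) * (4 * ∑' k',
          ENNReal.ofReal (freq M k' ^ (-(1 + 2 * δ))) *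
          (c k k' * ∫⁻ t, ∫⁻ t', ‖P k k' (t, t')‖ₑ ^ 2)) := by
        congr 1
        refine tsum_congr fun k => ?_
        congr 1
        rw [lintegral_const_mul _ (Measurable.tsum fun k' => ((hm k k').const_mul _).const_mul _),
          lintegral_tsum fun k' => (((hm k k').const_mul _).const_mul _).aemeasurable]
        congr 1
        refine tsum_congr fun k' => ?_
        rw [lintegral_const_mul _ ((hm k k').const_mul _), lintegral_const_mul _ (hm k k')]
    _ = _ := by
        have e : ∀ x y : ℝ≥0∞, x * (4 * y) = 4 * (x * y) := fun x y => mul_left_comm _ _ _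
        simp only [e, ENNReal.tsum_mul_left]
        rw [← mul_assoc, show (4 * 4 : ℝ≥0∞) = 16 by norm_num]

/-- The sum over the frequencies. The convolution of the weights `ω_k^{-(1+2δ)}` with themselves is
of order `ω_K^{-4δ}`, and the test function at scale `λ` restricts the sum over `K` to
`ω_K ≲ λ⁻¹`. -/
theorem exists_lintegral_modeKernel_le (hδ : 0 < δ) (hδ' : δ < 1 / 2) (hM : 0 < M) :
    ∃ C : ℝ, 0 < C ∧ ∀ (P : ℤ × ℤ → ℤ × ℤ → ℝ × ℝ → ℂ), (∀ k k', Measurable (P k k')) →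
      ∀ Θ lam : ℝ, 0 ≤ Θ → 0 < lam →
      (∀ k k', ∫⁻ t, ∫⁻ t', ‖P k k' (t, t')‖ₑ ^ 2 ≤ ENNReal.ofReal
        (Θ * (decay M lam (k + k') ^ 2 * ((freq M k ^ 2)⁻¹ * (freq M k' ^ 2)⁻¹)))) →
      ∫⁻ p, ‖modeKernel M P p‖ₑ ^ 2 ∂(modeMeasure δ M).prod (modeMeasure δ M) ≤
        ENNReal.ofReal (C * Θ * lam ^ (2 * (-1 + 2 * δ))) := by
  obtain ⟨C₁, hC₁, h₁⟩ := exists_sum_conv_le hM (by linarith : 1 < 1 + 2 * δ) (by linarith)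
  obtain ⟨C₂, hC₂, h₂⟩ := exists_sum_decay_le hM (by linarith : 0 < 4 * δ) (by linarith)
  refine ⟨64 * C₁ * C₂, by positivity, fun P hP Θ lam hΘ hl hb => ?_⟩
  refine (lintegral_modeKernel_le hP).trans ?_
  have hf : ∀ k, 0 < freq M k := freq_pos hM
  set w : ℤ × ℤ → ℝ := fun k => freq M k ^ (-(1 + 2 * δ)) with hw
  have hw0 : ∀ k, 0 ≤ w k := fun k => Real.rpow_nonneg (hf k).le _
  have hterm : ∀ k k', ENNReal.ofReal (w k) * (ENNReal.ofReal (w k') *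
      (ENNReal.ofReal ((2 * (freq M k * freq M k')) ^ 2) *
        ∫⁻ t, ∫⁻ t', ‖P k k' (t, t')‖ₑ ^ 2)) ≤
      ENNReal.ofReal (4 * Θ) * (ENNReal.ofReal (decay M lam (k + k') ^ 2) *
        ENNReal.ofReal (w k * w k')) := by
    intro k k'
    have := hf k
    have := hf k'
    calc _ ≤ ENNReal.ofReal (w k) * (ENNReal.ofReal (w k') *
        (ENNReal.ofReal ((2 * (freq M k * freq M k')) ^ 2) * ENNReal.ofReal
        (Θ * (decay M lam (k + k') ^ 2 * ((freq M k ^ 2)⁻¹ * (freq M k' ^ 2)⁻¹))))) := by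
          gcongr; exact hb k k'
      _ = _ := by
        rw [← ENNReal.ofReal_mul (by positivity), ← ENNReal.ofReal_mul (hw0 _),
          ← ENNReal.ofReal_mul (hw0 _), ← ENNReal.ofReal_mul (by positivity),
          ← ENNReal.ofReal_mul (by positivity)]
        congr 1
        field_simp
        ring
  calc _ ≤ 16 * ∑' k, ∑' k', ENNReal.ofReal (4 * Θ) *
        (ENNReal.ofReal (decay M lam (k + k') ^ 2) * ENNReal.ofReal (w k * w k')) := by
        refine mul_le_mul_right (ENNReal.tsum_le_tsum fun k => ENNReal.tsum_le_tsum fun k' => ?_) _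
        exact hterm k k'
    _ = 16 * ∑' k, ∑' K, ENNReal.ofReal (4 * Θ) *
        (ENNReal.ofReal (decay M lam K ^ 2) * ENNReal.ofReal (w k * w (K - k))) := by
        congr 1
        refine tsum_congr fun k => ?_
        rw [← (Equiv.addLeft k).tsum_eq fun K => ENNReal.ofReal (4 * Θ) *
          (ENNReal.ofReal (decay M lam K ^ 2) * ENNReal.ofReal (w k * w (K - k)))]
        refine tsum_congr fun k' => ?_
        rw [Equiv.coe_addLeft, add_sub_cancel_left]
    _ = 16 * (ENNReal.ofReal (4 * Θ) * ∑' K, ENNReal.ofReal (decay M lam K ^ 2) *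
          ∑' k, ENNReal.ofReal (w k * w (K - k))) := by
        rw [ENNReal.tsum_comm]
        simp only [ENNReal.tsum_mul_left]
    _ ≤ 16 * (ENNReal.ofReal (4 * Θ) * ∑' K, ENNReal.ofReal (decay M lam K ^ 2) *
          ENNReal.ofReal (C₁ * freq M K ^ (2 - 2 * (1 + 2 * δ)))) := by
        gcongr with K
        exact h₁ K
    _ = 16 * (ENNReal.ofReal (4 * Θ) * (ENNReal.ofReal C₁ * ∑' K, ENNReal.ofReal
          (freq M K ^ (-(4 * δ)) * decay M lam K ^ 2))) := by
        rw [← ENNReal.tsum_mul_left (a := ENNReal.ofReal C₁)]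
        refine congrArg (fun x => 16 * (ENNReal.ofReal (4 * Θ) * x)) (tsum_congr fun K => ?_)
        rw [← ENNReal.ofReal_mul (by positivity), ← ENNReal.ofReal_mul hC₁.le]
        congr 1
        rw [show 2 - 2 * (1 + 2 * δ) = -(4 * δ) by ring]
        ring
    _ ≤ 16 * (ENNReal.ofReal (4 * Θ) * (ENNReal.ofReal C₁ *
          ENNReal.ofReal (C₂ * lam ^ (4 * δ - 2)))) := by
        gcongr
        exact h₂ lam hl
    _ = _ := by
        rw [← ENNReal.ofReal_mul hC₁.le, ← ENNReal.ofReal_mul (by positivity),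
          show (16 : ℝ≥0∞) = ENNReal.ofReal 16 by simp, ← ENNReal.ofReal_mul (by norm_num)]
        congr 1
        rw [show 4 * δ - 2 = 2 * (-1 + 2 * δ) by ring]
        ring

end Modes

/-! ### The smeared chaos kernels -/

section Smeared

variable {δ M S S' : ℝ} {G G' : Spacetime → ℝ} {H H' : ℤ × ℤ → ℝ → ℂ}

theorem chaosKernel_eq (hG : IsProfile G H) (z : Spacetime) (p : Mode × Mode) :
    chaosKernel M G z p = diracCoeff M p * (phase (p.1.2.1 + p.2.2.1) z.2 *
      (H p.1.2.1 (z.1 - p.1.1) * H p.2.2.1 (z.1 - p.2.1))) := by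
  rw [chaosKernel, diracCoeff, Finset.sum_mul]
  refine Finset.sum_congr rfl fun j _ => ?_
  rw [antiVec, fermionVec, hG, hG, phase_add_left]
  split_ifs <;> ring

theorem integrable_mul_chaosKernel (hG : IsProfile G H) (hH : IsHeatLike M S H)
    {f : Spacetime → ℂ} (hf : Integrable f) (p : Mode × Mode) :
    Integrable fun z => f z * chaosKernel M G z p := by
  simp only [chaosKernel_eq hG]
  have hm : Measurable fun z : Spacetime => diracCoeff M p * (phase (p.1.2.1 + p.2.2.1) z.2 *
      (H p.1.2.1 (z.1 - p.1.1) * H p.2.2.1 (z.1 - p.2.1))) := by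
    have h1 := hH.meas p.1.2.1
    have h2 := hH.meas p.2.2.1
    have h3 := (continuous_phase (p.1.2.1 + p.2.2.1)).measurable
    fun_prop
  refine hf.mul_bdd (c := ‖diracCoeff M p‖ * (S * S)) hm.aestronglyMeasurable
    (Eventually.of_forall fun z => ?_)
  rw [norm_mul, norm_mul, norm_mul, norm_phase, one_mul]
  have h0 := (norm_nonneg _).trans (hH.norm_le p.1.2.1 0)
  gcongr
  exacts [hH.norm_le _ _, hH.norm_le _ _]

theorem integral_mul_chaosKernel (hG : IsProfile G H) (hH : IsHeatLike M S H)
    {f : Spacetime → ℂ} (hf : Integrable f) (p : Mode × Mode) :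
    ∫ z, f z * chaosKernel M G z p =
      modeKernel M (fun k k' => pairing f (H k) (H k') (k + k')) p := by
  have h := integrable_mul_chaosKernel hG hH hf p
  rw [modeKernel, pairing, Measure.volume_eq_prod, integral_prod _ h, ← integral_const_mul]
  refine integral_congr_ae (Eventually.of_forall fun s => ?_)
  simp only [chaosKernel_eq hG, spatialFT]
  rw [← integral_mul_const, ← integral_const_mul]
  refine integral_congr_ae (Eventually.of_forall fun x => ?_)
  simp only
  ring

theorem measurable_modeKernel_pairing {f : Spacetime → ℂ} (hf : Measurable f)
    (hH : IsHeatLike M S H) :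
    Measurable (modeKernel M fun k k' => pairing f (H k) (H k') (k + k')) :=
  measurable_modeKernel fun k k' => measurable_pairing hf (hH.meas k) (hH.meas k') _

theorem testFun_integrable (η : TestFun) : Integrable (η : Spacetime → ℂ) :=
  η.contDiff.continuous.integrable_of_hasCompactSupport η.hasCompactSupport

theorem testFun_measurable (η : TestFun) : Measurable (η : Spacetime → ℂ) :=
  η.contDiff.continuous.measurable

theorem smearedKernel_eq (hG : IsProfile G H) (hH : IsHeatLike M S H) (η : TestFun) :
    smearedKernel M G η = modeKernel M fun k k' => pairing η (H k) (H k') (k + k') :=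
  funext fun p => integral_mul_chaosKernel hG hH (testFun_integrable η) p

theorem memLp_two_of_lintegral_sq_le {X : Type*} [MeasurableSpace X] {μ : Measure X} {F : X → ℂ}
    (hF : Measurable F) {c : ℝ} (h : ∫⁻ p, ‖F p‖ₑ ^ 2 ∂μ ≤ ENNReal.ofReal c) :
    MemLp F 2 μ := by
  refine ⟨hF.aestronglyMeasurable, ?_⟩
  rw [eLpNorm_lt_top_iff_lintegral_rpow_enorm_lt_top two_ne_zero ENNReal.ofNat_ne_top]
  simp only [ENNReal.toReal_ofNat, ENNReal.rpow_two]
  exact h.trans_lt ENNReal.ofReal_lt_top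

theorem norm_toLp_sq_le {X : Type*} [MeasurableSpace X] {μ : Measure X} {F : X → ℂ}
    (hF : MemLp F 2 μ) {c : ℝ} (hc : 0 ≤ c) (h : ∫⁻ p, ‖F p‖ₑ ^ 2 ∂μ ≤ ENNReal.ofReal (c ^ 2)) :
    ‖hF.toLp F‖ ≤ c := by
  rw [Lp.norm_toLp]
  refine ENNReal.toReal_le_of_le_ofReal hc ?_
  rw [eLpNorm_eq_lintegral_rpow_enorm_toReal two_ne_zero ENNReal.ofNat_ne_top]
  simp only [ENNReal.toReal_ofNat, ENNReal.rpow_two]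
  calc _ ≤ (ENNReal.ofReal (c ^ 2)) ^ (1 / 2 : ℝ) := by gcongr
    _ = _ := by
      rw [ENNReal.ofReal_pow hc, ← ENNReal.rpow_two, ← ENNReal.rpow_mul]
      norm_num

/-- The chaos kernel smeared with a bump is square integrable, and its norm depends on the
bump only through the scale and the size of its spatial Fourier transform. -/
theorem exists_lintegral_smeared_le (hδ : 0 < δ) (hδ' : δ < 1 / 2) (hM : 0 < M) :
    ∃ C : ℝ, 0 < C ∧ ∀ (S : ℝ) (H : ℤ × ℤ → ℝ → ℂ), IsHeatLike M S H →
      ∀ (f : Spacetime → ℂ) (c : Spacetime) (T R A lam : ℝ), IsBump f c T R A lam → 0 ≤ T →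
      0 ≤ R → 0 ≤ A → 0 < lam →
      ∫⁻ p, ‖modeKernel M (fun k k' => pairing f (H k) (H k') (k + k')) p‖ₑ ^ 2
          ∂(modeMeasure δ M).prod (modeMeasure δ M) ≤
        ENNReal.ofReal (C * ((2 * T * (4 * R ^ 2 * A * (2 + lam * M))) ^ 2 * S ^ 4) *
          lam ^ (2 * (-1 + 2 * δ))) := by
  obtain ⟨C, hC, h⟩ := exists_lintegral_modeKernel_le hδ hδ' hM
  refine ⟨C, hC, fun S H hH f c T R A lam hf hT hR hA hl => ?_⟩
  have hS0 := (norm_nonneg _).trans (hH.norm_le 0 0)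
  refine h _ (fun k k' => measurable_pairing hf.smooth.continuous.measurable (hH.meas k)
    (hH.meas k') _) _ lam (by positivity) hl fun k k' => ?_
  refine (hf.lintegral_pairing_sq_le hM hT hR hA hl (hH.meas k) (hH.meas k') (hH.norm_le k)
    (hH.norm_le k') (hH.lintegral_le k) (hH.lintegral_le k') (by positivity) (k + k')).trans_eq ?_
  congr 1
  rw [bumpSize]
  ring

theorem memLp_smearedKernel (hδ : 0 < δ) (hδ' : δ < 1 / 2) (hM : 0 < M) (hG : IsProfile G H)
    (hH : IsHeatLike M S H) (η : TestFun) :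
    MemLp (smearedKernel M G η) 2 ((modeMeasure δ M).prod (modeMeasure δ M)) := by
  obtain ⟨C, -, h⟩ := exists_lintegral_smeared_le hδ hδ' hM
  obtain ⟨R, A, hR, hb⟩ := exists_isBump_of_hasCompactSupport
    (η.contDiff.of_le (by exact_mod_cast le_top)) η.hasCompactSupport
  rw [smearedKernel_eq hG hH]
  exact memLp_two_of_lintegral_sq_le (measurable_modeKernel_pairing (testFun_measurable η) hH)
    (h S H hH η 0 R R A 1 hb hR.le hR.le ((norm_nonneg _).trans (hb.norm_le 0)) one_pos)

/-- The regularity estimate, at a single scale. -/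
theorem exists_norm_smeared_scaleTest_le (hδ : 0 < δ) (hδ' : δ < 1 / 2) (hM : 0 < M) (S : ℝ) :
    ∃ C : ℝ, 0 < C ∧ ∀ (G : Spacetime → ℝ) (H : ℤ × ℤ → ℝ → ℂ), IsProfile G H → IsHeatLike M S H →
      ∀ (r : ℕ), 1 ≤ r → ∀ η ∈ testBall r, ∀ z, ∀ lam ∈ Set.Ioc (0 : ℝ) 1,
      ‖toTwo δ M (smearedKernel M G (scaleTest lam z η))‖ ≤ C * lam ^ (-1 + 2 * δ) := by
  obtain ⟨C, hC, h⟩ := exists_lintegral_smeared_le hδ hδ' hM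
  refine ⟨√C * (8 * (2 + M) * S ^ 2 + 1), by positivity, fun G H hG hH r hr η hη z lam hl => ?_⟩
  have hmem := memLp_smearedKernel hδ hδ' hM hG hH (scaleTest lam z η)
  have hl0 : 0 < lam := hl.1
  rw [toTwo, dif_pos hmem]
  refine norm_toLp_sq_le hmem (by positivity) ?_
  rw [smearedKernel_eq hG hH]
  refine (h S H hH _ z (lam ^ 2) lam (lam ^ 4)⁻¹ lam (isBump_scaleTest hr hη hl0 z) (by positivity)
    (by positivity) (by positivity) hl0).trans (ENNReal.ofReal_le_ofReal ?_)
  have e1 : ∀ X : ℝ, (√C * X * lam ^ (-1 + 2 * δ)) ^ 2 = C * X ^ 2 * lam ^ (2 * (-1 + 2 * δ)) := by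
    intro X
    rw [mul_pow, mul_pow, Real.sq_sqrt hC.le, ← Real.rpow_natCast (lam ^ (-1 + 2 * δ)) 2,
      ← Real.rpow_mul hl0.le, mul_comm (-1 + 2 * δ), Nat.cast_ofNat]
  have e : 2 * lam ^ 2 * (4 * lam ^ 2 * (lam ^ 4)⁻¹ * (2 + lam * M)) = 8 * (2 + lam * M) := by
    field_simp
    ring
  rw [e1, e, show S ^ 4 = (S ^ 2) ^ 2 by ring, ← mul_pow]
  gcongr
  have : lam * M ≤ M := mul_le_of_le_one_left hM.le hl.2
  nlinarith [sq_nonneg S]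

end Smeared

/-! ### The rate of convergence -/

section Rate

variable {δ M S : ℝ}

/-- Interpolation between the three bounds for the relative size of the error at frequency `x`. -/
theorem min_le_rpow_mul_rpow {ε lam ν x : ℝ} (hε : 0 < ε) (hl : 0 < lam) (hl' : lam ≤ 1)
    (hν : 0 < ν) (hν' : ν ≤ 1) (hx : 0 < x) :
    min 1 (min (ε * x) ((lam * x) ^ 2)⁻¹) ≤ ε ^ (ν / 2) * lam ^ (-(2 * ν)) := by
  set B := min 1 (min (ε * x) ((lam * x) ^ 2)⁻¹) with hB
  have hB0 : 0 < B := by rw [hB]; positivity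
  have h1 : B ≤ 1 := min_le_left _ _
  have h2 : B ≤ ε * x := (min_le_right _ _).trans (min_le_left _ _)
  have h3 : B ≤ ((lam * x) ^ 2)⁻¹ := (min_le_right _ _).trans (min_le_right _ _)
  have h4 : B ^ (3 : ℝ) ≤ (ε * lam⁻¹) ^ (2 : ℝ) := by
    calc B ^ (3 : ℝ) = B ^ 2 * B := by
          rw [show (3 : ℝ) = ((3 : ℕ) : ℝ) by norm_num, Real.rpow_natCast]; ring
      _ ≤ (ε * x) ^ 2 * ((lam * x) ^ 2)⁻¹ := by gcongr
      _ = (ε * lam⁻¹) ^ (2 : ℝ) := by rw [Real.rpow_two]; field_simp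
  calc B ≤ B ^ (3 * (ν / 4)) := by
        conv_lhs => rw [← Real.rpow_one B]
        exact Real.rpow_le_rpow_of_exponent_ge hB0 h1 (by linarith)
    _ = (B ^ (3 : ℝ)) ^ (ν / 4) := Real.rpow_mul hB0.le _ _
    _ ≤ ((ε * lam⁻¹) ^ (2 : ℝ)) ^ (ν / 4) := Real.rpow_le_rpow (by positivity) h4 (by positivity)
    _ = ε ^ (ν / 2) * lam ^ (-(ν / 2)) := by
        rw [← Real.rpow_mul (by positivity), Real.mul_rpow hε.le (by positivity),
          Real.inv_rpow hl.le, ← Real.rpow_neg hl.le]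
        congr 2 <;> ring
    _ ≤ _ := by
        gcongr ε ^ (ν / 2) * ?_
        exact Real.rpow_le_rpow_of_exponent_ge hl hl' (by linarith)

/-- The error bound for a single pair of modes. If the product of the `L¹` norms of the profiles
is small of order `ε Ω`, with `Ω` the larger frequency, this is combined with the
decay that the test function's time scale `λ²` gives for `Ω ≫ λ⁻¹`. -/
theorem lintegral_pairing_scaleTest_le (hM : 0 < M) {η : TestFun} {r : ℕ} (hr : 1 ≤ r)
    (hη : η ∈ testBall r) (z : Spacetime) {ε lam ν : ℝ} (hε : 0 < ε) (hl : 0 < lam) (hl' : lam ≤ 1)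
    (hν : 0 < ν) (hν' : ν ≤ 1) {a b : ℝ → ℂ} (ha : Measurable a) (hb : Measurable b)
    (hSa : ∀ s, ‖a s‖ ≤ S) (hSb : ∀ s, ‖b s‖ ≤ S) {x y Ia Ib : ℝ} (hx : 0 < x) (hy : 0 < y)
    (hIa : ∫⁻ s, ‖a s‖ₑ ≤ ENNReal.ofReal Ia) (hIb : ∫⁻ s, ‖b s‖ₑ ≤ ENNReal.ofReal Ib)
    (hIa0 : 0 ≤ Ia) (hIb0 : 0 ≤ Ib) (hIa1 : Ia ≤ S * (x ^ 2)⁻¹) (hIb1 : Ib ≤ S * (y ^ 2)⁻¹)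
    (hI : Ia * Ib ≤ S ^ 2 * ((x ^ 2)⁻¹ * (y ^ 2)⁻¹) * (ε * max x y)) (K : ℤ × ℤ) :
    ∫⁻ t, ∫⁻ t', ‖pairing (scaleTest lam z η) a b K (t, t')‖ₑ ^ 2 ≤
      ENNReal.ofReal (64 * (2 + M) ^ 2 * S ^ 4 * (ε ^ (ν / 2) * lam ^ (-(2 * ν))) *
        (decay M lam K ^ 2 * ((x ^ 2)⁻¹ * (y ^ 2)⁻¹))) := by
  have hf := isBump_scaleTest hr hη hl z
  have hS0 := (norm_nonneg _).trans (hSa 0)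
  have hd := decay_nonneg hM hl K
  have hlM : lam * M ≤ M := mul_le_of_le_one_left hM.le hl'
  have hΩ : 0 < max x y := lt_max_of_lt_left hx
  set E : ℝ := 64 * (2 + M) ^ 2 * S ^ 4 * (decay M lam K ^ 2 * ((x ^ 2)⁻¹ * (y ^ 2)⁻¹)) with hE
  have hE0 : 0 ≤ E := by positivity
  have e1 : bumpSize M lam (lam ^ 4)⁻¹ lam K = 4 * (lam ^ 2)⁻¹ * (2 + lam * M) * decay M lam K := by
    rw [bumpSize]; field_simp
  have e2 : 2 * lam ^ 2 * bumpSize M lam (lam ^ 4)⁻¹ lam K =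
      8 * (2 + lam * M) * decay M lam K := by
    rw [e1]; field_simp; ring
  have hIab : Ia * Ib ≤ S ^ 2 * ((x ^ 2)⁻¹ * (y ^ 2)⁻¹) := by
    calc Ia * Ib ≤ (S * (x ^ 2)⁻¹) * (S * (y ^ 2)⁻¹) := by gcongr
      _ = _ := by ring
  -- the bound by the product of the `L¹` norms of the profiles
  have b0 : ∀ m : ℝ, 0 ≤ m → Ia * Ib ≤ S ^ 2 * ((x ^ 2)⁻¹ * (y ^ 2)⁻¹) * m →
      ∫⁻ t, ∫⁻ t', ‖pairing (scaleTest lam z η) a b K (t, t')‖ₑ ^ 2 ≤ ENNReal.ofReal (E * m) := by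
    intro m hm h
    refine (hf.lintegral_pairing_sq_le hM (by positivity) hl.le (by positivity) hl ha hb hSa hSb
      hIa hIb hIa0 K).trans (ENNReal.ofReal_le_ofReal ?_)
    rw [e2]
    calc _ ≤ (8 * (2 + M) * decay M lam K) ^ 2 * (S * S) *
          (S ^ 2 * ((x ^ 2)⁻¹ * (y ^ 2)⁻¹) * m) := by gcongr
      _ = _ := by rw [hE]; ring
  -- the Cauchy–Schwarz bound, with the profile of the larger frequency integrated twice
  have b1 : ∫⁻ t, ∫⁻ t', ‖pairing (scaleTest lam z η) a b K (t, t')‖ₑ ^ 2 ≤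
      ENNReal.ofReal (E * ((lam * max x y) ^ 2)⁻¹) := by
    refine (hf.lintegral_pairing_sq_le_min hM (by positivity) hl.le (by positivity) hl ha hb hSa hSb
      hIa hIb hIa0 hIb0 K).trans (ENNReal.ofReal_le_ofReal ?_)
    have hmin : min (S * Ia) (S * Ib) ≤ S ^ 2 * ((max x y) ^ 2)⁻¹ := by
      rcases max_choice x y with h | h
      · rw [h]
        calc _ ≤ S * Ia := min_le_left _ _
          _ ≤ S * (S * (x ^ 2)⁻¹) := by gcongr
          _ = _ := by ring
      · rw [h]
        calc _ ≤ S * Ib := min_le_right _ _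
          _ ≤ S * (S * (y ^ 2)⁻¹) := by gcongr
          _ = _ := by ring
    rw [e1]
    calc _ ≤ 2 * lam ^ 2 * (4 * (lam ^ 2)⁻¹ * (2 + M) * decay M lam K) ^ 2 *
          (S ^ 2 * ((x ^ 2)⁻¹ * (y ^ 2)⁻¹)) * (S ^ 2 * ((max x y) ^ 2)⁻¹) := by gcongr
      _ = (E / 2) * ((lam * max x y) ^ 2)⁻¹ := by
          rw [hE]; field_simp; ring
      _ ≤ _ := by
          gcongr
          linarith
  have key : ∫⁻ t, ∫⁻ t', ‖pairing (scaleTest lam z η) a b K (t, t')‖ₑ ^ 2 ≤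
      ENNReal.ofReal (E * min 1 (min (ε * max x y) ((lam * max x y) ^ 2)⁻¹)) := by
    rcases min_choice 1 (min (ε * max x y) ((lam * max x y) ^ 2)⁻¹) with h | h
    · rw [h]; exact b0 1 zero_le_one (by rwa [mul_one])
    · rw [h]
      rcases min_choice (ε * max x y) ((lam * max x y) ^ 2)⁻¹ with h | h
      · rw [h]; exact b0 _ (by positivity) hI
      · rw [h]; exact b1
  refine key.trans (ENNReal.ofReal_le_ofReal ?_)
  calc _ ≤ E * (ε ^ (ν / 2) * lam ^ (-(2 * ν))) := by
        gcongr; exact min_le_rpow_mul_rpow hε hl hl' hν hν' hΩ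
    _ = _ := by rw [hE]; ring

theorem IsHeatLike.mono {S' : ℝ} {H : ℤ × ℤ → ℝ → ℂ} (hH : IsHeatLike M S H) (h : S ≤ S') :
    IsHeatLike M S' H :=
  ⟨hH.meas, fun k τ => (hH.norm_le k τ).trans h,
    fun k => (hH.lintegral_le k).trans (ENNReal.ofReal_le_ofReal (by gcongr))⟩

theorem IsHeatLike.sub {S' : ℝ} {H H' : ℤ × ℤ → ℝ → ℂ} (hH : IsHeatLike M S H)
    (hH' : IsHeatLike M S' H') : IsHeatLike M (S + S') fun k τ => H k τ - H' k τ := by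
  have hS0 := (norm_nonneg _).trans (hH.norm_le 0 0)
  have hS0' := (norm_nonneg _).trans (hH'.norm_le 0 0)
  refine ⟨fun k => (hH.meas k).sub (hH'.meas k), fun k τ => (norm_sub_le _ _).trans
    (add_le_add (hH.norm_le k τ) (hH'.norm_le k τ)), fun k => ?_⟩
  calc _ ≤ ∫⁻ τ, (‖H k τ‖ₑ + ‖H' k τ‖ₑ) := lintegral_mono fun τ => enorm_sub_le
    _ = (∫⁻ τ, ‖H k τ‖ₑ) + ∫⁻ τ, ‖H' k τ‖ₑ := lintegral_add_left (hH.meas k).enorm _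
    _ ≤ _ := add_le_add (hH.lintegral_le k) (hH'.lintegral_le k)
    _ = _ := by rw [← ENNReal.ofReal_add (by positivity) (by positivity), add_mul]

theorem IsBump.integrable_spatialFT_mul {f : Spacetime → ℂ} {c : Spacetime} {T R A lam : ℝ}
    (hM : 0 < M) (hf : IsBump f c T R A lam) (hR : 0 ≤ R) (hl : 0 < lam) (K : ℤ × ℤ) {a b : ℝ → ℂ}
    (ha : Measurable a) (hb : Measurable b) {Sa Sb : ℝ} (hSa : ∀ s, ‖a s‖ ≤ Sa)
    (hSb : ∀ s, ‖b s‖ ≤ Sb) (t : ℝ × ℝ) :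
    Integrable fun s => spatialFT f s K * (a (s - t.1) * b (s - t.2)) := by
  have h : Integrable fun s => spatialFT f s K := by
    refine ⟨(measurable_spatialFT hf.smooth.continuous.measurable K).aestronglyMeasurable, ?_⟩
    have := hf.lintegral_spatialFT_pow_le hM hR hl K 1 one_ne_zero
    simp only [pow_one] at this
    exact this.trans_lt ENNReal.ofReal_lt_top
  refine h.mul_bdd (c := Sa * Sb) (Measurable.aestronglyMeasurable (by fun_prop))
    (Eventually.of_forall fun s => ?_)
  rw [norm_mul]
  exact mul_le_mul (hSa _) (hSb _) (norm_nonneg _) ((norm_nonneg _).trans (hSa 0))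

/-- The error estimate, at a single scale. -/
theorem exists_norm_smeared_sub_le (hδ : 0 < δ) (hδ' : δ < 1 / 2) (hM : 0 < M) {S : ℝ} :
    ∃ C : ℝ, 0 < C ∧ ∀ (G G' : Spacetime → ℝ) (H H' : ℤ × ℤ → ℝ → ℂ), IsProfile G H →
      IsProfile G' H' → IsHeatLike M S H → IsHeatLike M S H' → ∀ ε : ℝ, 0 < ε →
      (∀ k, ∫⁻ τ, ‖H k τ - H' k τ‖ₑ ≤ ENNReal.ofReal (S * (ε ^ 2 + ε * (freq M k)⁻¹))) →
      ∀ ν : ℝ, 0 < ν → ν ≤ 1 →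
      ∀ (r : ℕ), 1 ≤ r → ∀ η ∈ testBall r, ∀ z, ∀ lam ∈ Set.Ioc (0 : ℝ) 1,
      ‖toTwo δ M (smearedKernel M G (scaleTest lam z η)) -
        toTwo δ M (smearedKernel M G' (scaleTest lam z η))‖ ≤
          C * ε ^ (ν / 4) * lam ^ (-1 + 2 * δ - ν) := by
  obtain ⟨C, hC, h⟩ := exists_lintegral_modeKernel_le hδ hδ' hM
  refine ⟨√C * (32 * (2 + M) * S ^ 2 * 2 + 1), by positivity,
    fun G G' H H' hG hG' hH hH' ε hε hd ν hν hν' r hr η hη z lam hl => ?_⟩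
  have hl0 : 0 < lam := hl.1
  have hl1 : lam ≤ 1 := hl.2
  have hS0 := (norm_nonneg _).trans (hH.norm_le 0 0)
  set f := scaleTest lam z η with hf
  have hbump : IsBump f z (lam ^ 2) lam (lam ^ 4)⁻¹ lam := isBump_scaleTest hr hη hl0 z
  have hm := memLp_smearedKernel hδ hδ' hM hG hH f
  have hm' := memLp_smearedKernel hδ hδ' hM hG' hH' f
  have hfm := testFun_measurable f
  let D : ℤ × ℤ → ℝ → ℂ := fun k τ => H k τ - H' k τ
  have hD : IsHeatLike M (2 * S) D := by rw [two_mul]; exact hH.sub hH'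
  have hH2 := hH.mono (by linarith : S ≤ 2 * S)
  have hH2' := hH'.mono (by linarith : S ≤ 2 * S)
  have hfreq := freq_pos hM
  -- the `L¹` norm of the difference of the profiles, relative to the bound for each of them
  let m : ℤ × ℤ → ℝ := fun k => 2 * S * (freq M k ^ 2)⁻¹ * min 1 (ε * freq M k)
  have hm0 : ∀ k, 0 ≤ m k := fun k => by have := hfreq k; positivity
  have hm1 : ∀ k, m k ≤ 2 * S * (freq M k ^ 2)⁻¹ := fun k =>
    mul_le_of_le_one_right (by have := hfreq k; positivity) (min_le_left _ _)
  have hDm : ∀ k, ∫⁻ τ, ‖D k τ‖ₑ ≤ ENNReal.ofReal (m k) := by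
    intro k
    have hk := hfreq k
    rcases le_total 1 (ε * freq M k) with h1 | h1
    · simp only [m, min_eq_left h1, mul_one]
      exact hD.lintegral_le k
    · refine (hd k).trans (ENNReal.ofReal_le_ofReal ?_)
      simp only [m, min_eq_right h1]
      have h2 : ε ^ 2 ≤ ε * (freq M k)⁻¹ := by
        rw [sq]
        gcongr
        rw [← one_div]
        exact (le_div_iff₀ hk).2 h1
      calc S * (ε ^ 2 + ε * (freq M k)⁻¹) ≤ S * (ε * (freq M k)⁻¹ + ε * (freq M k)⁻¹) := by gcongr
        _ = _ := by field_simp; ring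
  have hmin : ∀ k x, freq M k ≤ x → min 1 (ε * freq M k) ≤ ε * x := fun k x hx =>
    (min_le_right _ _).trans (by gcongr)
  let P₁ : ℤ × ℤ → ℤ × ℤ → ℝ × ℝ → ℂ := fun k k' => pairing f (D k) (H k') (k + k')
  let P₂ : ℤ × ℤ → ℤ × ℤ → ℝ × ℝ → ℂ := fun k k' => pairing f (H' k) (D k') (k + k')
  have hP₁ : ∀ k k', Measurable (P₁ k k') := fun k k' =>
    measurable_pairing hfm (hD.meas k) (hH.meas k') _
  have hP₂ : ∀ k k', Measurable (P₂ k k') := fun k k' =>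
    measurable_pairing hfm (hH'.meas k) (hD.meas k') _
  set Θ : ℝ := 64 * (2 + M) ^ 2 * (2 * S) ^ 4 * (ε ^ (ν / 2) * lam ^ (-(2 * ν))) with hΘ
  have hΘ0 : 0 ≤ Θ := by positivity
  have b₁ := h P₁ hP₁ Θ lam hΘ0 hl0 fun k k' => by
    have hk := hfreq k
    have hk' := hfreq k'
    refine lintegral_pairing_scaleTest_le hM hr hη z hε hl0 hl1 hν hν' (hD.meas k) (hH.meas k')
      (hD.norm_le k) (hH2.norm_le k') hk hk' (hDm k) (hH2.lintegral_le k') (hm0 k) (by positivity)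
      (hm1 k) le_rfl ?_ _
    calc m k * (2 * S * (freq M k' ^ 2)⁻¹) = (2 * S) ^ 2 * ((freq M k ^ 2)⁻¹ * (freq M k' ^ 2)⁻¹) *
          min 1 (ε * freq M k) := by simp only [m]; ring
      _ ≤ _ := by
        gcongr
        exact hmin _ _ (le_max_left _ _)
  have b₂ := h P₂ hP₂ Θ lam hΘ0 hl0 fun k k' => by
    have hk := hfreq k
    have hk' := hfreq k'
    refine lintegral_pairing_scaleTest_le hM hr hη z hε hl0 hl1 hν hν' (hH'.meas k) (hD.meas k')
      (hH2'.norm_le k) (hD.norm_le k') hk hk' (hH2'.lintegral_le k) (hDm k') (by positivity)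
      (hm0 k') le_rfl (hm1 k') ?_ _
    calc (2 * S * (freq M k ^ 2)⁻¹) * m k' = (2 * S) ^ 2 * ((freq M k ^ 2)⁻¹ * (freq M k' ^ 2)⁻¹) *
          min 1 (ε * freq M k') := by simp only [m]; ring
      _ ≤ _ := by
        gcongr
        exact hmin _ _ (le_max_right _ _)
  -- the product rule `h h' - g g' = (h - g) h' + g (h' - g')` for the two profiles
  have hsplit : ∀ p, (smearedKernel M G f - smearedKernel M G' f) p =
      modeKernel M P₁ p + modeKernel M P₂ p := by
    intro p
    have i : ∀ (a b : ℤ × ℤ → ℝ → ℂ) (_ : IsHeatLike M (2 * S) a) (_ : IsHeatLike M (2 * S) b),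
        Integrable fun s => spatialFT f s (p.1.2.1 + p.2.2.1) *
          (a p.1.2.1 (s - p.1.1) * b p.2.2.1 (s - p.2.1)) := fun a b ha hb =>
      hbump.integrable_spatialFT_mul hM hl0.le hl0 _ (ha.meas _) (hb.meas _) (ha.norm_le _)
        (hb.norm_le _) (p.1.1, p.2.1)
    rw [smearedKernel_eq hG hH, smearedKernel_eq hG' hH', Pi.sub_apply]
    simp only [modeKernel, ← mul_sub, ← mul_add, P₁, P₂, pairing]
    rw [← integral_sub (i H H hH2 hH2) (i H' H' hH2' hH2'),
      ← integral_add (i D H hD hH2) (i H' D hH2' hD)]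
    congr 1
    refine integral_congr_ae (Eventually.of_forall fun s => ?_)
    simp only [D]
    ring
  rw [toTwo, dif_pos hm, toTwo, dif_pos hm', ← MemLp.toLp_sub]
  refine norm_toLp_sq_le (hm.sub hm') (by positivity) ?_
  have hpt : ∀ p, ‖(smearedKernel M G f - smearedKernel M G' f) p‖ₑ ^ 2 ≤
      2 * ‖modeKernel M P₁ p‖ₑ ^ 2 + 2 * ‖modeKernel M P₂ p‖ₑ ^ 2 := by
    intro p
    rw [hsplit, ← mul_add]
    simp only [← ofReal_norm]
    rw [← ENNReal.ofReal_pow (norm_nonneg _), ← ENNReal.ofReal_pow (norm_nonneg _),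
      ← ENNReal.ofReal_pow (norm_nonneg _), ← ENNReal.ofReal_add (by positivity) (by positivity),
      show (2 : ℝ≥0∞) = ENNReal.ofReal 2 by simp, ← ENNReal.ofReal_mul zero_le_two]
    refine ENNReal.ofReal_le_ofReal ?_
    nlinarith [norm_add_le (modeKernel M P₁ p) (modeKernel M P₂ p),
      norm_nonneg (modeKernel M P₁ p + modeKernel M P₂ p),
      sq_nonneg (‖modeKernel M P₁ p‖ - ‖modeKernel M P₂ p‖)]
  calc _ ≤ ∫⁻ p, (2 * ‖modeKernel M P₁ p‖ₑ ^ 2 + 2 * ‖modeKernel M P₂ p‖ₑ ^ 2)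
          ∂(modeMeasure δ M).prod (modeMeasure δ M) := lintegral_mono hpt
    _ = 2 * (∫⁻ p, ‖modeKernel M P₁ p‖ₑ ^ 2 ∂(modeMeasure δ M).prod (modeMeasure δ M)) +
        2 * ∫⁻ p, ‖modeKernel M P₂ p‖ₑ ^ 2 ∂(modeMeasure δ M).prod (modeMeasure δ M) := by
        have n1 := ((measurable_modeKernel (M := M) hP₁).enorm.pow_const 2)
        have n2 := ((measurable_modeKernel (M := M) hP₂).enorm.pow_const 2)
        rw [lintegral_add_left (n1.const_mul 2), lintegral_const_mul _ n1,
          lintegral_const_mul _ n2]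
    _ ≤ 2 * ENNReal.ofReal (C * Θ * lam ^ (2 * (-1 + 2 * δ))) +
        2 * ENNReal.ofReal (C * Θ * lam ^ (2 * (-1 + 2 * δ))) := by gcongr
    _ = ENNReal.ofReal (4 * (C * Θ * lam ^ (2 * (-1 + 2 * δ)))) := by
        rw [← two_mul, ← mul_assoc, ENNReal.ofReal_mul (p := 4) (by norm_num)]
        norm_num
    _ ≤ _ := by
        refine ENNReal.ofReal_le_ofReal ?_
        have e1 : (ε ^ (ν / 4)) ^ 2 = ε ^ (ν / 2) := by
          rw [← Real.rpow_natCast, ← Real.rpow_mul hε.le]; congr 1; push_cast; ring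
        have e2 : (lam ^ (-1 + 2 * δ - ν)) ^ 2 = lam ^ (-(2 * ν)) * lam ^ (2 * (-1 + 2 * δ)) := by
          rw [← Real.rpow_natCast, ← Real.rpow_mul hl0.le, ← Real.rpow_add hl0]
          congr 1; push_cast; ring
        have e3 : ∀ x y z : ℝ, (√C * x * y * z) ^ 2 = C * x ^ 2 * y ^ 2 * z ^ 2 := by
          intro x y z
          rw [mul_pow, mul_pow, mul_pow, Real.sq_sqrt hC.le]
        rw [e3, e1, e2, hΘ]
        calc _ = C * (32 * (2 + M) * S ^ 2 * 2) ^ 2 * ε ^ (ν / 2) *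
              (lam ^ (-(2 * ν)) * lam ^ (2 * (-1 + 2 * δ))) := by ring
          _ ≤ _ := by
            gcongr
            linarith

end Rate

/-! ### The mollified integrated noises at a point -/

section PointVectors

variable {δ M S : ℝ} {G : Spacetime → ℝ} {H : ℤ × ℤ → ℝ → ℂ}

theorem mollifiedProfile_eq_integral_spatialFT {r : Spacetime → ℝ} (hr : Integrable r)
    (hH : IsHeatLike M S H) (k : ℤ × ℤ) (τ : ℝ) :
    mollifiedProfile r H k τ = ∫ s, spatialFT (fun w => (r w : ℂ)) s k * H k (τ + s) := by
  have hm : Measurable fun w : Spacetime => phase k w.2 * H k (τ + w.1) := by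
    have h1 := hH.meas k
    have h2 := (continuous_phase k).measurable
    fun_prop
  have h : Integrable fun w : Spacetime => (r w : ℂ) * (phase k w.2 * H k (τ + w.1)) := by
    refine hr.ofReal.mul_bdd (c := S) hm.aestronglyMeasurable (Eventually.of_forall fun w => ?_)
    rw [norm_mul, norm_phase, one_mul]
    exact hH.norm_le _ _
  rw [mollifiedProfile, Measure.volume_eq_prod, integral_prod _ h]
  refine integral_congr_ae (Eventually.of_forall fun s => ?_)
  simp only [spatialFT]
  rw [← integral_mul_const]
  refine integral_congr_ae (Eventually.of_forall fun x => ?_)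
  simp only
  ring

/-- For a fixed mollifier, the mollified profile and its `L¹` norm are of order `ω_k⁻³`: the
mollification averages in time, which bounds both by the `L¹` norm of the profile, of order `ω_k⁻²`,
and the Fourier transform of the mollifier contributes a factor `ω_k⁻¹`. -/
theorem exists_lintegral_mollified_sq_le (hM : 0 < M) (hH : IsHeatLike M S H) {r : Spacetime → ℝ}
    (hr : ContDiff ℝ ∞ r) (hc : HasCompactSupport r) :
    ∃ D : ℝ, 0 ≤ D ∧ ∀ k, ∫⁻ τ, ‖mollifiedProfile r H k τ‖ₑ ^ 2 ≤
      ENNReal.ofReal (D * (freq M k ^ 6)⁻¹) := by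
  have hS0 := (norm_nonneg _).trans (hH.norm_le 0 0)
  have hsm : ContDiff ℝ 1 fun w => (r w : ℂ) :=
    Complex.ofRealCLM.contDiff.comp (hr.of_le (by exact_mod_cast le_top))
  obtain ⟨R, A, hR, hb⟩ := exists_isBump_of_hasCompactSupport hsm
    (hc.comp_left (g := fun x : ℝ => (x : ℂ)) Complex.ofReal_zero)
  have hA0 := (norm_nonneg _).trans (hb.norm_le 0)
  have hri : Integrable r := hr.continuous.integrable_of_hasCompactSupport hc
  have hm : ∀ k, Measurable fun s => spatialFT (fun w => (r w : ℂ)) s k := fun k =>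
    measurable_spatialFT hsm.continuous.measurable k
  set B : ℝ := 4 * R ^ 2 * A * (2 + 1 * M) with hB
  have hB0 : 0 ≤ B := by positivity
  refine ⟨2 * R * B ^ 2 * S ^ 2, by positivity, fun k => ?_⟩
  have hk := freq_pos hM k
  have hdec : decay M 1 k ≤ (freq M k)⁻¹ := by
    rw [decay, one_mul]; exact min_le_right _ _
  have hd0 := decay_nonneg hM one_pos k
  have hHk := hH.meas k
  have hpt : ∀ τ, ‖mollifiedProfile r H k τ‖ₑ ≤
      ∫⁻ s, ‖spatialFT (fun w => (r w : ℂ)) s k‖ₑ * ‖H k (τ + s)‖ₑ := by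
    intro τ
    rw [mollifiedProfile_eq_integral_spatialFT hri hH]
    refine (enorm_integral_le_lintegral_enorm _).trans_eq (lintegral_congr fun s => ?_)
    rw [enorm_mul]
  have hsup : ∀ τ, ‖mollifiedProfile r H k τ‖ₑ ≤
      ENNReal.ofReal (B * (freq M k)⁻¹ * (S * (freq M k ^ 2)⁻¹)) := by
    intro τ
    calc _ ≤ ∫⁻ s, ENNReal.ofReal (B * (freq M k)⁻¹) * ‖H k (τ + s)‖ₑ := by
          refine (hpt τ).trans (lintegral_mono fun s => ?_)
          refine mul_le_mul' ?_ le_rfl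
          exact ofReal_norm_le ((hb.norm_spatialFT_le_decay hM hR.le one_pos s k).trans
            (mul_le_mul_of_nonneg_left hdec hB0))
      _ = ENNReal.ofReal (B * (freq M k)⁻¹) * ∫⁻ s, ‖H k s‖ₑ := by
          rw [lintegral_const_mul _ (by fun_prop),
            lintegral_add_left_eq_self (fun s => ‖H k s‖ₑ)]
      _ ≤ _ := by
          rw [ENNReal.ofReal_mul (p := B * (freq M k)⁻¹) (by positivity)]
          exact mul_le_mul' le_rfl (hH.lintegral_le k)
  have hint : ∫⁻ τ, ‖mollifiedProfile r H k τ‖ₑ ≤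
      ENNReal.ofReal (2 * R * (B * (freq M k)⁻¹) * (S * (freq M k ^ 2)⁻¹)) := by
    have h1 := hb.lintegral_spatialFT_pow_le hM hR.le one_pos k 1 one_ne_zero
    simp only [pow_one] at h1
    calc _ ≤ ∫⁻ τ, ∫⁻ s, ‖spatialFT (fun w => (r w : ℂ)) s k‖ₑ * ‖H k (τ + s)‖ₑ :=
          lintegral_mono hpt
      _ = ∫⁻ s, ‖spatialFT (fun w => (r w : ℂ)) s k‖ₑ * ∫⁻ τ, ‖H k τ‖ₑ := by
          rw [lintegral_lintegral_swap (by have := hm k; fun_prop)]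
          refine lintegral_congr fun s => ?_
          rw [lintegral_const_mul _ (by fun_prop),
            lintegral_add_right_eq_self (fun s => ‖H k s‖ₑ)]
      _ = (∫⁻ s, ‖spatialFT (fun w => (r w : ℂ)) s k‖ₑ) * ∫⁻ τ, ‖H k τ‖ₑ :=
          lintegral_mul_const _ (hm k).enorm
      _ ≤ ENNReal.ofReal (2 * R * (B * decay M 1 k)) * ENNReal.ofReal (S * (freq M k ^ 2)⁻¹) :=
          mul_le_mul' h1 (hH.lintegral_le k)
      _ ≤ _ := by
          rw [← ENNReal.ofReal_mul (by positivity)]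
          refine ENNReal.ofReal_le_ofReal ?_
          gcongr
  have hmm := measurable_mollifiedProfile hr.continuous.measurable hH.meas k
  calc _ ≤ ∫⁻ τ, ENNReal.ofReal (B * (freq M k)⁻¹ * (S * (freq M k ^ 2)⁻¹)) *
        ‖mollifiedProfile r H k τ‖ₑ := by
        refine lintegral_mono fun τ => ?_
        rw [sq]
        gcongr
        exact hsup τ
    _ = ENNReal.ofReal (B * (freq M k)⁻¹ * (S * (freq M k ^ 2)⁻¹)) *
        ∫⁻ τ, ‖mollifiedProfile r H k τ‖ₑ := lintegral_const_mul _ hmm.enorm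
    _ ≤ ENNReal.ofReal (B * (freq M k)⁻¹ * (S * (freq M k ^ 2)⁻¹)) *
        ENNReal.ofReal (2 * R * (B * (freq M k)⁻¹) * (S * (freq M k ^ 2)⁻¹)) := by gcongr
    _ = _ := by
        rw [← ENNReal.ofReal_mul (by positivity)]
        congr 1
        field_simp

/-- A square integrable profile whose `L²` norm is of order `ω_k⁻³` gives vectors of `𝔥` with
norms that are bounded uniformly in the base point. -/
theorem exists_lintegral_vec_le (hδ : 0 < δ) (hM : 0 < M) (hH : ∀ k, Measurable (H k)) {D : ℝ}
    (hD0 : 0 ≤ D)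
    (hD : ∀ k, ∫⁻ τ, ‖H k τ‖ₑ ^ 2 ≤ ENNReal.ofReal (D * (freq M k ^ 6)⁻¹)) :
    ∃ c : ℝ, 0 ≤ c ∧ ∀ (v : Mode → ℂ) (z : Spacetime),
      (∀ p, ‖v p‖ ≤ freq M p.2.1 * ‖H p.2.1 (z.1 - p.1)‖) →
      ∫⁻ p, ‖v p‖ₑ ^ 2 ∂modeMeasure δ M ≤ ENNReal.ofReal (c ^ 2) := by
  obtain ⟨C, hC, h⟩ := exists_sum_high_le hM (by linarith : 2 < 5 + 2 * δ)
  refine ⟨√(4 * D * (C * (M / 2) ^ (2 - (5 + 2 * δ)))), by positivity, fun v z hv => ?_⟩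
  have hf := freq_pos hM
  have hpt : ∀ p : Mode, ‖v p‖ₑ ^ 2 ≤
      ENNReal.ofReal (freq M p.2.1 ^ 2) * ‖H p.2.1 (z.1 - p.1)‖ₑ ^ 2 := by
    intro p
    simp only [← ofReal_norm]
    rw [← ENNReal.ofReal_pow (norm_nonneg _), ← ENNReal.ofReal_pow (norm_nonneg _),
      ← ENNReal.ofReal_mul (by positivity), ← mul_pow]
    exact ENNReal.ofReal_le_ofReal (pow_le_pow_left₀ (norm_nonneg _) (hv p) 2)
  have hm : ∀ k, Measurable fun t => ‖H k (z.1 - t)‖ₑ ^ 2 := fun k => by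
    have := hH k; fun_prop
  calc _ ≤ ∫⁻ p, ENNReal.ofReal (freq M p.2.1 ^ 2) * ‖H p.2.1 (z.1 - p.1)‖ₑ ^ 2
        ∂modeMeasure δ M := lintegral_mono hpt
    _ ≤ 4 * ∑' k, ENNReal.ofReal (freq M k ^ (-(1 + 2 * δ))) *
        ∫⁻ t, ENNReal.ofReal (freq M k ^ 2) * ‖H k (z.1 - t)‖ₑ ^ 2 :=
        lintegral_modeMeasure_le (g := fun k t => ENNReal.ofReal (freq M k ^ 2) *
          ‖H k (z.1 - t)‖ₑ ^ 2) fun k => (hm k).const_mul _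
    _ ≤ 4 * ∑' k, ENNReal.ofReal D * (if M / 2 < freq M k then
          ENNReal.ofReal (freq M k ^ (-(5 + 2 * δ))) else 0) := by
        refine mul_le_mul_right (ENNReal.tsum_le_tsum fun k => ?_) _
        have hk := hf k
        rw [lintegral_const_mul _ (hm k), if_pos ((half_lt_self hM).trans_le (le_freq M k)),
          lintegral_sub_left_eq_self (fun s => ‖H k s‖ₑ ^ 2)]
        calc _ ≤ ENNReal.ofReal (freq M k ^ (-(1 + 2 * δ))) * (ENNReal.ofReal (freq M k ^ 2) *
              ENNReal.ofReal (D * (freq M k ^ 6)⁻¹)) := by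
              gcongr
              exact hD k
          _ = _ := by
            rw [← ENNReal.ofReal_mul (by positivity), ← ENNReal.ofReal_mul (by positivity),
              ← ENNReal.ofReal_mul hD0]
            congr 1
            rw [show -(5 + 2 * δ) = -(1 + 2 * δ) - (4 : ℕ) by push_cast; ring,
              Real.rpow_sub hk, Real.rpow_natCast]
            field_simp
    _ ≤ 4 * (ENNReal.ofReal D * ENNReal.ofReal (C * (M / 2) ^ (2 - (5 + 2 * δ)))) := by
        rw [ENNReal.tsum_mul_left]
        gcongr
        exact h (M / 2) (half_pos hM)
    _ = _ := by
        rw [Real.sq_sqrt (by positivity), ← ENNReal.ofReal_mul hD0,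
          show (4 : ℝ≥0∞) = ENNReal.ofReal 4 by simp, ← ENNReal.ofReal_mul (by norm_num)]
        congr 1
        ring

theorem norm_fermionVec_le (hG : IsProfile G H) (z : Spacetime) (j : Fin 2) (p : Mode) :
    ‖fermionVec M G z j p‖ ≤ freq M p.2.1 * ‖H p.2.1 (z.1 - p.1)‖ := by
  have h : 0 ≤ freq M p.2.1 := Real.sqrt_nonneg _
  rw [fermionVec]
  split_ifs
  · rw [norm_mul, hG, norm_mul, norm_phase, one_mul]
    gcongr
    exact norm_neg_diracBarSymbol_add_le M _ _ _
  · rw [norm_zero]; positivity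

theorem norm_antiVec_le (hG : IsProfile G H) (z : Spacetime) (j : Fin 2) (p : Mode) :
    ‖antiVec M G z j p‖ ≤ freq M p.2.1 * ‖H p.2.1 (z.1 - p.1)‖ := by
  have h : 0 ≤ freq M p.2.1 := Real.sqrt_nonneg _
  rw [antiVec]
  split_ifs
  · rw [norm_mul, hG, norm_mul, norm_phase, one_mul]
    gcongr
    exact norm_diracSymbol_add_le M _ _ _
  · rw [norm_zero]; positivity

theorem measurable_of_mode {E X : Type*} [MeasurableSpace E] [MeasurableSpace X]
    (F : (X × ℝ) → (ℤ × ℤ) × Comp → E) (hF : ∀ c, Measurable fun t => F t c) :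
    Measurable fun p : X × Mode => F (p.1, p.2.1) p.2.2 := by
  have h : Measurable (Function.uncurry F) := measurable_from_prod_countable_left hF
  exact h.comp (by fun_prop : Measurable fun p : X × Mode => ((p.1, p.2.1), p.2.2))

theorem measurable_modeCoeff (hG : IsProfile G H) (hH : ∀ k, Measurable (H k)) (k : ℤ × ℤ) :
    Measurable fun q : Spacetime × ℝ => modeCoeff G q.1 q.2 k := by
  have h1 := hH k
  have h2 := (continuous_phase k).measurable
  simp only [hG _ _ _]
  fun_prop

theorem measurable_fermionVec (hG : IsProfile G H) (hH : ∀ k, Measurable (H k)) (j : Fin 2) :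
    Measurable fun q : Spacetime × Mode => fermionVec M G q.1 j q.2 := by
  refine measurable_of_mode (fun t c => fermionVec M G t.1 j (t.2, c)) fun c => ?_
  simp only [fermionVec]
  split_ifs
  · exact (measurable_modeCoeff hG hH c.1).const_mul _
  · exact measurable_const

theorem measurable_antiVec (hG : IsProfile G H) (hH : ∀ k, Measurable (H k)) (j : Fin 2) :
    Measurable fun q : Spacetime × Mode => antiVec M G q.1 j q.2 := by
  refine measurable_of_mode (fun t c => antiVec M G t.1 j (t.2, c)) fun c => ?_
  simp only [antiVec]
  split_ifs
  · exact (measurable_modeCoeff hG hH c.1).const_mul _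
  · exact measurable_const

/-- The vectors at which `Ψ` gives the components of the integrated noises at a point lie in `𝔥`,
and their norms are bounded uniformly in the point. -/
structure HasPointVectors (δ M c : ℝ) (G : Spacetime → ℝ) : Prop where
  fermion_mem : ∀ z j, MemLp (fermionVec M G z j) 2 (modeMeasure δ M)
  anti_mem : ∀ z j, MemLp (antiVec M G z j) 2 (modeMeasure δ M)
  norm_fermion_le : ∀ z j, ‖toOne δ M (fermionVec M G z j)‖ ≤ c
  norm_anti_le : ∀ z j, ‖toOne δ M (antiVec M G z j)‖ ≤ c

theorem exists_hasPointVectors (hδ : 0 < δ) (hM : 0 < M) (hG : IsProfile G H)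
    (hH : ∀ k, Measurable (H k)) {D : ℝ} (hD0 : 0 ≤ D)
    (hD : ∀ k, ∫⁻ τ, ‖H k τ‖ₑ ^ 2 ≤ ENNReal.ofReal (D * (freq M k ^ 6)⁻¹)) :
    ∃ c : ℝ, 0 ≤ c ∧ HasPointVectors δ M c G := by
  obtain ⟨c, hc, h⟩ := exists_lintegral_vec_le hδ hM hH hD0 hD
  have h1 := fun z j => h (fermionVec M G z j) z (norm_fermionVec_le hG z j)
  have h2 := fun z j => h (antiVec M G z j) z (norm_antiVec_le hG z j)
  have m1 : ∀ z j, MemLp (fermionVec M G z j) 2 (modeMeasure δ M) := fun z j =>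
    memLp_two_of_lintegral_sq_le
      ((measurable_fermionVec (M := M) hG hH j).comp measurable_prodMk_left) (h1 z j)
  have m2 : ∀ z j, MemLp (antiVec M G z j) 2 (modeMeasure δ M) := fun z j =>
    memLp_two_of_lintegral_sq_le
      ((measurable_antiVec (M := M) hG hH j).comp measurable_prodMk_left) (h2 z j)
  refine ⟨c, hc, m1, m2, fun z j => ?_, fun z j => ?_⟩
  · rw [toOne, dif_pos (m1 z j)]
    exact norm_toLp_sq_le _ hc (h1 z j)
  · rw [toOne, dif_pos (m2 z j)]
    exact norm_toLp_sq_le _ hc (h2 z j)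

end PointVectors

/-! ### The mollified Wick square as a renormalised product -/

section Renormalised

variable {δ M S c : ℝ} {G : Spacetime → ℝ} {H : ℤ × ℤ → ℝ → ℂ}

/-- The second chaos kernel at a point, as an element of `𝔥 ⊗ 𝔥`. -/
def chaosVector (δ M : ℝ) (G : Spacetime → ℝ) (z : Spacetime) : TwoParticle δ M :=
  ∑ j : Fin 2, tensor (toOne δ M (antiVec M G z j)) (toOne δ M (fermionVec M G z j))

theorem renormalisedProduct_eq (Γ : Filtration (conjU δ M)) (G : Spacetime → ℝ) (z : Spacetime) :
    renormalisedProduct Γ G z = wickSquare Γ (chaosVector δ M G z) := by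
  rw [renormalisedProduct, counterterm, chaosVector, map_sum, ← Finset.sum_sub_distrib]
  exact Finset.sum_congr rfl fun j _ => (isWickSquare_wickSquare Γ _ _).symm

theorem coeFn_chaosVector (h : HasPointVectors δ M c G) (z : Spacetime) :
    chaosVector δ M G z =ᵐ[(modeMeasure δ M).prod (modeMeasure δ M)] chaosKernel M G z := by
  have h1 : ∀ j, (toOne δ M (antiVec M G z j) : Mode → ℂ) =ᵐ[modeMeasure δ M] antiVec M G z j :=
    fun j => by rw [toOne, dif_pos (h.anti_mem z j)]; exact MemLp.coeFn_toLp _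
  have h2 : ∀ j, (toOne δ M (fermionVec M G z j) : Mode → ℂ) =ᵐ[modeMeasure δ M]
      fermionVec M G z j :=
    fun j => by rw [toOne, dif_pos (h.fermion_mem z j)]; exact MemLp.coeFn_toLp _
  have h3 : ∀ j, (tensor (toOne δ M (antiVec M G z j)) (toOne δ M (fermionVec M G z j)) :
      Mode × Mode → ℂ) =ᵐ[(modeMeasure δ M).prod (modeMeasure δ M)]
      fun p => antiVec M G z j p.1 * fermionVec M G z j p.2 := by
    intro j
    filter_upwards [coeFn_tensor (toOne δ M (antiVec M G z j)) (toOne δ M (fermionVec M G z j)),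
      Measure.quasiMeasurePreserving_fst.ae_eq_comp (h1 j),
      Measure.quasiMeasurePreserving_snd.ae_eq_comp (h2 j)] with p p1 p2 p3
    simp only [Function.comp_apply] at p2 p3
    rw [p1, tensorFun, p2, p3]
  rw [chaosVector, Fin.sum_univ_two]
  filter_upwards [Lp.coeFn_add (tensor (toOne δ M (antiVec M G z 0))
    (toOne δ M (fermionVec M G z 0))) (tensor (toOne δ M (antiVec M G z 1))
    (toOne δ M (fermionVec M G z 1))), h3 0, h3 1] with p p1 p2 p3
  rw [p1, Pi.add_apply, p2, p3, chaosKernel, Fin.sum_univ_two]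

theorem norm_chaosVector_le (h : HasPointVectors δ M c G) (z : Spacetime) :
    ‖chaosVector δ M G z‖ ≤ 2 * c ^ 2 := by
  refine (norm_sum_le _ _).trans ?_
  rw [Fin.sum_univ_two, norm_tensor, norm_tensor]
  have h1 := h.norm_anti_le z
  have h2 := h.norm_fermion_le z
  have h3 := (norm_nonneg _).trans (h1 0)
  have e0 := mul_le_mul (h1 0) (h2 0) (norm_nonneg _) h3
  have e1 := mul_le_mul (h1 1) (h2 1) (norm_nonneg _) h3
  linarith

theorem measurable_chaosKernel (hG : IsProfile G H) (hH : ∀ k, Measurable (H k)) :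
    Measurable fun q : Spacetime × (Mode × Mode) => chaosKernel M G q.1 q.2 := by
  unfold chaosKernel
  refine Finset.measurable_fun_sum _ fun j _ => Measurable.mul ?_ ?_
  · exact (measurable_antiVec hG hH j).comp (by fun_prop :
      Measurable fun q : Spacetime × (Mode × Mode) => (q.1, q.2.1))
  · exact (measurable_fermionVec hG hH j).comp (by fun_prop :
      Measurable fun q : Spacetime × (Mode × Mode) => (q.1, q.2.2))

theorem integral_norm_mul_norm_le {X : Type*} [MeasurableSpace X] {μ : Measure X}
    (u v : Lp ℂ 2 μ) :
    Integrable (fun p => ‖u p‖ * ‖v p‖) μ ∧ ∫ p, ‖u p‖ * ‖v p‖ ∂μ ≤ ‖u‖ * ‖v‖ := by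
  have hu := (Lp.memLp u).norm
  have hv := (Lp.memLp v).norm
  refine ⟨hu.integrable_mul hv, ?_⟩
  have h := integral_mul_le_Lp_mul_Lq_of_nonneg (μ := μ) Real.HolderConjugate.two_two
    (f := fun p => ‖u p‖) (g := fun p => ‖v p‖)
    (Eventually.of_forall fun p => norm_nonneg _) (Eventually.of_forall fun p => norm_nonneg _)
    (by simpa using hu) (by simpa using hv)
  refine h.trans_eq ?_
  have e : ∀ w : Lp ℂ 2 μ, (∫ p, ‖w p‖ ^ (2 : ℝ) ∂μ) ^ (1 / (2 : ℝ)) = ‖w‖ := by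
    intro w
    have h0 : 0 ≤ (∫ p, ‖w p‖ ^ (2 : ℝ) ∂μ) ^ (1 / (2 : ℝ)) :=
      Real.rpow_nonneg (integral_nonneg fun p => by positivity) _
    rw [Lp.norm_def, (Lp.memLp w).eLpNorm_eq_integral_rpow_norm two_ne_zero ENNReal.ofNat_ne_top]
    simp only [ENNReal.toReal_ofNat, ← one_div]
    rw [ENNReal.toReal_ofReal h0]
  rw [e, e]

/-- Fubini's theorem: a bounded linear functional of the smeared chaos kernel is the integral of its
values at the chaos kernels at the points. -/
theorem inner_smearedKernel (hG : IsProfile G H) (hH : ∀ k, Measurable (H k))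
    (h : HasPointVectors δ M c G) (η : TestFun)
    (hη : MemLp (smearedKernel M G η) 2 ((modeMeasure δ M).prod (modeMeasure δ M)))
    (u : TwoParticle δ M) :
    Integrable (fun z => η z * inner ℂ u (chaosVector δ M G z)) ∧
      inner ℂ u (toTwo δ M (smearedKernel M G η)) =
        ∫ z, η z * inner ℂ u (chaosVector δ M G z) := by
  set μ := (modeMeasure δ M).prod (modeMeasure δ M) with hμ
  let F : Spacetime → Mode × Mode → ℂ := fun z p =>
    η z * (starRingEnd ℂ (u p) * chaosKernel M G z p)
  have hFm : AEStronglyMeasurable (Function.uncurry F) (volume.prod μ) := by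
    have h1 : AEStronglyMeasurable (fun q : Spacetime × (Mode × Mode) => η q.1)
        (volume.prod μ) := ((testFun_measurable η).comp measurable_fst).aestronglyMeasurable
    have h2 : AEStronglyMeasurable (fun q : Spacetime × (Mode × Mode) => starRingEnd ℂ (u q.2))
        (volume.prod μ) := (Lp.aestronglyMeasurable u).comp_snd.star
    exact h1.mul (h2.mul (measurable_chaosKernel hG hH).aestronglyMeasurable)
  have hFn : ∀ z, (fun p => ‖F z p‖) =ᵐ[μ] fun p => ‖η z‖ * (‖u p‖ * ‖chaosVector δ M G z p‖) := by
    intro z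
    filter_upwards [coeFn_chaosVector h z] with p hp
    simp only [F]
    rw [norm_mul, norm_mul, RCLike.norm_conj, hp]
  have hint : Integrable (Function.uncurry F) (volume.prod μ) := by
    rw [integrable_prod_iff hFm]
    constructor
    · have := hFm.prodMk_left
      filter_upwards [this] with z hz
      rw [← integrable_norm_iff hz]
      exact ((integral_norm_mul_norm_le u _).1.const_mul _).congr (hFn z).symm
    · refine Integrable.mono' (g := fun z => ‖η z‖ * (‖u‖ * (2 * c ^ 2)))
        ((testFun_integrable η).norm.mul_const _) hFm.norm.integral_prod_right'
        (Eventually.of_forall fun z => ?_)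
      rw [Real.norm_of_nonneg (integral_nonneg fun p => norm_nonneg _)]
      calc _ = ∫ p, ‖η z‖ * (‖u p‖ * ‖chaosVector δ M G z p‖) ∂μ := integral_congr_ae (hFn z)
        _ = ‖η z‖ * ∫ p, ‖u p‖ * ‖chaosVector δ M G z p‖ ∂μ := integral_const_mul _ _
        _ ≤ ‖η z‖ * (‖u‖ * ‖chaosVector δ M G z‖) := by
            gcongr; exact (integral_norm_mul_norm_le u _).2
        _ ≤ _ := by
            gcongr; exact norm_chaosVector_le h z
  have hz : ∀ z, ∫ p, F z p ∂μ = η z * inner ℂ u (chaosVector δ M G z) := by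
    intro z
    rw [L2.inner_def, ← integral_const_mul]
    refine integral_congr_ae ?_
    filter_upwards [coeFn_chaosVector h z] with p hp
    rw [hp, RCLike.inner_apply']
  constructor
  · simpa only [hz, Function.uncurry] using hint.integral_prod_left
  · simp only [← hz]
    rw [integral_integral_swap hint, toTwo, dif_pos hη, L2.inner_def]
    refine integral_congr_ae ?_
    filter_upwards [MemLp.coeFn_toLp hη] with p hp
    rw [hp, RCLike.inner_apply', smearedKernel, ← integral_const_mul]
    refine integral_congr_ae (Eventually.of_forall fun z => ?_)
    simp only [F]
    ring

theorem wickProduct_eq_integral (hG : IsProfile G H) (hH : ∀ k, Measurable (H k))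
    (h : HasPointVectors δ M c G) (η : TestFun)
    (hη : MemLp (smearedKernel M G η) 2 ((modeMeasure δ M).prod (modeMeasure δ M)))
    (Γ : Filtration (conjU δ M)) (L : ExtCAR Γ →L[ℂ] ℂ) :
    Integrable (fun z => η z * L (renormalisedProduct Γ G z)) ∧
      L (wickProduct Γ G η) = ∫ z, η z * L (renormalisedProduct Γ G z) := by
  let u : TwoParticle δ M := (InnerProductSpace.toDual ℂ _).symm (L ∘L wickSquare Γ)
  have hu : ∀ F, L (wickSquare Γ F) = inner ℂ u F := fun F =>
    (InnerProductSpace.toDual_symm_apply (x := F) (y := L ∘L wickSquare Γ)).symm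
  simp only [renormalisedProduct_eq, wickProduct, hu]
  exact inner_smearedKernel hG hH h η hη u

end Renormalised

/-! ### The Wick square as a distribution -/

section Distribution

variable {δ M S : ℝ} {G : Spacetime → ℝ} {H : ℤ × ℤ → ℝ → ℂ}

theorem norm_toTwo_smearedKernel_le (hδ : 0 < δ) (hδ' : δ < 1 / 2) (hM : 0 < M)
    (hG : IsProfile G H) (hH : IsHeatLike M S H) {R : ℝ} (hR : 0 ≤ R) :
    ∃ C : ℝ, 0 ≤ C ∧ ∀ (η : TestFun) (A : ℝ), IsBump η 0 R R A 1 → 0 ≤ A →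
      ‖toTwo δ M (smearedKernel M G η)‖ ≤ C * A := by
  obtain ⟨C, hC, h⟩ := exists_lintegral_smeared_le hδ hδ' hM
  refine ⟨√C * (2 * R * (4 * R ^ 2 * (2 + M)) * S ^ 2), by positivity, fun η A hη hA => ?_⟩
  have hmem := memLp_smearedKernel hδ hδ' hM hG hH η
  rw [toTwo, dif_pos hmem]
  refine norm_toLp_sq_le hmem (by positivity) ?_
  rw [smearedKernel_eq hG hH]
  refine (h S H hH η 0 R R A 1 hη hR hR hA one_pos).trans (ENNReal.ofReal_le_ofReal
    (le_of_eq ?_))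
  rw [Real.one_rpow, mul_assoc (√C), mul_pow (√C), Real.sq_sqrt hC.le]
  ring

/-- The smeared chaos kernel, as a linear function of the test function. -/
def smearedLinear (hδ : 0 < δ) (hδ' : δ < 1 / 2) (hM : 0 < M) (hG : IsProfile G H)
    (hH : IsHeatLike M S H) : TestFun →ₗ[ℂ] TwoParticle δ M where
  toFun η := toTwo δ M (smearedKernel M G η)
  map_add' η η' := by
    have h := memLp_smearedKernel hδ hδ' hM hG hH η
    have h' := memLp_smearedKernel hδ hδ' hM hG hH η'
    have e : smearedKernel M G (η + η') = smearedKernel M G η + smearedKernel M G η' := by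
      funext p
      have i := integrable_mul_chaosKernel hG hH (testFun_integrable η) p
      have i' := integrable_mul_chaosKernel hG hH (testFun_integrable η') p
      simp only [smearedKernel, Pi.add_apply]
      rw [← integral_add i i']
      refine integral_congr_ae (Eventually.of_forall fun z => ?_)
      simp only [add_apply]
      ring
    rw [e, toTwo, toTwo, toTwo, dif_pos h, dif_pos h', dif_pos (h.add h'), MemLp.toLp_add]
  map_smul' a η := by
    have h := memLp_smearedKernel hδ hδ' hM hG hH η
    have e : smearedKernel M G (a • η) = a • smearedKernel M G η := by
      funext p
      simp only [smearedKernel, Pi.smul_apply, smul_eq_mul]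
      rw [← integral_const_mul]
      refine integral_congr_ae (Eventually.of_forall fun z => ?_)
      simp only [smul_apply, smul_eq_mul]
      ring
    rw [e, toTwo, toTwo, dif_pos h, dif_pos (h.const_smul a), MemLp.toLp_const_smul,
      RingHom.id_apply]

/-- The smeared chaos kernel depends continuously on the test function: on functions supported in a
fixed compact set, its norm is dominated by the `C¹` norm. -/
theorem exists_smearedCLM (hδ : 0 < δ) (hδ' : δ < 1 / 2) (hM : 0 < M) (hG : IsProfile G H)
    (hH : IsHeatLike M S H) :
    ∃ T : TestFun →L[ℂ] TwoParticle δ M, ∀ η, T η = toTwo δ M (smearedKernel M G η) := by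
  let T := smearedLinear hδ hδ' hM hG hH
  refine ⟨TestFunction.mkCLM ℂ T (map_add T) (fun c f => map_smul T c f) fun K hK => ?_,
    fun η => rfl⟩
  obtain ⟨R, hR⟩ := K.isCompact.isBounded.exists_norm_le
  obtain ⟨C, hC, hbound⟩ := norm_toTwo_smearedKernel_le hδ hδ' hM hG hH (le_max_right R 0)
  let e := TestFunction.ofSupportedInCLM (n := ⊤) (F := ℂ) ℂ hK
  refine (ContDiffMapSupportedIn.mkCLMtoNormedSpace ℂ (fun f => T (e f))
    (fun f g => by rw [map_add, map_add]) (fun c f => by rw [map_smul, map_smul])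
    ⟨{0, 1}, C, hC, fun f => ?_⟩).continuous
  set s : Finset ℕ := {0, 1} with hs
  have hle : ∀ i ∈ s, ∀ w, ‖iteratedFDeriv ℝ i f w‖ ≤
      (s.sup fun i => ContDiffMapSupportedIn.seminorm ℂ Spacetime ℂ ⊤ K i) f := fun i hi w =>
    (ContDiffMapSupportedIn.norm_iteratedFDeriv_apply_le_seminorm_top ℂ).trans
      (Seminorm.le_finset_sup_apply hi)
  refine hbound (e f) _ ⟨(e f).contDiff.of_le (by exact_mod_cast le_top), fun w hw => ?_,
    fun w => ?_, fun w v hv => ?_⟩ (apply_nonneg _ _)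
  · have hwK : w ∈ K := by
      by_contra h
      exact hw (f.zero_on_compl h)
    have h1 := (hR w hwK).trans (le_max_left R 0)
    simp only [Prod.norm_def, sup_le_iff, Real.norm_eq_abs] at h1
    simpa using h1
  · have := hle 0 (by simp [hs]) w
    rwa [norm_iteratedFDeriv_zero] at this
  · have h1 := hle 1 (by simp [hs]) w
    rw [norm_iteratedFDeriv_one] at h1
    rw [one_mul]
    refine (ContinuousLinearMap.le_opNorm _ _).trans (le_trans ?_ h1)
    refine mul_le_of_le_one_right (norm_nonneg _) ?_
    simpa [Prod.norm_def] using hv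

theorem chaosKernel_add_int (hG : IsProfile G H) (z : Spacetime) (k : ℤ × ℤ) (p : Mode × Mode) :
    chaosKernel M G (z + ((0, (k.1 : ℝ), (k.2 : ℝ)) : Spacetime)) p = chaosKernel M G z p := by
  rw [chaosKernel_eq hG, chaosKernel_eq hG, Prod.snd_add, Prod.fst_add, add_zero, phase_add]
  simp only
  rw [phase_int, mul_one]

theorem smearedKernel_translate (hG : IsProfile G H) (k : ℤ × ℤ) (η : TestFun) :
    smearedKernel M G (scaleTest 1 (0, k.1, k.2) η) = smearedKernel M G η := by
  funext p
  have : (volume : Measure Spacetime).IsAddRightInvariant :=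
    inferInstanceAs ((volume : Measure ℝ).prod (volume : Measure (ℝ × ℝ))).IsAddRightInvariant
  have h := integral_add_right_eq_self (μ := (volume : Measure Spacetime))
    (fun z => scaleTest 1 (0, k.1, k.2) η z * chaosKernel M G z p) (0, k.1, k.2)
  rw [smearedKernel, smearedKernel, ← h]
  refine integral_congr_ae (Eventually.of_forall fun z => ?_)
  simp only [chaosKernel_add_int hG]
  congr 1
  change (((1 ^ 4)⁻¹ : ℝ) : ℂ) * η _ = η z
  simp

/-- The second term of the norm is the first one at `λ = 1`, whence the factor `2`. -/
theorem holderNorm_le {E : Type*} {p : E → ℝ} {α C : ℝ} (hα : α < 0) (hC : 0 ≤ C)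
    {K : Set Spacetime} {ξ : TestFun → E}
    (h : ∀ r : ℕ, 1 ≤ r → ∀ η ∈ testBall r, ∀ z, ∀ lam ∈ Set.Ioc (0 : ℝ) 1,
      p (ξ (scaleTest lam z η)) ≤ C * lam ^ α) :
    holderNorm p α K ξ ≤ ENNReal.ofReal (2 * C) := by
  have hr : 1 ≤ (-⌊α⌋).toNat := by
    have : ⌊α⌋ < 0 := Int.floor_lt.2 (by simpa using hα)
    omega
  rw [holderNorm, two_mul, ENNReal.ofReal_add hC hC]
  refine add_le_add (iSup₂_le fun z _ => iSup₂_le fun η hη => iSup₂_le fun lam hl =>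
    ENNReal.ofReal_le_ofReal ?_) (iSup₂_le fun z _ => iSup₂_le fun η hη =>
    ENNReal.ofReal_le_ofReal ?_)
  · calc _ ≤ lam ^ (-α) * (C * lam ^ α) := by
          gcongr
          · exact Real.rpow_nonneg hl.1.le _
          · exact h _ hr η hη z lam hl
      _ = C * (lam ^ (-α) * lam ^ α) := by ring
      _ = C := by rw [← Real.rpow_add hl.1]; simp
  · simpa using h _ hr η hη z 1 (by simp)

theorem memHolder_wickProduct (hδ : 0 < δ) (hδ' : δ < 1 / 2) (hM : 0 < M) (hG : IsProfile G H)
    (hH : IsHeatLike M S H) (Γ : Filtration (conjU δ M)) {α : ℝ} (hα : α ≤ -1 + 2 * δ) :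
    MemHolder Γ α (wickProduct Γ G) := by
  refine ⟨?_, fun k η => ?_, fun n K _ => ?_⟩
  · obtain ⟨T, hT⟩ := exists_smearedCLM hδ hδ' hM hG hH
    exact ⟨wickSquare Γ ∘L T, fun η => by rw [ContinuousLinearMap.comp_apply, hT, wickProduct]⟩
  · rw [wickProduct, wickProduct, smearedKernel_translate hG]
  · obtain ⟨C, hC, h⟩ := exists_norm_smeared_scaleTest_le hδ hδ' hM S
    have hw := wickConst_nonneg (by norm_num : (0 : ℝ) ≤ 8) n
    refine (holderNorm_le (C := wickConst 8 n * C) (by linarith) (by positivity)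
      fun r hr η hη z lam hl => ?_).trans_lt ENNReal.ofReal_lt_top
    calc _ ≤ wickConst 8 n * ‖toTwo δ M (smearedKernel M G (scaleTest lam z η))‖ :=
          extNorm_wickSquare_le Γ n _
      _ ≤ wickConst 8 n * (C * lam ^ (-1 + 2 * δ)) := by
          gcongr; exact h G H hG hH r hr η hη z lam hl
      _ ≤ wickConst 8 n * (C * lam ^ α) := by
          gcongr wickConst 8 n * (C * ?_)
          exact Real.rpow_le_rpow_of_exponent_ge hl.1 hl.2 hα
      _ = _ := by ring

theorem exists_holderNorm_sub_le (hδ : 0 < δ) (hδ' : δ < 1 / 2) (hM : 0 < M) (S : ℝ) (n : ℕ) :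
    ∃ C : ℝ, 0 < C ∧ ∀ (G G' : Spacetime → ℝ) (H H' : ℤ × ℤ → ℝ → ℂ), IsProfile G H →
      IsProfile G' H' → IsHeatLike M S H → IsHeatLike M S H' → ∀ ε : ℝ, 0 < ε →
      (∀ k, ∫⁻ τ, ‖H k τ - H' k τ‖ₑ ≤ ENNReal.ofReal (S * (ε ^ 2 + ε * (freq M k)⁻¹))) →
      ∀ (Γ : Filtration (conjU δ M)) (ν : ℝ), 0 < ν → ν ≤ 1 → ∀ K : Set Spacetime,
      holderNorm (extNorm Γ n) (-1 + 2 * δ - ν) K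
        (fun η => wickProduct Γ G η - wickProduct Γ G' η) ≤ ENNReal.ofReal (C * ε ^ (ν / 4)) := by
  obtain ⟨C, hC, h⟩ := exists_norm_smeared_sub_le hδ hδ' hM (S := S)
  have hw := wickConst_nonneg (by norm_num : (0 : ℝ) ≤ 8) n
  refine ⟨2 * ((wickConst 8 n + 1) * C), by positivity,
    fun G G' H H' hG hG' hH hH' ε hε hd Γ ν hν hν' K => ?_⟩
  refine (holderNorm_le (C := (wickConst 8 n + 1) * (C * ε ^ (ν / 4))) (by linarith) (by positivity)
    fun r hr η hη z lam hl => ?_).trans_eq (by congr 1; ring)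
  have hb := h G G' H H' hG hG' hH hH' ε hε hd ν hν hν' r hr η hη z lam hl
  simp only [wickProduct]
  rw [← map_sub]
  calc _ ≤ wickConst 8 n * ‖toTwo δ M (smearedKernel M G (scaleTest lam z η)) -
        toTwo δ M (smearedKernel M G' (scaleTest lam z η))‖ := extNorm_wickSquare_le Γ n _
    _ ≤ (wickConst 8 n + 1) * (C * ε ^ (ν / 4) * lam ^ (-1 + 2 * δ - ν)) := by
        gcongr
        linarith
    _ = _ := by ring

end Distribution

end FermionicWick

end

theorem mainTheorem4 (δ M : ℝ) (hδ : 0 < δ) (hδ' : δ < 1 / 2) (hM : 0 < M)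
    (ρ : FermionicWick.Spacetime → ℝ) (hρ : FermionicWick.IsMollifier ρ)
    (φ : ℝ × ℝ → ℝ) (χ : ℝ → ℝ) (hcut : FermionicWick.IsCutoff φ χ) :
    let G : FermionicWick.Spacetime → ℝ := FermionicWick.transposedKernel M φ χ
    let Gε : ℝ → FermionicWick.Spacetime → ℝ := fun ε => FermionicWick.mollify ρ ε G
    -- the objects are well defined: the second Wick power exists and is unique, the limiting and
    -- the mollified chaos kernels take values in `𝔥 ⊗ 𝔥`, the mollified vectors lie in `𝔥`
    (∀ Γ : FermionicWick.Filtration (FermionicWick.conjU δ M),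
      (∃! W, FermionicWick.IsWickSquare Γ W) ∧
        FermionicWick.IsWickSquare Γ (FermionicWick.wickSquare Γ)) ∧
    (∀ η : FermionicWick.TestFun,
      (∀ᵐ p ∂(FermionicWick.modeMeasure δ M).prod (FermionicWick.modeMeasure δ M),
        Integrable fun z => η z * FermionicWick.chaosKernel M G z p) ∧
      MemLp (FermionicWick.smearedKernel M G η) 2
        ((FermionicWick.modeMeasure δ M).prod (FermionicWick.modeMeasure δ M))) ∧
    (∀ ε : ℝ, 0 < ε → ∀ η : FermionicWick.TestFun,
      (∀ᵐ p ∂(FermionicWick.modeMeasure δ M).prod (FermionicWick.modeMeasure δ M),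
        Integrable fun z => η z * FermionicWick.chaosKernel M (Gε ε) z p) ∧
      MemLp (FermionicWick.smearedKernel M (Gε ε) η) 2
        ((FermionicWick.modeMeasure δ M).prod (FermionicWick.modeMeasure δ M))) ∧
    (∀ ε : ℝ, 0 < ε → ∀ (z : FermionicWick.Spacetime) (j : Fin 2),
      MemLp (FermionicWick.fermionVec M (Gε ε) z j) 2 (FermionicWick.modeMeasure δ M) ∧
      MemLp (FermionicWick.antiVec M (Gε ε) z j) 2 (FermionicWick.modeMeasure δ M)) ∧
    -- the mollified Wick square is the renormalised product of the mollified integrated noises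
    (∀ (Γ : FermionicWick.Filtration (FermionicWick.conjU δ M)) (ε : ℝ), 0 < ε →
      ∀ (η : FermionicWick.TestFun) (L : FermionicWick.ExtCAR Γ →L[ℂ] ℂ),
        Integrable (fun z => η z * L (FermionicWick.renormalisedProduct Γ (Gε ε) z)) ∧
        L (FermionicWick.wickProduct Γ (Gε ε) η) =
          ∫ z, η z * L (FermionicWick.renormalisedProduct Γ (Gε ε) z)) ∧
    -- regularity of the Wick square
    (∀ Γ : FermionicWick.Filtration (FermionicWick.conjU δ M),
      FermionicWick.MemHolder Γ (-1 + 2 * δ) (FermionicWick.wickProduct Γ G)) ∧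
    -- the rate
    (∀ n : ℕ, ∃ C : ℝ, 0 < C ∧
      ∀ (Γ : FermionicWick.Filtration (FermionicWick.conjU δ M)) (ν : ℝ), 0 < ν → ν ≤ 1 →
      ∀ ε : ℝ, 0 < ε → ε ≤ 1 →
        FermionicWick.holderNorm (FermionicWick.extNorm Γ n) (-1 + 2 * δ - ν) Set.univ
            (fun η => FermionicWick.wickProduct Γ G η - FermionicWick.wickProduct Γ (Gε ε) η) ≤
          ENNReal.ofReal (C * ε ^ (ν / 4))) ∧
    -- convergence
    (∀ (Γ : FermionicWick.Filtration (FermionicWick.conjU δ M)) (ν : ℝ), 0 < ν → ν ≤ 1 →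
      FermionicWick.MemHolder Γ (-1 + 2 * δ - ν) (FermionicWick.wickProduct Γ G) ∧
      (∀ ε : ℝ, 0 < ε →
        FermionicWick.MemHolder Γ (-1 + 2 * δ - ν) (FermionicWick.wickProduct Γ (Gε ε))) ∧
      ∀ (n : ℕ) (K : Set FermionicWick.Spacetime), IsCompact K →
        Tendsto (fun ε => FermionicWick.holderNorm (FermionicWick.extNorm Γ n) (-1 + 2 * δ - ν) K
          (fun η => FermionicWick.wickProduct Γ G η - FermionicWick.wickProduct Γ (Gε ε) η))
          (𝓝[>] 0) (𝓝 0)) := by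
  intro G Gε
  have hG := FermionicWick.isProfile_transposedKernel (M := M) hcut
  have hH := FermionicWick.isHeatLike_heatProfile hM hcut
  have hGε := fun ε (hε : 0 < ε) => FermionicWick.isProfile_mollify (M := M) hcut hρ hε
  have hHε := fun ε (hε : 0 < ε) => hH.mollified hρ hε
  have hvec : ∀ ε : ℝ, 0 < ε → ∃ c, FermionicWick.HasPointVectors δ M c (Gε ε) := by
    intro ε hε
    obtain ⟨D, hD, h⟩ := FermionicWick.exists_lintegral_mollified_sq_le hM hH
      (FermionicWick.contDiff_rescale hρ ε) (FermionicWick.hasCompactSupport_rescale hρ hε)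
    obtain ⟨c, -, hc⟩ := FermionicWick.exists_hasPointVectors hδ hM (hGε ε hε)
      (hHε ε hε).meas hD h
    exact ⟨c, hc⟩
  obtain ⟨C₀, hC₀, hdiff⟩ := FermionicWick.exists_lintegral_mollified_sub_le hM hcut hρ
  -- a constant that serves for the bounds of both profiles and of their difference
  set S : ℝ := max C₀ (max 1 (FermionicWick.mollifierMass ρ * 1)) with hS
  have hHS : FermionicWick.IsHeatLike M S (FermionicWick.heatProfile M χ) :=
    hH.mono ((le_max_left _ _).trans (le_max_right _ _))
  have hHεS := fun ε (hε : 0 < ε) =>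
    (hHε ε hε).mono (S' := S) ((le_max_right _ _).trans (le_max_right _ _))
  have hrate : ∀ n : ℕ, ∃ C : ℝ, 0 < C ∧ ∀ (Γ : FermionicWick.Filtration
      (FermionicWick.conjU δ M)) (ν : ℝ), 0 < ν → ν ≤ 1 → ∀ ε : ℝ, 0 < ε → ∀ K,
      FermionicWick.holderNorm (FermionicWick.extNorm Γ n) (-1 + 2 * δ - ν) K
        (fun η => FermionicWick.wickProduct Γ G η - FermionicWick.wickProduct Γ (Gε ε) η) ≤
      ENNReal.ofReal (C * ε ^ (ν / 4)) := by
    intro n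
    obtain ⟨C, hC, h⟩ := FermionicWick.exists_holderNorm_sub_le hδ hδ' hM S n
    refine ⟨C, hC, fun Γ ν hν hν' ε hε K => h G (Gε ε) _ _ hG (hGε ε hε) hHS (hHεS ε hε) ε hε
      (fun k => (hdiff ε hε k).trans (ENNReal.ofReal_le_ofReal ?_)) Γ ν hν hν' K⟩
    have := FermionicWick.freq_pos hM k
    gcongr
    exact le_max_left _ _
  refine ⟨fun Γ => ⟨⟨FermionicWick.wickSquare Γ, FermionicWick.isWickSquare_wickSquare Γ,
    fun W hW => hW.unique (FermionicWick.isWickSquare_wickSquare Γ)⟩,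
    FermionicWick.isWickSquare_wickSquare Γ⟩, fun η => ⟨?_, ?_⟩, fun ε hε η => ⟨?_, ?_⟩,
    fun ε hε z j => ?_, fun Γ ε hε η L => ?_, fun Γ => ?_, fun n => ?_, fun Γ ν hν hν' =>
    ⟨?_, fun ε hε => ?_, fun n K hK => ?_⟩⟩
  · exact Eventually.of_forall fun p => FermionicWick.integrable_mul_chaosKernel hG hH
      (FermionicWick.testFun_integrable η) p
  · exact FermionicWick.memLp_smearedKernel hδ hδ' hM hG hH η
  · exact Eventually.of_forall fun p => FermionicWick.integrable_mul_chaosKernel (hGε ε hε)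
      (hHε ε hε) (FermionicWick.testFun_integrable η) p
  · exact FermionicWick.memLp_smearedKernel hδ hδ' hM (hGε ε hε) (hHε ε hε) η
  · obtain ⟨c, hc⟩ := hvec ε hε
    exact ⟨hc.fermion_mem z j, hc.anti_mem z j⟩
  · obtain ⟨c, hc⟩ := hvec ε hε
    exact FermionicWick.wickProduct_eq_integral (hGε ε hε) (hHε ε hε).meas hc η
      (FermionicWick.memLp_smearedKernel hδ hδ' hM (hGε ε hε) (hHε ε hε) η) Γ L
  · exact FermionicWick.memHolder_wickProduct hδ hδ' hM hG hH Γ le_rfl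
  · obtain ⟨C, hC, h⟩ := hrate n
    exact ⟨C, hC, fun Γ ν hν hν' ε hε _ => h Γ ν hν hν' ε hε Set.univ⟩
  · exact FermionicWick.memHolder_wickProduct hδ hδ' hM hG hH Γ (by linarith)
  · exact FermionicWick.memHolder_wickProduct hδ hδ' hM (hGε ε hε) (hHε ε hε) Γ (by linarith)
  · obtain ⟨C, hC, h⟩ := hrate n
    have hlim : Tendsto (fun ε : ℝ => ENNReal.ofReal (C * ε ^ (ν / 4))) (𝓝[>] 0) (𝓝 0) := by
      have h1 : Tendsto (fun ε : ℝ => C * ε ^ (ν / 4)) (𝓝 0) (𝓝 0) := by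
        have h2 := (Real.continuousAt_rpow_const (0 : ℝ) (ν / 4)
          (Or.inr (by positivity))).tendsto.const_mul C
        simpa [Real.zero_rpow (by positivity : ν / 4 ≠ 0)] using h2
      simpa using ENNReal.tendsto_ofReal (h1.mono_left nhdsWithin_le_nhds)
    refine tendsto_of_tendsto_of_tendsto_of_le_of_le' tendsto_const_nhds hlim
      (Eventually.of_forall fun _ => zero_le) ?_
    filter_upwards [self_mem_nhdsWithin] with ε hε
    exact h Γ ν hν hν' ε hε K
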